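/- **Definitions.** Let $n\ge 2$. For a finite set $X\subset\mathbb R^n$ and a weight function $w:X\to\mathbb R_{>0}$, let $\{r_1,\dots,r_p\}=\{\|x\| : x\in X\}$ (with $r_i$ distinct), let $S_i$ be the sphere of radius $r_i$ centred at the origin, $S=S_1\cup\dots\cup S_p$, $X_i=X\cap S_i$ and $w(X_i)=\sum_{x\in X_i}w(x)$. The pair $(X,w)$ is a *Euclidean $t$-design* if $$\sum_{i=1}^p\frac{w(X_i)}{|S_i|}\int_{S_i}f\,d\sigma_i=\sum_{x\in X}w(x)f(x)$$ for every real polynomial $f$ in $n$ variables of degree at most $t$, where $\sigma_i$ is the surface measure of $S_i$ and $|S_i|=\sigma_i(S_i)$. Let $\mathcal P_4^*(S)$ be the space of restrictions to $S$ of the real polynomials all of whose terms have degree $0$, $2$ or $4$. A *tight $9$-design on $2$ concentric spheres of positive radii* is a Euclidean $9$-design with $p=2$, $r_1,r_2>0$ and $|X|=2\dim\mathcal P_4^*(S)$. Let $Q_{l,n-1}$ be the Gegenbauer polynomial of degree $l$ of parameter $\frac{n-2}{2}$ (the Chebyshev polynomial if $n=2$), normalized so that $Q_{l,n-1}(1)$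 is the dimension of the space of homogeneous harmonic polynomials of degree $l$ in $n$ variables. Weighted finite sets $(X,w)$ and $(Y,v)$ are *similar* if there are a linear isometry $g$ and constants $b,c>0$ such that $Y=\{c\,g(x):x\in X\}$ and $v(c\,g(x))=b\,w(x)$ for all $x\in X$. **Theorem.** Let $n\ge 2$, and let $(X,w)$, $X=X_1\cup X_2$, be a tight $9$-design on $2$ concentric spheres of positive radii $r_1\ne r_2$ in $\mathbb R^n$. Then: 1. $X$ is antipodal, that is, $-x\in X$ for every $x\in X$. 2. For all $x\in X_1$ and $y\in X_2$, the number $\frac{x\cdot y}{r_1r_2}$ is a zero of $Q_{4,n-1}$, where explicitly $$Q_{4,n-1}(x)=\frac{n(n+6)}{24}\bigl((n+4)(n+2)x^4-6(n+2)x^2+3\bigr).$$ 3. $n=2$, and there is $w_1>0$ such that $(X,w)$ is similar to $Y=Y_1\cup Y_2$, where $$Y_1=\Bigl\{r_1(\cos\theta_k,\sin\theta_k) : \theta_k=\tfrac{2k\pi}{8},\ 0\le k\le 7\Bigr\},\qquad Y_2=\Bigl\{r_2(\cos\theta_k,\sin\theta_k) : \theta_k=\tfrac{(2k+1)\pi}{8},\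 0\le k\le 7\Bigr\},$$ with weight $w_1$ on $Y_1$ and $\frac{r_1^8}{r_2^8}w_1$ on $Y_2$. In particular no such design exists for $n\ge 3$. Conversely, for any positive reals $r_1\ne r_2$ and $w_1>0$, the weighted set $Y\subset\mathbb R^2$ above is a tight $9$-design on $2$ concentric spheres. -/

import Mathlib

noncomputable section

open MeasureTheory
open scoped Classical

namespace EuclideanDesign

/-- Euclidean space `ℝⁿ`. -/
abbrev E (n : ℕ) : Type := EuclideanSpace ℝ (Fin n)

/-- The value of a polynomial at a point of `ℝⁿ`. -/
def evalAt {n : ℕ} (f : MvPolynomial (Fin n) ℝ) (x : E n) : ℝ :=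
  MvPolynomial.eval (fun i => x i) f

/-- The set of the lengths of the vectors in `X`. -/
def radii {n : ℕ} (X : Finset (E n)) : Finset ℝ := X.image fun x => ‖x‖

/-- The part of `X` on the sphere of radius `r` around the origin. -/
def layer {n : ℕ} (X : Finset (E n)) (r : ℝ) : Finset (E n) := X.filter fun x => ‖x‖ = r

/-- The union of the spheres around the origin that meet `X`. -/
def sphereUnion {n : ℕ} (X : Finset (E n)) : Set (E n) := {x | ‖x‖ ∈ radii X}

/-- The normalized surface integral `(1/|S|) ∫_S f dσ` over the sphere `S` of radius `r` around
the origin, written as the mean of `u ↦ f (r u)` over the unit sphere with its surface measure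
(for `r = 0` this is the value at the origin). -/
def sphereMean {n : ℕ} (r : ℝ) (f : E n → ℝ) : ℝ :=
  ⨍ u : Metric.sphere (0 : E n) 1, f (r • (u : E n)) ∂((volume : Measure (E n)).toSphere)

/-- `(X, w)` is a Euclidean `t`-design in `ℝⁿ`. -/
structure IsDesign {n : ℕ} (t : ℕ) (X : Finset (E n)) (w : E n → ℝ) : Prop where
  weight_pos : ∀ x ∈ X, 0 < w x
  sum_eq : ∀ f : MvPolynomial (Fin n) ℝ, f.totalDegree ≤ t →
    ∑ r ∈ radii X, (∑ x ∈ layer X r, w x) * sphereMean r (evalAt f) =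
      ∑ x ∈ X, w x * evalAt f x

/-- Restriction of polynomials to functions on a subset `S` of `ℝⁿ`. -/
def restrictTo {n : ℕ} (S : Set (E n)) : MvPolynomial (Fin n) ℝ →ₗ[ℝ] (S → ℝ) where
  toFun f := fun x => evalAt f x
  map_add' f g := by ext x; simp [evalAt]
  map_smul' c f := by ext x; simp [evalAt, MvPolynomial.smul_eval]

/-- The space of the restrictions to `S` of the polynomials of degree at most `e`. -/
def polySpace {n : ℕ} (e : ℕ) (S : Set (E n)) : Submodule ℝ (S → ℝ) :=
  (MvPolynomial.restrictTotalDegree (Fin n) ℝ e).map (restrictTo S)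

/-- The space of the restrictions to `S` of the polynomials all of whose terms have degree at
most `e` and of the same parity as `e`. -/
def polySpaceStar {n : ℕ} (e : ℕ) (S : Set (E n)) : Submodule ℝ (S → ℝ) :=
  (⨆ i ∈ Finset.range (e / 2 + 1),
    MvPolynomial.homogeneousSubmodule (Fin n) ℝ (e - 2 * i)).map (restrictTo S)

/-- Möller's lower bound for the size of a Euclidean `t`-design. -/
def moellerBound {n : ℕ} (t : ℕ) (X : Finset (E n)) : ℕ :=
  if Even t then Module.finrank ℝ (polySpace (t / 2) (sphereUnion X))
  else if Even (t / 2) ∧ (0 : E n) ∈ X then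
    2 * Module.finrank ℝ (polySpaceStar (t / 2) (sphereUnion X)) - 1
  else 2 * Module.finrank ℝ (polySpaceStar (t / 2) (sphereUnion X))

/-- `(X, w)` is a tight `t`-design on `p` concentric spheres in `ℝⁿ`. -/
structure IsTightDesign {n : ℕ} (t p : ℕ) (X : Finset (E n)) (w : E n → ℝ) : Prop where
  design : IsDesign t X w
  card_radii : (radii X).card = p
  card_eq : X.card = moellerBound t X

/-- The Laplace operator on polynomials. -/
def laplacian (n : ℕ) : MvPolynomial (Fin n) ℝ →ₗ[ℝ] MvPolynomial (Fin n) ℝ :=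
  ∑ i : Fin n, (MvPolynomial.pderiv i).toLinearMap ∘ₗ (MvPolynomial.pderiv i).toLinearMap

/-- The homogeneous harmonic polynomials of degree `l` in `n` variables. -/
def harmonicSpace (n l : ℕ) : Submodule ℝ (MvPolynomial (Fin n) ℝ) :=
  MvPolynomial.homogeneousSubmodule (Fin n) ℝ l ⊓ LinearMap.ker (laplacian n)

/-- The Gegenbauer polynomials of parameter `(n - 2) / 2`, with value `1` at `1`, by their
three-term recurrence `(l + n - 2) P_{l+1} = (2 l + n - 2) x P_l - l P_{l-1}`, for `n ≥ 2`
(Chebyshev polynomials for `n = 2`, Legendre polynomials for `n = 3`). -/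
def gegenbauerUnit (n : ℕ) : ℕ → Polynomial ℝ
  | 0 => 1
  | 1 => Polynomial.X
  | l + 2 => Polynomial.C (((l : ℝ) + n - 1)⁻¹) *
      (Polynomial.C (2 * (l : ℝ) + n) * Polynomial.X * gegenbauerUnit n (l + 1) -
        Polynomial.C ((l : ℝ) + 1) * gegenbauerUnit n l)

/-- The Gegenbauer polynomial `Q_{l,n-1}`, normalized so that its value at `1` is the dimension
of the space of homogeneous harmonic polynomials of degree `l` in `n` variables. -/
def gegenbauerQ (n l : ℕ) : Polynomial ℝ :=
  Polynomial.C (Module.finrank ℝ (harmonicSpace n l) : ℝ) * gegenbauerUnit n l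

/-- Weighted finite sets are similar if an orthogonal map followed by a dilation carries one set
to the other and the weights to a constant multiple of the weights. -/
def WeightedSimilar {n m : ℕ} (X : Finset (E n)) (w : E n → ℝ) (Y : Finset (E m))
    (v : E m → ℝ) : Prop :=
  ∃ (g : E n ≃ₗᵢ[ℝ] E m) (c b : ℝ), 0 < c ∧ 0 < b ∧
    X.image (fun x => c • g x) = Y ∧ ∀ x ∈ X, v (c • g x) = b * w x

/-- The regular octagon of radius `r`, rotated by `φ`. -/
def octagon (r φ : ℝ) : Finset (E 2) :=
  (Finset.range 8).image fun k : ℕ =>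
    !₂[r * Real.cos (φ + 2 * k * Real.pi / 8), r * Real.sin (φ + 2 * k * Real.pi / 8)]

/-- Two regular octagons of radii `r₁` and `r₂`, the second rotated by `π / 8`. -/
def octagonPair (r₁ r₂ : ℝ) : Finset (E 2) := octagon r₁ 0 ∪ octagon r₂ (Real.pi / 8)

/-- The weight `w₁` on the first octagon and `(r₁⁸ / r₂⁸) w₁` on the second one. -/
def octagonWeight (r₁ r₂ w₁ : ℝ) (y : E 2) : ℝ :=
  if y ∈ octagon r₁ 0 then w₁ else r₁ ^ 8 / r₂ ^ 8 * w₁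

end EuclideanDesign

end

open EuclideanDesign

noncomputable section

open MeasureTheory
open scoped Classical

namespace EuclideanDesign

variable {n : ℕ}

/-! ### Means over spheres -/

/-! Let V be the space of functions on X given by even quartics. A product of two even quartics and
a linear form l is odd of degree at most 9, so V is orthogonal to lV for the inner product weighted
by w. Restriction from the two spheres to X is injective on even quartics, because the design yields
a reproducing formula (`sum_reproKernel_mul_evalAt`). If l has no zero on X, tightness therefore
says that ℝ^X is the direct sum of V and lV, and multiplication by v/l maps V to itself for every
linear form v (`exists_ratio`). Repeated multiplication by such quotients produces an element of V
supported on {x, -x} (`exists_separating`); testing it against an odd function forces -x ∈ X with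
the same weight.

The kernel K has a special shape. Even quartics split into harmonic parts of degrees 0, 2 and 4. On
two spheres the parts of degrees 0 and 2 can be prescribed independently on each sphere, while the
part of degree 4 occurs only once. So K is a local kernel on each sphere plus one global kernel of
degree 4. Separating functions give 2 w(x) K(x,x) = 1 and K(x,y) = 0 for y ≠ ±x. Between the spheres
only the global part survives, so the cosines are zeros of Q₄ (`zonalFour_eq_zero`). Within a sphere
the weight is constant, the layer is an antipodal 7-design, and the squared cosines satisfy a
quadratic equation with a parameter α (`tightLayer`). The two parameters have sum (n+6)/12, and each
is at least 1/3 (`third_le`).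

For n ≥ 3 arithmetic excludes everything. The roots between the layers involve the square root of
6(n+1)(n+2), which moments show to be rational; hence (n+1)(n+2) = 6K² (`exists_six_mul_sq`). Within
a layer, an adjacency matrix has a rational eigenvalue, which must be an integer; this gives an
integer M for each α (`exists_int`). For the larger α one finds M = K+1, which pins both parameters
so tightly that the other M lies strictly between K+4 and K+5 (`no_solution`; the solution n = 23 is
treated separately).

For n = 2 both parameters equal 1/3, each layer has 8 points at angles that are multiples of π/4
from each other, and the Q₄ condition turns the second octagon by π/8. Conversely, a regular octagon
integrates exactly every degree up to 9 except 8, and the chosen weights make the two errors in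
degree 8 cancel. Explicit separating quartics then show that the cardinality is the tight one. -/

lemma integrable_sphere {f : E n → ℝ} (hf : Continuous f) (r : ℝ) :
    Integrable (fun u : Metric.sphere (0 : E n) 1 => f (r • (u : E n)))
      ((volume : Measure (E n)).toSphere) := by
  apply Continuous.integrable_of_hasCompactSupport
  · fun_prop
  · exact HasCompactSupport.of_compactSpace _

lemma sphereMean_add {f g : E n → ℝ} (hf : Continuous f) (hg : Continuous g) (r : ℝ) :
    sphereMean r (fun x => f x + g x) = sphereMean r f + sphereMean r g := by
  unfold sphereMean
  rw [average_eq, average_eq, average_eq, integral_add (integrable_sphere hf r)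
    (integrable_sphere hg r), smul_add]

lemma sphereMean_const_mul (c : ℝ) (f : E n → ℝ) (r : ℝ) :
    sphereMean r (fun x => c * f x) = c * sphereMean r f := by
  unfold sphereMean
  rw [average_eq, average_eq, integral_const_mul]
  simp only [smul_eq_mul]; ring

lemma sphereMean_sum {ι : Type*} (s : Finset ι) {f : ι → E n → ℝ}
    (hf : ∀ i ∈ s, Continuous (f i)) (r : ℝ) :
    sphereMean r (fun x => ∑ i ∈ s, f i x) = ∑ i ∈ s, sphereMean r (f i) := by
  unfold sphereMean
  simp only [average_eq]
  rw [integral_finsetSum _ fun i hi => integrable_sphere (hf i hi) r, Finset.smul_sum]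

lemma sphereMean_congr {f g : E n → ℝ} {r : ℝ} (hr : 0 ≤ r)
    (h : ∀ x, ‖x‖ = r → f x = g x) : sphereMean r f = sphereMean r g := by
  unfold sphereMean
  congr 1
  ext u
  apply h
  rw [norm_smul, mem_sphere_zero_iff_norm.1 u.2, mul_one, Real.norm_of_nonneg hr]

lemma sphereMean_const (hn : 2 ≤ n) (r c : ℝ) : sphereMean r (fun _ : E n => c) = c := by
  unfold sphereMean
  have : Nontrivial (E n) := by
    have : Nonempty (Fin n) := ⟨⟨0, by omega⟩⟩
    infer_instance
  have : NeZero ((volume : Measure (E n)).toSphere) := ⟨Measure.toSphere_ne_zero _⟩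
  exact average_const _ _

lemma sphereMean_scale (r : ℝ) (f : E n → ℝ) :
    sphereMean r f = sphereMean 1 (fun u => f (r • u)) := by
  simp [sphereMean]

/-- The map of the unit sphere induced by a linear isometry. -/
def sphereMap (φ : E n ≃ₗᵢ[ℝ] E n) (u : Metric.sphere (0 : E n) 1) : Metric.sphere (0 : E n) 1 :=
  ⟨φ u, by simp⟩

lemma measurable_sphereMap (φ : E n ≃ₗᵢ[ℝ] E n) : Measurable (sphereMap φ) := by
  apply Continuous.measurable
  unfold sphereMap
  fun_prop

/-- `toSphere` measures a set by a multiple of the volume of the cone over it. An isometry preserves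
volume and carries cones to cones. -/
lemma map_sphereMap (φ : E n ≃ₗᵢ[ℝ] E n) :
    Measure.map (sphereMap φ) ((volume : Measure (E n)).toSphere) =
      (volume : Measure (E n)).toSphere := by
  ext s hs
  rw [Measure.map_apply (measurable_sphereMap φ) hs, Measure.toSphere_apply' _ hs,
    Measure.toSphere_apply' _ (measurable_sphereMap φ hs)]
  congr 1
  conv_rhs => rw [← φ.measurePreserving.measure_preimage_equiv (f := φ.toMeasurableEquiv)]
  congr 1
  ext x
  simp only [Set.mem_smul, Set.mem_image, Set.mem_preimage]
  constructor
  · rintro ⟨a, ha, _, ⟨u, hu, rfl⟩, rfl⟩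
    exact ⟨a, ha, _, ⟨_, hu, rfl⟩, by simp [sphereMap]⟩
  · rintro ⟨a, ha, _, ⟨u, hu, rfl⟩, h⟩
    refine ⟨a, ha, _, ⟨sphereMap φ.symm u, ?_, rfl⟩, ?_⟩
    · have : sphereMap φ (sphereMap φ.symm u) = u := by ext; simp [sphereMap]
      simpa [this] using hu
    · apply φ.injective
      simpa [sphereMap] using h

lemma sphereMean_comp_isometry {f : E n → ℝ} (hf : Continuous f) (φ : E n ≃ₗᵢ[ℝ] E n) (r : ℝ) :
    sphereMean r (fun x => f (φ x)) = sphereMean r f := by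
  unfold sphereMean
  rw [average_eq, average_eq]
  congr 1
  conv_rhs => rw [← map_sphereMap φ]
  rw [integral_map (measurable_sphereMap φ).aemeasurable]
  · simp [sphereMap]
  · exact Continuous.aestronglyMeasurable (by fun_prop)

lemma sphereMean_odd {f : E n → ℝ} (hf : Continuous f) (h : ∀ x, f (-x) = -f x) (r : ℝ) :
    sphereMean r f = 0 := by
  have h1 := sphereMean_comp_isometry hf (LinearIsometryEquiv.neg ℝ) r
  have h2 : sphereMean r (fun x => f ((LinearIsometryEquiv.neg ℝ) x)) =
      sphereMean r (fun x => (-1) * f x) := by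
    congr 1; ext x; simp [h]
  rw [h2, sphereMean_const_mul] at h1
  linarith

/-! ### Moments of linear forms -/

/-- The mean of `⟨x, u⟩ ^ a * ⟨v, u⟩ ^ b` over the unit sphere. -/
def mixedMoment (x v : E n) (a b : ℕ) : ℝ :=
  sphereMean 1 (fun u : E n => inner ℝ x u ^ a * inner ℝ v u ^ b)

lemma exists_isometry_map {x y : E n} (h : ‖x‖ = ‖y‖) : ∃ φ : E n ≃ₗᵢ[ℝ] E n, φ x = y :=
  ⟨_, Submodule.reflection_sub h⟩

/-- A reflection takes `v` to `‖v‖ • e`, and the surface measure is invariant under it. -/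
lemma sphereMean_inner_pow (v e : E n) (he : ‖e‖ = 1) (k : ℕ) :
    sphereMean 1 (fun u => inner ℝ v u ^ k) =
      ‖v‖ ^ k * sphereMean 1 (fun u => inner ℝ e u ^ k) := by
  obtain ⟨φ, hφ⟩ := exists_isometry_map (x := v) (y := ‖v‖ • e) (by simp [norm_smul, he])
  rw [← sphereMean_const_mul,
    ← sphereMean_comp_isometry (f := fun u => ‖v‖ ^ k * inner ℝ e u ^ k) (by fun_prop) φ]
  congr 1
  ext u
  rw [← mul_pow, ← real_inner_smul_left, ← hφ, LinearIsometryEquiv.inner_map_map]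

lemma sphereMean_smul_add_pow (x v : E n) (s : ℝ) (k : ℕ) :
    sphereMean 1 (fun u => inner ℝ (s • x + v) u ^ k) =
      ∑ j ∈ Finset.range (k + 1), s ^ j * (k.choose j) * mixedMoment x v j (k - j) := by
  unfold mixedMoment
  simp_rw [← sphereMean_const_mul]
  rw [← sphereMean_sum _ (fun i _ => by fun_prop)]
  congr 1
  ext u
  rw [inner_add_left, real_inner_smul_left, add_pow]
  refine Finset.sum_congr rfl fun j _ => ?_
  ring

lemma norm_smul_add_pow_two_mul (x v : E n) (s : ℝ) (m : ℕ) :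
    ‖s • x + v‖ ^ (2 * m) =
      (s ^ 2 * ‖x‖ ^ 2 + 2 * s * inner ℝ x v + ‖v‖ ^ 2) ^ m := by
  rw [pow_mul, norm_add_sq_real, norm_smul, real_inner_smul_left, mul_pow, Real.norm_eq_abs, sq_abs]
  ring

/-- Both sides are polynomials in `s` of degree at most `2 * m`, so comparing them determines every
mixed moment of total degree `2 * m` from the single moment of a coordinate. -/
lemma sum_mixedMoment_eq (x v e : E n) (he : ‖e‖ = 1) (m : ℕ) (s : ℝ) :
    ∑ j ∈ Finset.range (2 * m + 1),
        s ^ j * ((2 * m).choose j) * mixedMoment x v j (2 * m - j) =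
      (s ^ 2 * ‖x‖ ^ 2 + 2 * s * inner ℝ x v + ‖v‖ ^ 2) ^ m *
        sphereMean 1 (fun u => inner ℝ e u ^ (2 * m)) := by
  rw [← sphereMean_smul_add_pow, sphereMean_inner_pow _ e he, norm_smul_add_pow_two_mul]

/-- The unit vector `e₀`. -/
def e₀ (hn : 2 ≤ n) : E n := EuclideanSpace.single ⟨0, by omega⟩ 1

lemma norm_e₀ (hn : 2 ≤ n) : ‖e₀ hn‖ = 1 := by simp [e₀]

/-- The `k`-th moment of a coordinate on the unit sphere. -/
def coordMoment (hn : 2 ≤ n) (k : ℕ) : ℝ := sphereMean 1 (fun u => inner ℝ (e₀ hn) u ^ k)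

lemma sphereMean_inner_pow_eq (hn : 2 ≤ n) (v : E n) (k : ℕ) :
    sphereMean 1 (fun u => inner ℝ v u ^ k) = ‖v‖ ^ k * coordMoment hn k :=
  sphereMean_inner_pow v _ (norm_e₀ hn) k

lemma coordMoment_zero (hn : 2 ≤ n) : coordMoment hn 0 = 1 := by
  simp [coordMoment, sphereMean_const hn]

lemma sum_mixedMoment_coord (hn : 2 ≤ n) (k : ℕ) :
    ∑ i : Fin n, mixedMoment (e₀ hn) (EuclideanSpace.single i 1) k 2 = coordMoment hn k := by
  unfold mixedMoment
  rw [← sphereMean_sum _ (fun i _ => by fun_prop)]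
  apply sphereMean_congr zero_le_one
  intro u hu
  rw [← Finset.mul_sum]
  have : ∑ i : Fin n, (inner ℝ (EuclideanSpace.single i (1 : ℝ)) u) ^ 2 = 1 := by
    have h := EuclideanSpace.real_norm_sq_eq u
    simp only [EuclideanSpace.inner_single_left]
    simp [← h, hu]
  rw [this, mul_one]

/-- Inserting the factor 1 = ∑ uᵢ² into the moment of order `2 * m` leaves one term of order `2 * m
+ 2` and `n - 1` equal mixed moments. The hypothesis expresses these by the same moment of order `2
* m + 2`. -/
lemma coordMoment_step (hn : 2 ≤ n) (m : ℕ)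
    (h : ∀ v : E n, ‖v‖ = 1 → inner ℝ (e₀ hn) v = 0 →
      (2 * m + 1 : ℝ) * mixedMoment (e₀ hn) v (2 * m) 2 = coordMoment hn (2 * m + 2)) :
    coordMoment hn (2 * m + 2) = (2 * m + 1) / (n + 2 * m) * coordMoment hn (2 * m) := by
  have hs := sum_mixedMoment_coord hn (2 * m)
  have h0 : ∀ i ∈ Finset.univ, i ≠ (⟨0, by omega⟩ : Fin n) →
      mixedMoment (e₀ hn) (EuclideanSpace.single i 1) (2 * m) 2 =
        coordMoment hn (2 * m + 2) / (2 * m + 1) := by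
    intro i _ hi
    rw [eq_div_iff (by positivity), mul_comm]
    apply h _ (by simp)
    rw [e₀, EuclideanSpace.inner_single_left]
    simp [hi.symm]
  have h1 : mixedMoment (e₀ hn) (EuclideanSpace.single (⟨0, by omega⟩ : Fin n) 1) (2 * m) 2 =
      coordMoment hn (2 * m + 2) := by
    unfold mixedMoment coordMoment e₀
    simp only [← pow_add]
  rw [← Finset.add_sum_erase _ _ (Finset.mem_univ (⟨0, by omega⟩ : Fin n)), h1,
    Finset.sum_congr rfl (fun i hi => h0 i (Finset.mem_univ _) (Finset.ne_of_mem_erase hi)),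
    Finset.sum_const, Finset.card_erase_of_mem (Finset.mem_univ _), Finset.card_univ,
    Fintype.card_fin, nsmul_eq_mul, Nat.cast_sub (by omega)] at hs
  have hn' : (0 : ℝ) < n := by positivity
  rw [← hs]
  field_simp
  push_cast
  ring

lemma coordMoment_two (hn : 2 ≤ n) : coordMoment hn 2 = 1 / n := by
  have := coordMoment_step hn 0 (fun v hv h0 => by
    have hs := sum_mixedMoment_eq (e₀ hn) v (e₀ hn) (norm_e₀ hn) 1
    have e1 := hs 0
    simp [Finset.sum_range_succ, hv, coordMoment] at e1 ⊢
    linarith)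
  simpa [coordMoment_zero] using this

lemma coordMoment_four (hn : 2 ≤ n) : coordMoment hn 4 = 3 / (n * (n + 2)) := by
  have hn' : (0 : ℝ) < n := by positivity
  have := coordMoment_step hn 1 (fun v hv h0 => by
    have hs := sum_mixedMoment_eq (e₀ hn) v (e₀ hn) (norm_e₀ hn) 2
    -- Coefficients are compared by sampling the identity at as many values of `s` as it has unknown
    -- moments; `linarith` solves the resulting Vandermonde system. The other even moments are found
    -- in the same way.
    have e0 := hs 0
    have e1 := hs 1
    have e2 := hs (-1)
    have e3 := hs 2
    have e4 := hs (-2)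
    simp [Finset.sum_range_succ, hv, h0, norm_e₀, Nat.choose] at e0 e1 e2 e3 e4
    simp only [coordMoment]
    norm_num at *
    linarith)
  norm_num [coordMoment_two] at this
  rw [this]
  field_simp

lemma coordMoment_six (hn : 2 ≤ n) : coordMoment hn 6 = 15 / (n * (n + 2) * (n + 4)) := by
  have hn' : (0 : ℝ) < n := by positivity
  have := coordMoment_step hn 2 (fun v hv h0 => by
    have hs := sum_mixedMoment_eq (e₀ hn) v (e₀ hn) (norm_e₀ hn) 3
    have e0 := hs 0
    have e1 := hs 1
    have e2 := hs (-1)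
    have e3 := hs 2
    have e4 := hs (-2)
    have e5 := hs 3
    have e6 := hs (-3)
    simp [Finset.sum_range_succ, hv, h0, norm_e₀, Nat.choose] at e0 e1 e2 e3 e4 e5 e6
    simp only [coordMoment]
    norm_num at *
    linarith)
  norm_num [coordMoment_four] at this
  rw [this]
  field_simp
  norm_num

lemma coordMoment_eight (hn : 2 ≤ n) :
    coordMoment hn 8 = 105 / (n * (n + 2) * (n + 4) * (n + 6)) := by
  have hn' : (0 : ℝ) < n := by positivity
  have := coordMoment_step hn 3 (fun v hv h0 => by
    have hs := sum_mixedMoment_eq (e₀ hn) v (e₀ hn) (norm_e₀ hn) 4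
    have e0 := hs 0
    have e1 := hs 1
    have e2 := hs (-1)
    have e3 := hs 2
    have e4 := hs (-2)
    have e5 := hs 3
    have e6 := hs (-3)
    have e7 := hs 4
    have e8 := hs (-4)
    simp [Finset.sum_range_succ, hv, h0, norm_e₀, Nat.choose] at e0 e1 e2 e3 e4 e5 e6 e7 e8
    simp only [coordMoment]
    norm_num at *
    linarith)
  norm_num [coordMoment_six] at this
  rw [this]
  field_simp
  norm_num

lemma coordMoment_odd (hn : 2 ≤ n) {k : ℕ} (hk : Odd k) : coordMoment hn k = 0 :=
  sphereMean_odd (by fun_prop) (fun x => by rw [inner_neg_right, hk.neg_pow]) 1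

lemma mixedMoment_two_two (hn : 2 ≤ n) (x v : E n) :
    mixedMoment x v 2 2 =
      (‖x‖ ^ 2 * ‖v‖ ^ 2 + 2 * inner ℝ x v ^ 2) / (n * (n + 2)) := by
  have hs := sum_mixedMoment_eq x v (e₀ hn) (norm_e₀ hn) 2
  change ∀ s, _ = _ * coordMoment hn 4 at hs
  rw [coordMoment_four] at hs
  have e0 := hs 0
  have e1 := hs 1
  have e2 := hs (-1)
  have e3 := hs 2
  have e4 := hs (-2)
  simp [Finset.sum_range_succ, Nat.choose] at e0 e1 e2 e3 e4
  norm_num at *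
  have hn' : (0 : ℝ) < n := by positivity
  field_simp at *
  linarith

lemma mixedMoment_four_two (hn : 2 ≤ n) (x v : E n) :
    mixedMoment x v 4 2 =
      (3 * ‖x‖ ^ 4 * ‖v‖ ^ 2 + 12 * ‖x‖ ^ 2 * inner ℝ x v ^ 2) / (n * (n + 2) * (n + 4)) := by
  have hs := sum_mixedMoment_eq x v (e₀ hn) (norm_e₀ hn) 3
  change ∀ s, _ = _ * coordMoment hn 6 at hs
  rw [coordMoment_six] at hs
  have e0 := hs 0
  have e1 := hs 1
  have e2 := hs (-1)
  have e3 := hs 2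
  have e4 := hs (-2)
  have e5 := hs 3
  have e6 := hs (-3)
  simp [Finset.sum_range_succ, Nat.choose] at e0 e1 e2 e3 e4 e5 e6
  norm_num at *
  have hn' : (0 : ℝ) < n := by positivity
  field_simp at *
  linarith

lemma mixedMoment_four_four (hn : 2 ≤ n) (x v : E n) :
    mixedMoment x v 4 4 =
      (9 * ‖x‖ ^ 4 * ‖v‖ ^ 4 + 72 * ‖x‖ ^ 2 * ‖v‖ ^ 2 * inner ℝ x v ^ 2
        + 24 * inner ℝ x v ^ 4) / (n * (n + 2) * (n + 4) * (n + 6)) := by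
  have hs := sum_mixedMoment_eq x v (e₀ hn) (norm_e₀ hn) 4
  change ∀ s, _ = _ * coordMoment hn 8 at hs
  rw [coordMoment_eight] at hs
  have e0 := hs 0
  have e1 := hs 1
  have e2 := hs (-1)
  have e3 := hs 2
  have e4 := hs (-2)
  have e5 := hs 3
  have e6 := hs (-3)
  have e7 := hs 4
  have e8 := hs (-4)
  simp [Finset.sum_range_succ, Nat.choose] at e0 e1 e2 e3 e4 e5 e6 e7 e8
  norm_num at *
  have hn' : (0 : ℝ) < n := by positivity
  field_simp at *
  linarith

lemma mixedMoment_comm (x v : E n) (a b : ℕ) : mixedMoment x v a b = mixedMoment v x b a := by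
  unfold mixedMoment
  congr 1; ext u; ring

lemma mixedMoment_zero_right (hn : 2 ≤ n) (x v : E n) (a : ℕ) :
    mixedMoment x v a 0 = ‖x‖ ^ a * coordMoment hn a := by
  rw [← sphereMean_inner_pow_eq]
  simp [mixedMoment]

lemma mixedMoment_zero_left (hn : 2 ≤ n) (x v : E n) (a : ℕ) :
    mixedMoment x v 0 a = ‖v‖ ^ a * coordMoment hn a := by
  rw [mixedMoment_comm, mixedMoment_zero_right hn]

end EuclideanDesign

end

noncomputable section

open MeasureTheory
open scoped Classical

namespace EuclideanDesign

variable {n : ℕ}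

/-! ### Polynomial functions -/

/-- Evaluation of polynomials at a point, as a linear functional. -/
def evalLin (x : E n) : MvPolynomial (Fin n) ℝ →ₗ[ℝ] ℝ where
  toFun f := evalAt f x
  map_add' f g := by simp [evalAt]
  map_smul' c f := by simp [evalAt, MvPolynomial.smul_eval]

@[simp] lemma evalLin_apply (x : E n) (f : MvPolynomial (Fin n) ℝ) : evalLin x f = evalAt f x := rfl

/-- The linear form `⟨v, x⟩` as a polynomial. -/
def linPoly (v : E n) : MvPolynomial (Fin n) ℝ := ∑ i, v i • MvPolynomial.X i

/-- The polynomial `‖x‖ ^ 2`. -/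
def normPoly (n : ℕ) : MvPolynomial (Fin n) ℝ := ∑ i, MvPolynomial.X i ^ 2

lemma evalAt_linPoly (v x : E n) : evalAt (linPoly v) x = inner ℝ v x := by
  simp [evalAt, linPoly, MvPolynomial.smul_eval, PiLp.inner_apply, mul_comm]

lemma evalAt_normPoly (x : E n) : evalAt (normPoly n) x = ‖x‖ ^ 2 := by
  simp [evalAt, normPoly, EuclideanSpace.real_norm_sq_eq]

lemma evalAt_mul (f g : MvPolynomial (Fin n) ℝ) (x : E n) :
    evalAt (f * g) x = evalAt f x * evalAt g x := by simp [evalAt]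

lemma evalAt_add (f g : MvPolynomial (Fin n) ℝ) (x : E n) :
    evalAt (f + g) x = evalAt f x + evalAt g x := by simp [evalAt]

lemma evalAt_smul (c : ℝ) (f : MvPolynomial (Fin n) ℝ) (x : E n) :
    evalAt (c • f) x = c * evalAt f x := by simp [evalAt, MvPolynomial.smul_eval]

lemma evalAt_pow (f : MvPolynomial (Fin n) ℝ) (k : ℕ) (x : E n) :
    evalAt (f ^ k) x = evalAt f x ^ k := by simp [evalAt]

lemma evalAt_C (c : ℝ) (x : E n) : evalAt (MvPolynomial.C c) x = c := by simp [evalAt]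

lemma linPoly_isHomogeneous (v : E n) : (linPoly v).IsHomogeneous 1 :=
  MvPolynomial.IsHomogeneous.sum _ _ _ fun i _ => by
    rw [MvPolynomial.smul_eq_C_mul]
    exact MvPolynomial.isHomogeneous_C_mul_X _ _

lemma normPoly_isHomogeneous (n : ℕ) : (normPoly n).IsHomogeneous 2 :=
  MvPolynomial.IsHomogeneous.sum _ _ _ fun _ _ => MvPolynomial.isHomogeneous_X_pow _ _

lemma continuous_evalAt (f : MvPolynomial (Fin n) ℝ) : Continuous (evalAt f) := by
  unfold evalAt
  exact (MvPolynomial.continuous_eval f).comp (by fun_prop)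

/-- Homogeneous polynomials are linear combinations of powers of linear forms. -/
lemma homogeneousSubmodule_le_span_linPoly_pow (m : ℕ) :
    MvPolynomial.homogeneousSubmodule (Fin n) ℝ m ≤
      Submodule.span ℝ (Set.range fun v : E n => linPoly v ^ m) := by
  intro p hp
  by_contra hnot
  obtain ⟨T, hTp, hT⟩ := Submodule.exists_le_ker_of_notMem hnot
  apply hTp
  have key : ∀ d ∈ Finset.finsuppAntidiag (Finset.univ : Finset (Fin n)) m,
      T (MvPolynomial.monomial d 1) = 0 := by
    -- Expanded by the multinomial theorem, the value of `T` on the `m`-th power of the form `v` is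
    -- this polynomial in the coordinates of `v`. It vanishes identically, and multinomial
    -- coefficients are nonzero in ℝ.
    let q : MvPolynomial (Fin n) ℝ :=
      ∑ d ∈ Finset.finsuppAntidiag (Finset.univ : Finset (Fin n)) m,
        MvPolynomial.monomial d ((d.multinomial : ℝ) * T (MvPolynomial.monomial d 1))
    have hq : q = 0 := by
      apply MvPolynomial.funext
      intro v
      have h1 : T (linPoly (WithLp.toLp 2 v) ^ m) = 0 :=
        hT (Submodule.subset_span ⟨_, rfl⟩)
      have h2 : linPoly (WithLp.toLp 2 v) ^ m =
          ∑ d ∈ Finset.finsuppAntidiag (Finset.univ : Finset (Fin n)) m,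
            ((d.multinomial : ℝ) * d.prod (fun r k => v r ^ k)) • MvPolynomial.monomial d 1 := by
        ext s
        rw [linPoly, MvPolynomial.coeff_linearCombination_X_pow_of_fintype, MvPolynomial.coeff_sum]
        simp only [MvPolynomial.coeff_smul, MvPolynomial.coeff_monomial, smul_eq_mul, mul_ite,
          mul_one, mul_zero, Finset.sum_ite_eq', Finset.mem_finsuppAntidiag, Finset.subset_univ,
          and_true]
        rw [Finsupp.sum_fintype _ _ (by simp)]
      rw [h2, map_sum] at h1
      simp only [map_smul, smul_eq_mul] at h1
      rw [map_zero, map_sum, ← h1]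
      refine Finset.sum_congr rfl fun d _ => ?_
      rw [MvPolynomial.eval_monomial]
      ring
    intro d hd
    have h3 : q.coeff d = 0 := by rw [hq]; simp
    rw [MvPolynomial.coeff_sum] at h3
    simp only [MvPolynomial.coeff_monomial, Finset.sum_ite_eq', hd, if_true] at h3
    have h4 : (d.multinomial : ℝ) ≠ 0 := by
      rw [Finsupp.multinomial_eq]
      exact_mod_cast (Nat.multinomial_pos _ _).ne'
    exact (mul_eq_zero.1 h3).resolve_left h4
  rw [MvPolynomial.as_sum p, map_sum]
  refine Finset.sum_eq_zero fun d hd => ?_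
  have h5 : MvPolynomial.monomial d (p.coeff d) = p.coeff d • MvPolynomial.monomial d (1 : ℝ) := by
    simp [MvPolynomial.smul_monomial]
  rw [h5, map_smul, key d, smul_zero]
  have hdeg := MvPolynomial.IsHomogeneous.degree_eq_sum_deg_support
    ((MvPolynomial.mem_homogeneousSubmodule _ _).1 hp) hd
  rw [Finset.mem_finsuppAntidiag]
  refine ⟨?_, Finset.subset_univ _⟩
  rw [hdeg, Finset.sum_subset (Finset.subset_univ d.support) (fun i _ hi => by simpa using hi)]

/-- `g` is a polynomial function of degree at most `d`. -/
def IsPoly (d : ℕ) (g : E n → ℝ) : Prop :=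
  ∃ f : MvPolynomial (Fin n) ℝ, f.totalDegree ≤ d ∧ ∀ x, evalAt f x = g x

namespace IsPoly

variable {a b d : ℕ} {f g : E n → ℝ}

lemma continuous (h : IsPoly d g) : Continuous g := by
  obtain ⟨f, -, hf⟩ := h
  rw [← funext hf]
  exact continuous_evalAt f

lemma mono (h : IsPoly a g) (hab : a ≤ b) : IsPoly b g := by
  obtain ⟨f, hd, hf⟩ := h
  exact ⟨f, hd.trans hab, hf⟩

lemma mul (hf : IsPoly a f) (hg : IsPoly b g) : IsPoly (a + b) (fun x => f x * g x) := by
  obtain ⟨p, hp, hf⟩ := hf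
  obtain ⟨q, hq, hg⟩ := hg
  exact ⟨p * q, (MvPolynomial.totalDegree_mul _ _).trans (add_le_add hp hq),
    fun x => by rw [evalAt_mul, hf, hg]⟩

lemma add (hf : IsPoly d f) (hg : IsPoly d g) : IsPoly d (fun x => f x + g x) := by
  obtain ⟨p, hp, hf⟩ := hf
  obtain ⟨q, hq, hg⟩ := hg
  exact ⟨p + q, (MvPolynomial.totalDegree_add _ _).trans (max_le hp hq),
    fun x => by rw [evalAt_add, hf, hg]⟩

lemma const (d : ℕ) (c : ℝ) : IsPoly d (fun _ : E n => c) :=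
  ⟨MvPolynomial.C c, by simp, fun x => evalAt_C c x⟩

lemma const_mul (c : ℝ) (hf : IsPoly d f) : IsPoly d (fun x => c * f x) := by
  simpa using (const 0 c).mul hf

lemma inner_pow (v : E n) (k : ℕ) : IsPoly k (fun x => inner ℝ v x ^ k) :=
  ⟨linPoly v ^ k, by simpa using ((linPoly_isHomogeneous v).pow k).totalDegree_le,
    fun x => by rw [evalAt_pow, evalAt_linPoly]⟩

lemma norm_pow (n k : ℕ) : IsPoly (2 * k) (fun x : E n => ‖x‖ ^ (2 * k)) :=
  ⟨normPoly n ^ k, ((normPoly_isHomogeneous n).pow k).totalDegree_le,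
    fun x => by rw [evalAt_pow, evalAt_normPoly, ← pow_mul]⟩

end IsPoly

/-! ### Designs on two spheres -/

/-- The total weight of the points of norm `r`. -/
def layerWeight (X : Finset (E n)) (w : E n → ℝ) (r : ℝ) : ℝ := ∑ x ∈ layer X r, w x

lemma layerWeight_pos {X : Finset (E n)} {w : E n → ℝ} {t : ℕ} (h : IsDesign t X w) {r : ℝ}
    (hr : r ∈ radii X) : 0 < layerWeight X w r := by
  obtain ⟨x, hx, hxr⟩ := Finset.mem_image.1 hr
  refine Finset.sum_pos (fun y hy => h.weight_pos y (Finset.mem_filter.1 hy).1) ⟨x, ?_⟩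
  exact Finset.mem_filter.2 ⟨hx, hxr⟩

/-- A Euclidean `9`-design supported by two spheres of positive radii. -/
structure TwoSphereDesign (X : Finset (E n)) (w : E n → ℝ) (r₁ r₂ : ℝ) : Prop where
  two_le : 2 ≤ n
  pos₁ : 0 < r₁
  pos₂ : 0 < r₂
  ne : r₁ ≠ r₂
  radii_eq : radii X = {r₁, r₂}
  design : IsDesign 9 X w

namespace TwoSphereDesign

variable {X : Finset (E n)} {w : E n → ℝ} {r₁ r₂ : ℝ}

lemma symm (h : TwoSphereDesign X w r₁ r₂) : TwoSphereDesign X w r₂ r₁ :=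
  ⟨h.two_le, h.pos₂, h.pos₁, h.ne.symm, by rw [h.radii_eq, Finset.pair_comm], h.design⟩

lemma norm_eq (h : TwoSphereDesign X w r₁ r₂) {x : E n} (hx : x ∈ X) : ‖x‖ = r₁ ∨ ‖x‖ = r₂ := by
  have : ‖x‖ ∈ radii X := Finset.mem_image_of_mem _ hx
  simpa [h.radii_eq] using this

lemma weight₁_pos (h : TwoSphereDesign X w r₁ r₂) : 0 < layerWeight X w r₁ :=
  layerWeight_pos h.design (by simp [h.radii_eq])

lemma weight₂_pos (h : TwoSphereDesign X w r₁ r₂) : 0 < layerWeight X w r₂ :=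
  h.symm.weight₁_pos

lemma sum_eq (h : TwoSphereDesign X w r₁ r₂) {g : E n → ℝ} (hg : IsPoly 9 g) :
    ∑ x ∈ X, w x * g x =
      layerWeight X w r₁ * sphereMean r₁ g + layerWeight X w r₂ * sphereMean r₂ g := by
  obtain ⟨f, hf, hfg⟩ := hg
  have := h.design.sum_eq f hf
  rw [h.radii_eq, Finset.sum_pair h.ne] at this
  rw [← funext hfg]
  exact this.symm

lemma sq_sub_ne (h : TwoSphereDesign X w r₁ r₂) : r₁ ^ 2 - r₂ ^ 2 ≠ 0 := by
  intro h0
  apply h.ne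
  have h1 := h.pos₁
  have h2 := h.pos₂
  rwa [sub_eq_zero, sq_eq_sq₀ h1.le h2.le] at h0

/-- Each of the two layers is a weighted spherical `7`-design. -/
lemma layer_sum_eq (h : TwoSphereDesign X w r₁ r₂) {g : E n → ℝ} (hg : IsPoly 7 g) :
    ∑ x ∈ layer X r₁, w x * g x = layerWeight X w r₁ * sphereMean r₁ g := by
  -- This factor kills the other sphere and is a nonzero constant on this one; it costs two of the
  -- nine degrees.
  have hp : IsPoly 9 (fun x : E n => (‖x‖ ^ (2 * 1) + - r₂ ^ 2) * g x) :=
    ((IsPoly.norm_pow n 1).add (IsPoly.const _ _)).mul hg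
  have h1 := h.sum_eq hp
  have h2 : sphereMean r₂ (fun x : E n => (‖x‖ ^ (2 * 1) + - r₂ ^ 2) * g x) = 0 := by
    rw [sphereMean_congr (g := fun _ => 0) h.pos₂.le (fun x hx => by simp [hx]),
      sphereMean_const h.two_le]
  have h3 : sphereMean r₁ (fun x : E n => (‖x‖ ^ (2 * 1) + - r₂ ^ 2) * g x) =
      (r₁ ^ 2 - r₂ ^ 2) * sphereMean r₁ g := by
    rw [← sphereMean_const_mul]
    exact sphereMean_congr h.pos₁.le (fun x hx => by rw [hx]; ring)
  have h4 : ∑ x ∈ X, w x * ((‖x‖ ^ (2 * 1) + - r₂ ^ 2) * g x) =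
      (r₁ ^ 2 - r₂ ^ 2) * ∑ x ∈ layer X r₁, w x * g x := by
    rw [layer, Finset.sum_filter, Finset.mul_sum]
    refine Finset.sum_congr rfl fun x hx => ?_
    rcases h.norm_eq hx with hx | hx
    · rw [if_pos hx, hx]; ring
    · rw [if_neg (by rw [hx]; exact h.ne.symm), hx]; ring
  rw [h2, h3, h4] at h1
  exact mul_left_cancel₀ h.sq_sub_ne (by linear_combination h1)

end TwoSphereDesign

/-! ### Zonal kernels -/

/-- The zonal kernel of degree two, homogeneous of degree two in each variable. -/
def zonalTwo (x y : E n) : ℝ :=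
  ((n : ℝ) + 2) / 2 * (n * inner ℝ x y ^ 2 - ‖x‖ ^ 2 * ‖y‖ ^ 2)

/-- The zonal kernel of degree four, homogeneous of degree four in each variable. -/
def zonalFour (x y : E n) : ℝ :=
  (n : ℝ) * (n + 6) / 24 * ((n + 4) * (n + 2) * inner ℝ x y ^ 4
    - 6 * (n + 2) * inner ℝ x y ^ 2 * ‖x‖ ^ 2 * ‖y‖ ^ 2 + 3 * ‖x‖ ^ 4 * ‖y‖ ^ 4)

/-- The projection of `⟨x, v⟩ ^ 4` to the harmonic polynomials of degree four. -/
def harmonicFour (x v : E n) : ℝ :=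
  inner ℝ x v ^ 4 - 6 * inner ℝ x v ^ 2 * ‖x‖ ^ 2 * ‖v‖ ^ 2 / (n + 4)
    + 3 * ‖x‖ ^ 4 * ‖v‖ ^ 4 / ((n + 2) * (n + 4))

lemma sphereMean_mul_inner_pow (g : E n → ℝ) (v : E n) (r : ℝ) (m : ℕ) :
    sphereMean r (fun y => g y * inner ℝ v y ^ m) =
      r ^ m * sphereMean 1 (fun u => g (r • u) * inner ℝ v u ^ m) := by
  rw [sphereMean_scale, ← sphereMean_const_mul]
  congr 1
  ext u
  rw [real_inner_smul_right]
  ring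

lemma sphereMean_zonalFour (x v : E n) {r : ℝ} (hr : 0 ≤ r) (m : ℕ) :
    sphereMean r (fun y => zonalFour x y * inner ℝ v y ^ m) =
      r ^ (4 + m) * ((n : ℝ) * (n + 6) / 24 * ((n + 4) * (n + 2) * mixedMoment x v 4 m
        - 6 * (n + 2) * ‖x‖ ^ 2 * mixedMoment x v 2 m + 3 * ‖x‖ ^ 4 * mixedMoment x v 0 m)) := by
  rw [sphereMean_mul_inner_pow, pow_add, mul_comm (r ^ 4), mul_assoc (r ^ m)]
  congr 1
  have : sphereMean 1 (fun u : E n => zonalFour x (r • u) * inner ℝ v u ^ m) =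
      sphereMean 1 (fun u : E n =>
        (r ^ 4 * ((n : ℝ) * (n + 6) / 24) * ((n + 4) * (n + 2))) *
            (inner ℝ x u ^ 4 * inner ℝ v u ^ m) +
          ((-(r ^ 4 * ((n : ℝ) * (n + 6) / 24) * (6 * (n + 2) * ‖x‖ ^ 2))) *
            (inner ℝ x u ^ 2 * inner ℝ v u ^ m) +
          (r ^ 4 * ((n : ℝ) * (n + 6) / 24) * (3 * ‖x‖ ^ 4)) *
            (inner ℝ x u ^ 0 * inner ℝ v u ^ m))) := by
    refine sphereMean_congr zero_le_one fun u hu => ?_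
    rw [zonalFour, real_inner_smul_right, norm_smul, hu, Real.norm_of_nonneg hr]
    ring
  rw [this, sphereMean_add (by fun_prop) (by fun_prop), sphereMean_add (by fun_prop) (by fun_prop),
    sphereMean_const_mul, sphereMean_const_mul, sphereMean_const_mul]
  simp only [mixedMoment]
  ring

lemma sphereMean_zonalTwo (x v : E n) {r : ℝ} (hr : 0 < r) (hx : ‖x‖ = r) (m : ℕ) :
    sphereMean r (fun y => (1 + zonalTwo x y / r ^ 4) * inner ℝ v y ^ m) =
      r ^ m * ((1 - ((n : ℝ) + 2) / 2) * mixedMoment x v 0 m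
        + ((n : ℝ) + 2) / 2 * n / r ^ 2 * mixedMoment x v 2 m) := by
  rw [sphereMean_mul_inner_pow]
  congr 1
  have : sphereMean 1 (fun u : E n => (1 + zonalTwo x (r • u) / r ^ 4) * inner ℝ v u ^ m) =
      sphereMean 1 (fun u : E n =>
        (1 - ((n : ℝ) + 2) / 2) * (inner ℝ x u ^ 0 * inner ℝ v u ^ m) +
          (((n : ℝ) + 2) / 2 * n / r ^ 2) * (inner ℝ x u ^ 2 * inner ℝ v u ^ m)) := by
    refine sphereMean_congr zero_le_one fun u hu => ?_
    rw [zonalTwo, real_inner_smul_right, norm_smul, hu, Real.norm_of_nonneg hr.le, hx]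
    field_simp
    ring
  rw [this, sphereMean_add (by fun_prop) (by fun_prop), sphereMean_const_mul, sphereMean_const_mul]
  simp only [mixedMoment]

/-- Up to a power of `r`, the kernel `zonalFour` represents the projection to harmonics of degree 4.
This lemma and the two on degrees two and four test it on powers of linear forms, which span all
homogeneous polynomials. -/
lemma sphereMean_zonalFour_zero (hn : 2 ≤ n) (x v : E n) {r : ℝ} (hr : 0 ≤ r) :
    sphereMean r (fun y => zonalFour x y * inner ℝ v y ^ 0) = 0 := by
  have hn' : (0 : ℝ) < n := by positivity
  rw [sphereMean_zonalFour x v hr, mixedMoment_zero_right hn, mixedMoment_zero_right hn,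
    mixedMoment_zero_right hn, coordMoment_four, coordMoment_two, coordMoment_zero]
  field_simp
  ring

lemma sphereMean_zonalFour_two (hn : 2 ≤ n) (x v : E n) {r : ℝ} (hr : 0 ≤ r) :
    sphereMean r (fun y => zonalFour x y * inner ℝ v y ^ 2) = 0 := by
  have hn' : (0 : ℝ) < n := by positivity
  rw [sphereMean_zonalFour x v hr, mixedMoment_four_two hn, mixedMoment_two_two hn,
    mixedMoment_zero_left hn, coordMoment_two]
  field_simp
  ring

lemma mixedMoment_two_four (hn : 2 ≤ n) (x v : E n) :
    mixedMoment x v 2 4 =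
      (3 * ‖v‖ ^ 4 * ‖x‖ ^ 2 + 12 * ‖v‖ ^ 2 * inner ℝ x v ^ 2) / (n * (n + 2) * (n + 4)) := by
  rw [mixedMoment_comm, mixedMoment_four_two hn, real_inner_comm]

lemma sphereMean_zonalFour_four (hn : 2 ≤ n) (x v : E n) {r : ℝ} (hr : 0 ≤ r) :
    sphereMean r (fun y => zonalFour x y * inner ℝ v y ^ 4) = r ^ 8 * harmonicFour x v := by
  have hn' : (0 : ℝ) < n := by positivity
  rw [sphereMean_zonalFour x v hr, mixedMoment_four_four hn, mixedMoment_two_four hn,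
    mixedMoment_zero_left hn, coordMoment_four, harmonicFour]
  field_simp
  ring

/-- The kernel `1 + zonalTwo x y / r ^ 4` complements `zonalFour`: it reproduces degrees 0 and 2,
and from a fourth power it returns exactly what `harmonicFour` leaves. -/
lemma sphereMean_zonalTwo_zero (hn : 2 ≤ n) (x v : E n) {r : ℝ} (hr : 0 < r) (hx : ‖x‖ = r) :
    sphereMean r (fun y => (1 + zonalTwo x y / r ^ 4) * inner ℝ v y ^ 0) = 1 := by
  have hn' : (0 : ℝ) < n := by positivity
  rw [sphereMean_zonalTwo x v hr hx, mixedMoment_zero_right hn,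
    mixedMoment_zero_right hn, coordMoment_two, coordMoment_zero, hx]
  field_simp
  ring

lemma sphereMean_zonalTwo_two (hn : 2 ≤ n) (x v : E n) {r : ℝ} (hr : 0 < r) (hx : ‖x‖ = r) :
    sphereMean r (fun y => (1 + zonalTwo x y / r ^ 4) * inner ℝ v y ^ 2) = inner ℝ x v ^ 2 := by
  have hn' : (0 : ℝ) < n := by positivity
  rw [sphereMean_zonalTwo x v hr hx, mixedMoment_two_two hn,
    mixedMoment_zero_left hn, coordMoment_two, hx]
  field_simp
  ring

lemma sphereMean_zonalTwo_four (hn : 2 ≤ n) (x v : E n) {r : ℝ} (hr : 0 < r) (hx : ‖x‖ = r) :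
    sphereMean r (fun y => (1 + zonalTwo x y / r ^ 4) * inner ℝ v y ^ 4) =
      inner ℝ x v ^ 4 - harmonicFour x v := by
  have hn' : (0 : ℝ) < n := by positivity
  rw [sphereMean_zonalTwo x v hr hx, mixedMoment_two_four hn,
    mixedMoment_zero_left hn, coordMoment_four, harmonicFour, hx]
  field_simp
  ring

lemma isPoly_zonalFour (x : E n) : IsPoly 4 (zonalFour x) := by
  have := IsPoly.const_mul ((n : ℝ) * (n + 6) / 24) <|
    ((IsPoly.inner_pow x 4).const_mul (((n : ℝ) + 4) * (n + 2))).add <|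
    (((IsPoly.inner_pow x 2).mul (IsPoly.norm_pow n 1)).const_mul (-6 * ((n : ℝ) + 2) * ‖x‖ ^ 2)).add
    ((IsPoly.norm_pow n 2).const_mul (3 * ‖x‖ ^ 4))
  convert this using 1
  ext y
  rw [zonalFour]
  ring

lemma isPoly_zonalTwo (x : E n) (c : ℝ) : IsPoly 2 (fun y => 1 + zonalTwo x y / c) := by
  have := (IsPoly.const 2 1).add <| IsPoly.const_mul (((n : ℝ) + 2) / 2 / c) <|
    ((IsPoly.inner_pow x 2).const_mul (n : ℝ)).add
    ((IsPoly.norm_pow n 1).const_mul (-‖x‖ ^ 2))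
  convert this using 1
  ext y
  rw [zonalTwo]
  ring

/-! ### The reproducing kernel -/

/-- The polynomials all of whose terms have degree `0`, `2` or `4`. -/
def evenQuartics (n : ℕ) : Submodule ℝ (MvPolynomial (Fin n) ℝ) :=
  ⨆ i ∈ Finset.range (4 / 2 + 1), MvPolynomial.homogeneousSubmodule (Fin n) ℝ (4 - 2 * i)

lemma homogeneous_le_evenQuartics {m : ℕ} (hm : m = 0 ∨ m = 2 ∨ m = 4) :
    MvPolynomial.homogeneousSubmodule (Fin n) ℝ m ≤ evenQuartics n := by
  have : ∀ i ∈ Finset.range (4 / 2 + 1),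
      MvPolynomial.homogeneousSubmodule (Fin n) ℝ (4 - 2 * i) ≤ evenQuartics n :=
    fun i hi => le_biSup (fun i => MvPolynomial.homogeneousSubmodule (Fin n) ℝ (4 - 2 * i)) hi
  rcases hm with rfl | rfl | rfl
  · exact this 2 (by simp)
  · exact this 1 (by simp)
  · exact this 0 (by simp)

lemma evenQuartics_le {N : Submodule ℝ (MvPolynomial (Fin n) ℝ)}
    (h0 : ∀ v : E n, linPoly v ^ 0 ∈ N) (h2 : ∀ v : E n, linPoly v ^ 2 ∈ N)
    (h4 : ∀ v : E n, linPoly v ^ 4 ∈ N) : evenQuartics n ≤ N := by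
  refine iSup₂_le fun i hi => (homogeneousSubmodule_le_span_linPoly_pow _).trans ?_
  rw [Submodule.span_le]
  rintro _ ⟨v, rfl⟩
  have : i = 0 ∨ i = 1 ∨ i = 2 := by have := Finset.mem_range.1 hi; omega
  rcases this with rfl | rfl | rfl
  · exact h4 v
  · exact h2 v
  · exact h0 v

lemma evalAt_neg_of_mem {f : MvPolynomial (Fin n) ℝ} (hf : f ∈ evenQuartics n) (x : E n) :
    evalAt f (-x) = evalAt f x := by
  have : evenQuartics n ≤ LinearMap.ker (evalLin (-x) - evalLin x) := by
    apply evenQuartics_le <;> intro v <;>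
      simp only [LinearMap.mem_ker, LinearMap.sub_apply, evalLin_apply, evalAt_pow, evalAt_linPoly,
        inner_neg_right] <;>
      ring
  have h := this hf
  simpa [LinearMap.mem_ker, sub_eq_zero] using h

lemma isPoly_of_mem {f : MvPolynomial (Fin n) ℝ} (hf : f ∈ evenQuartics n) :
    IsPoly 4 (evalAt f) := by
  have : evenQuartics n ≤ MvPolynomial.restrictTotalDegree (Fin n) ℝ 4 := by
    apply evenQuartics_le <;> intro v <;> rw [MvPolynomial.mem_restrictTotalDegree] <;>
      refine ((linPoly_isHomogeneous v).pow _).totalDegree_le.trans (by norm_num)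
  exact ⟨f, (MvPolynomial.mem_restrictTotalDegree _ _ _).1 (this hf), fun x => rfl⟩

/-- The total eighth moment of the radii. -/
def momentEight (X : Finset (E n)) (w : E n → ℝ) (r₁ r₂ : ℝ) : ℝ :=
  layerWeight X w r₁ * r₁ ^ 8 + layerWeight X w r₂ * r₂ ^ 8

/-- The reproducing kernel of the even quartics on the two spheres. -/
def reproKernel (X : Finset (E n)) (w : E n → ℝ) (r₁ r₂ : ℝ) (x y : E n) : ℝ :=
  (if ‖y‖ = ‖x‖ then (1 + zonalTwo x y / ‖x‖ ^ 4) / layerWeight X w ‖x‖ else 0)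
    + zonalFour x y / momentEight X w r₁ r₂

namespace TwoSphereDesign

variable {X : Finset (E n)} {w : E n → ℝ} {r₁ r₂ : ℝ}

lemma momentEight_pos (h : TwoSphereDesign X w r₁ r₂) : 0 < momentEight X w r₁ r₂ := by
  have := h.pos₁
  have := h.pos₂
  have := h.weight₁_pos
  have := h.weight₂_pos
  unfold momentEight
  positivity

lemma momentEight_comm (X : Finset (E n)) (w : E n → ℝ) (r₁ r₂ : ℝ) :
    momentEight X w r₁ r₂ = momentEight X w r₂ r₁ := add_comm _ _

lemma reproKernel_comm_radii (X : Finset (E n)) (w : E n → ℝ) (r₁ r₂ : ℝ) (x y : E n) :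
    reproKernel X w r₁ r₂ x y = reproKernel X w r₂ r₁ x y := by
  rw [reproKernel, reproKernel, momentEight_comm]

/-- The local part of the kernel times a quartic has degree 6, within reach of the 7-design on one
layer. The part of degree 4 times a quartic has degree 8 and needs the whole design, which explains
why it is normalized by the joint eighth moment. -/
lemma sum_reproKernel_mul (h : TwoSphereDesign X w r₁ r₂) {x v : E n} (hx : ‖x‖ = r₁)
    {m : ℕ} (hm : m ≤ 4) :
    ∑ y ∈ X, w y * reproKernel X w r₁ r₂ x y * inner ℝ v y ^ m =
      sphereMean r₁ (fun y => (1 + zonalTwo x y / r₁ ^ 4) * inner ℝ v y ^ m) +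
      (layerWeight X w r₁ * sphereMean r₁ (fun y => zonalFour x y * inner ℝ v y ^ m) +
        layerWeight X w r₂ * sphereMean r₂ (fun y => zonalFour x y * inner ℝ v y ^ m)) /
          momentEight X w r₁ r₂ := by
  have h1 := h.layer_sum_eq (((isPoly_zonalTwo x (r₁ ^ 4)).mul (IsPoly.inner_pow v m)).mono
    (show 2 + m ≤ 7 by omega))
  have h2 := h.sum_eq (((isPoly_zonalFour x).mul (IsPoly.inner_pow v m)).mono
    (show 4 + m ≤ 9 by omega))
  have hW := h.weight₁_pos.ne'
  rw [← h2, eq_comm, ← mul_right_inj' hW, mul_add, ← h1, layer, Finset.sum_filter, Finset.mul_sum,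
    Finset.sum_div, Finset.mul_sum, ← Finset.sum_add_distrib]
  refine Finset.sum_congr rfl fun y _ => ?_
  rw [reproKernel, hx]
  split_ifs
  · field_simp
  · ring

lemma sum_reproKernel_mul_evalAt₁ (h : TwoSphereDesign X w r₁ r₂) {x : E n} (hx : ‖x‖ = r₁)
    {f : MvPolynomial (Fin n) ℝ} (hf : f ∈ evenQuartics n) :
    ∑ y ∈ X, w y * reproKernel X w r₁ r₂ x y * evalAt f y = evalAt f x := by
  have hle : evenQuartics n ≤ LinearMap.ker
      ((∑ y ∈ X, (w y * reproKernel X w r₁ r₂ x y) • evalLin y) - evalLin x) := by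
    apply evenQuartics_le <;> intro v <;>
      simp only [LinearMap.mem_ker, LinearMap.sub_apply, LinearMap.coe_sum, Finset.sum_apply,
        LinearMap.smul_apply, evalLin_apply, smul_eq_mul, evalAt_pow, evalAt_linPoly] <;>
      rw [h.sum_reproKernel_mul hx (by norm_num), real_inner_comm x v]
    · rw [sphereMean_zonalTwo_zero h.two_le _ _ h.pos₁ hx,
        sphereMean_zonalFour_zero h.two_le _ _ h.pos₁.le,
        sphereMean_zonalFour_zero h.two_le _ _ h.pos₂.le]
      simp
    · rw [sphereMean_zonalTwo_two h.two_le _ _ h.pos₁ hx,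
        sphereMean_zonalFour_two h.two_le _ _ h.pos₁.le,
        sphereMean_zonalFour_two h.two_le _ _ h.pos₂.le]
      simp
    · rw [sphereMean_zonalTwo_four h.two_le _ _ h.pos₁ hx,
        sphereMean_zonalFour_four h.two_le _ _ h.pos₁.le,
        sphereMean_zonalFour_four h.two_le _ _ h.pos₂.le]
      have := h.momentEight_pos.ne'
      field_simp
      rw [momentEight]
      ring
  have := hle hf
  simpa [LinearMap.mem_ker, sub_eq_zero] using this

/-- The values of an even quartic on the two spheres are determined by its values on `X`. -/
lemma sum_reproKernel_mul_evalAt (h : TwoSphereDesign X w r₁ r₂) {x : E n}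
    (hx : ‖x‖ = r₁ ∨ ‖x‖ = r₂) {f : MvPolynomial (Fin n) ℝ} (hf : f ∈ evenQuartics n) :
    ∑ y ∈ X, w y * reproKernel X w r₁ r₂ x y * evalAt f y = evalAt f x := by
  rcases hx with hx | hx
  · exact h.sum_reproKernel_mul_evalAt₁ hx hf
  · simp_rw [reproKernel_comm_radii X w r₁ r₂]
    exact h.symm.sum_reproKernel_mul_evalAt₁ hx hf

end TwoSphereDesign

end EuclideanDesign

end

noncomputable section

open MeasureTheory
open scoped Classical

namespace EuclideanDesign

variable {n : ℕ}

/-! ### Tight designs are antipodal -/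

/-- Restriction of polynomials to the points of a finite set. -/
def restrictPts (X : Finset (E n)) : MvPolynomial (Fin n) ℝ →ₗ[ℝ] (X → ℝ) :=
  LinearMap.pi fun x => evalLin (x : E n)

@[simp] lemma restrictPts_apply (X : Finset (E n)) (f : MvPolynomial (Fin n) ℝ) (x : X) :
    restrictPts X f x = evalAt f x := rfl

/-- The restrictions of the even quartics to a finite set. -/
def quarticValues (X : Finset (E n)) : Submodule ℝ (X → ℝ) := (evenQuartics n).map (restrictPts X)

/-- A product of nonzero linear forms is a nonzero polynomial, hence has a nonzero value over the
infinite field ℝ. -/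
lemma exists_inner_ne_zero (X : Finset (E n)) (hX : ∀ x ∈ X, x ≠ 0) :
    ∃ l : E n, ∀ x ∈ X, inner ℝ l x ≠ 0 := by
  have hp : (∏ x ∈ X, linPoly x) ≠ 0 := by
    rw [Finset.prod_ne_zero_iff]
    intro x hx h0
    have h1 := evalAt_linPoly x x
    rw [h0, real_inner_self_eq_norm_sq] at h1
    have : ‖x‖ ^ 2 ≠ 0 := pow_ne_zero _ (norm_ne_zero_iff.2 (hX x hx))
    exact this (by rw [← h1]; simp [evalAt])
  obtain ⟨v, hv⟩ : ∃ v : Fin n → ℝ, MvPolynomial.eval v (∏ x ∈ X, linPoly x) ≠ 0 := by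
    by_contra! hcon
    exact hp (MvPolynomial.funext fun v => by simp [hcon v])
  refine ⟨WithLp.toLp 2 v, fun x hx => ?_⟩
  rw [map_prod, Finset.prod_ne_zero_iff] at hv
  have := hv x hx
  rw [real_inner_comm, ← evalAt_linPoly]
  exact this

namespace TwoSphereDesign

variable {X : Finset (E n)} {w : E n → ℝ} {r₁ r₂ : ℝ}

lemma ne_zero (h : TwoSphereDesign X w r₁ r₂) {x : E n} (hx : x ∈ X) : x ≠ 0 := by
  rw [← norm_pos_iff]
  rcases h.norm_eq hx with h' | h' <;> rw [h']
  exacts [h.pos₁, h.pos₂]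

/-- No dimension is lost in passing from the spheres to `X`: the reproducing formula recovers an
even quartic on both spheres from its values on `X`. -/
lemma finrank_quarticValues (h : TwoSphereDesign X w r₁ r₂) :
    Module.finrank ℝ (quarticValues X) =
      Module.finrank ℝ (polySpaceStar 4 (sphereUnion X)) := by
  let ι : X → sphereUnion X := fun x => ⟨x, Finset.mem_image_of_mem _ x.2⟩
  let R : (sphereUnion X → ℝ) →ₗ[ℝ] (X → ℝ) := LinearMap.funLeft ℝ ℝ ι
  have hR : quarticValues X = (polySpaceStar 4 (sphereUnion X)).map R := by
    rw [polySpaceStar, ← Submodule.map_comp]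
    rfl
  rw [hR, ← LinearMap.range_domRestrict]
  apply LinearMap.finrank_range_of_inj
  rw [← LinearMap.ker_eq_bot, LinearMap.ker_eq_bot']
  rintro ⟨g, hg⟩ h0
  obtain ⟨f, hf, rfl⟩ := hg
  ext x
  have hx : ‖(x : E n)‖ = r₁ ∨ ‖(x : E n)‖ = r₂ := by
    have := x.2
    simpa [sphereUnion, h.radii_eq] using this
  have h1 : ∀ y ∈ X, evalAt f y = 0 := fun y hy => congrFun h0 ⟨y, hy⟩
  change evalAt f x = 0
  rw [← h.sum_reproKernel_mul_evalAt hx hf]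
  exact Finset.sum_eq_zero fun y hy => by rw [h1 y hy, mul_zero]

/-- Products of two even quartics and a linear form have sum zero. -/
lemma sum_mul_inner_eq_zero (h : TwoSphereDesign X w r₁ r₂) {f g : MvPolynomial (Fin n) ℝ}
    (hf : f ∈ evenQuartics n) (hg : g ∈ evenQuartics n) (v : E n) :
    ∑ x ∈ X, w x * (evalAt f x * (inner ℝ v x * evalAt g x)) = 0 := by
  have hp : IsPoly 9 (fun x => evalAt f x * (inner ℝ v x ^ 1 * evalAt g x)) :=
    (isPoly_of_mem hf).mul ((IsPoly.inner_pow v 1).mul (isPoly_of_mem hg))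
  have h1 := h.sum_eq hp
  rw [sphereMean_odd hp.continuous, sphereMean_odd hp.continuous] at h1
  · simpa using h1
  all_goals
    intro x
    rw [evalAt_neg_of_mem hf, evalAt_neg_of_mem hg, inner_neg_right]
    ring

/-- Multiplication of functions on `X` by a linear form. -/
def mulForm (X : Finset (E n)) (l : E n) : (X → ℝ) →ₗ[ℝ] (X → ℝ) :=
  LinearMap.mulLeft ℝ fun x : X => inner ℝ l (x : E n)

lemma mulForm_apply (l : E n) (u : X → ℝ) (x : X) :
    mulForm X l u x = inner ℝ l (x : E n) * u x := rfl

lemma mulForm_injective {l : E n} (hl : ∀ x ∈ X, inner ℝ l x ≠ 0) :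
    Function.Injective (mulForm X l) := by
  rw [← LinearMap.ker_eq_bot, LinearMap.ker_eq_bot']
  intro u hu
  ext x
  have := congrFun hu x
  rw [mulForm_apply] at this
  exact (mul_eq_zero.1 this).resolve_left (hl x x.2)

lemma evalAt_eq_zero_of_sum (h : TwoSphereDesign X w r₁ r₂) (a : MvPolynomial (Fin n) ℝ)
    (ha : ∑ x ∈ X, w x * (evalAt a x * evalAt a x) = 0) : ∀ x ∈ X, evalAt a x = 0 := by
  intro x hx
  have := (Finset.sum_eq_zero_iff_of_nonneg (fun x hx =>
    mul_nonneg (h.design.weight_pos x hx).le (mul_self_nonneg _))).1 ha x hx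
  exact mul_self_eq_zero.1 ((mul_eq_zero.1 this).resolve_left (h.design.weight_pos x hx).ne')

/-- The two subspaces are orthogonal for the weighted inner product, so a common element has norm
zero. -/
lemma disjoint_mulForm (h : TwoSphereDesign X w r₁ r₂) (l : E n) :
    Disjoint (quarticValues X) ((quarticValues X).map (mulForm X l)) := by
  rw [Submodule.disjoint_def]
  rintro _ ⟨a, ha, rfl⟩ ⟨_, ⟨b, hb, rfl⟩, hab⟩
  have hab' : ∀ x ∈ X, inner ℝ l x * evalAt b x = evalAt a x := fun x hx => congrFun hab ⟨x, hx⟩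
  have h0 := h.evalAt_eq_zero_of_sum a (by
    rw [← h.sum_mul_inner_eq_zero ha hb l]
    exact Finset.sum_congr rfl fun x hx => by rw [hab' x hx])
  ext x
  exact h0 x x.2

lemma finrank_map_mulForm {l : E n} (hl : ∀ x ∈ X, inner ℝ l x ≠ 0) :
    Module.finrank ℝ ((quarticValues X).map (mulForm X l)) =
      Module.finrank ℝ (quarticValues X) :=
  (Submodule.equivMapOfInjective _ (mulForm_injective hl) _).finrank_eq.symm

/-- By dimension count V ⊕ lV is everything. The product of `v` and `g` is orthogonal to V, as is
lV, so its component in V vanishes. Thus division by `l` after multiplication by `v` stays within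
even quartics on `X`. -/
lemma exists_ratio (h : TwoSphereDesign X w r₁ r₂)
    (hcard : X.card = 2 * Module.finrank ℝ (polySpaceStar 4 (sphereUnion X))) {l : E n}
    (hl : ∀ x ∈ X, inner ℝ l x ≠ 0) (v : E n) {g : MvPolynomial (Fin n) ℝ}
    (hg : g ∈ evenQuartics n) :
    ∃ b ∈ evenQuartics n, ∀ x ∈ X, inner ℝ v x * evalAt g x = inner ℝ l x * evalAt b x := by
  have htop : quarticValues X ⊔ (quarticValues X).map (mulForm X l) = ⊤ := by
    apply Submodule.eq_top_of_disjoint _ _ _ (h.disjoint_mulForm l)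
    rw [finrank_map_mulForm hl, h.finrank_quarticValues, Module.finrank_fintype_fun_eq_card,
      Fintype.card_coe, hcard]
    omega
  have hmem : (fun x : X => inner ℝ v (x : E n) * evalAt g x) ∈
      quarticValues X ⊔ (quarticValues X).map (mulForm X l) := by rw [htop]; trivial
  obtain ⟨_, ⟨a, ha, rfl⟩, _, ⟨_, ⟨b, hb, rfl⟩, rfl⟩, hab⟩ := Submodule.mem_sup.1 hmem
  have hab' : ∀ x ∈ X, evalAt a x + inner ℝ l x * evalAt b x = inner ℝ v x * evalAt g x :=
    fun x hx => congrFun hab ⟨x, hx⟩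
  have h0 := h.evalAt_eq_zero_of_sum a (by
    have e1 := h.sum_mul_inner_eq_zero ha hg v
    have e2 := h.sum_mul_inner_eq_zero ha hb l
    rw [← sub_eq_zero.2 (e1.trans e2.symm), ← Finset.sum_sub_distrib]
    refine Finset.sum_congr rfl fun x hx => ?_
    rw [← hab' x hx]
    ring)
  refine ⟨b, hb, fun x hx => ?_⟩
  rw [← hab' x hx, h0 x hx, zero_add]

/-- An antipodal design all of whose antipodal pairs are separated by even quartics is tight. -/
lemma card_eq_of_separating (h : TwoSphereDesign X w r₁ r₂)
    (hsep : ∀ x ∈ X, ∃ f ∈ evenQuartics n, evalAt f x ≠ 0 ∧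
      ∀ y ∈ X, y ≠ x → y ≠ -x → evalAt f y = 0) :
    X.card = 2 * Module.finrank ℝ (polySpaceStar 4 (sphereUnion X)) := by
  obtain ⟨l, hl⟩ := exists_inner_ne_zero X fun x hx => h.ne_zero hx
  have htop : quarticValues X ⊔ (quarticValues X).map (mulForm X l) = ⊤ := by
    rw [eq_top_iff, ← (Pi.basisFun ℝ X).span_eq, Submodule.span_le]
    rintro _ ⟨x, rfl⟩
    obtain ⟨f, hf, hfx, hfX⟩ := hsep x x.2
    have e1 : restrictPts X f ∈ quarticValues X := ⟨f, hf, rfl⟩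
    -- The indicator of `x` is written as its even half plus its odd half; they add up at `x` and
    -- cancel at `-x`.
    refine Submodule.mem_sup.2 ⟨(2 * evalAt f x)⁻¹ • restrictPts X f,
      Submodule.smul_mem _ _ e1, mulForm X l ((2 * evalAt f x * inner ℝ l x)⁻¹ • restrictPts X f),
      ⟨_, Submodule.smul_mem _ _ e1, rfl⟩, ?_⟩
    ext y
    have hlx := hl x x.2
    simp only [Pi.add_apply, mulForm_apply, Pi.smul_apply, restrictPts_apply, smul_eq_mul,
      Pi.basisFun_apply]
    by_cases hy : y = x
    · subst hy
      rw [Pi.single_eq_same]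
      field_simp
      norm_num
    · rw [Pi.single_eq_of_ne hy]
      by_cases hy' : (y : E n) = -x
      · rw [hy', evalAt_neg_of_mem hf, inner_neg_right]
        field_simp
        norm_num
      · rw [hfX y y.2 (fun hh => hy (Subtype.ext hh)) hy']
        ring
  have h1 := Submodule.finrank_sup_add_finrank_inf_eq (quarticValues X)
    ((quarticValues X).map (mulForm X l))
  rw [htop, (h.disjoint_mulForm l).eq_bot, finrank_bot, finrank_top, finrank_map_mulForm hl,
    h.finrank_quarticValues, Module.finrank_fintype_fun_eq_card, Fintype.card_coe] at h1
  omega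

/-- The points other than `±x` are removed one at a time, each by a quotient v/l with v vanishing
there. `exists_ratio` keeps the result an even quartic, so the degree never grows. -/
lemma exists_separating₁ (h : TwoSphereDesign X w r₁ r₂)
    (hcard : X.card = 2 * Module.finrank ℝ (polySpaceStar 4 (sphereUnion X))) {x : E n}
    (hx : x ∈ X) (hxr : ‖x‖ = r₁) :
    ∃ f ∈ evenQuartics n, evalAt f x ≠ 0 ∧ ∀ y ∈ X, y ≠ x → y ≠ -x → evalAt f y = 0 := by
  obtain ⟨l, hl⟩ := exists_inner_ne_zero X fun x hx => h.ne_zero hx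
  have key : ∀ T : Finset (E n), T ⊆ X → ∃ f ∈ evenQuartics n, evalAt f x ≠ 0 ∧
      (∀ y ∈ X, ‖y‖ ≠ r₁ → evalAt f y = 0) ∧ ∀ y ∈ T, y ≠ x → y ≠ -x → evalAt f y = 0 := by
    intro T
    induction T using Finset.induction_on with
    | empty =>
      intro _
      -- The induction starts from a function that vanishes on the whole other sphere.
      refine ⟨normPoly n + MvPolynomial.C (-r₂ ^ 2), ?_, ?_, ?_, by simp⟩
      · refine add_mem (homogeneous_le_evenQuartics (by simp) (normPoly_isHomogeneous n))
          (homogeneous_le_evenQuartics (m := 0) (by simp) (MvPolynomial.isHomogeneous_C _ _))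
      · rw [evalAt_add, evalAt_normPoly, evalAt_C, hxr]
        exact h.sq_sub_ne
      · intro y hy hyr
        rw [evalAt_add, evalAt_normPoly, evalAt_C, (h.norm_eq hy).resolve_left hyr]
        ring
    | insert y T hyT ih =>
      intro hT
      obtain ⟨f, hf, hfx, hfr, hfT⟩ := ih ((Finset.subset_insert _ _).trans hT)
      have hyX : y ∈ X := hT (Finset.mem_insert_self _ _)
      by_cases hy : y = x ∨ y = -x ∨ ‖y‖ ≠ r₁
      · refine ⟨f, hf, hfx, hfr, fun z hz hzx hzx' => ?_⟩
        rcases Finset.mem_insert.1 hz with rfl | hz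
        · rcases hy with hy | hy | hy
          · exact absurd hy hzx
          · exact absurd hy hzx'
          · exact hfr _ hyX hy
        · exact hfT z hz hzx hzx'
      · push Not at hy
        obtain ⟨hy1, hy2, hyr⟩ := hy
        -- This form is orthogonal to `y`. It vanishes at `x` only in the equality case of
        -- Cauchy–Schwarz, which for equal norms means `y = ±x`.
        obtain ⟨b, hb, hbf⟩ := h.exists_ratio hcard hl (‖y‖ ^ 2 • x - inner ℝ x y • y) hf
        have hzero : ∀ z ∈ X, evalAt f z = 0 → evalAt b z = 0 := fun z hz hfz => by
          have := hbf z hz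
          rw [hfz, mul_zero, eq_comm] at this
          exact (mul_eq_zero.1 this).resolve_left (hl z hz)
        refine ⟨b, hb, ?_, fun z hz hzr => hzero z hz (hfr z hz hzr), fun z hz hzx hzx' => ?_⟩
        · intro hbx
          have := hbf x hx
          rw [hbx, mul_zero] at this
          have h1 := (mul_eq_zero.1 this).resolve_right hfx
          rw [inner_sub_left, real_inner_smul_left, real_inner_smul_left, real_inner_comm x y,
            real_inner_self_eq_norm_sq, hyr, hxr] at h1
          have h2 : (inner ℝ x y - r₁ ^ 2) * (inner ℝ x y + r₁ ^ 2) = 0 := by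
            linear_combination -h1
          rcases mul_eq_zero.1 h2 with h3 | h3
          · apply hy1
            rw [← sub_eq_zero, ← norm_eq_zero, ← sq_eq_zero_iff, norm_sub_sq_real, hyr, hxr,
              real_inner_comm]
            linear_combination -2 * h3
          · apply hy2
            rw [← sub_eq_zero, sub_neg_eq_add, ← norm_eq_zero, ← sq_eq_zero_iff, norm_add_sq_real,
              hyr, hxr, real_inner_comm]
            linear_combination 2 * h3
        · rcases Finset.mem_insert.1 hz with rfl | hz
          · have := hbf z hyX
            rw [inner_sub_left, real_inner_smul_left, real_inner_smul_left,
              real_inner_self_eq_norm_sq] at this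
            have h1 : inner ℝ l z * evalAt b z = 0 := by rw [← this]; ring
            exact (mul_eq_zero.1 h1).resolve_left (hl z hyX)
          · exact hzero z (hT (Finset.mem_insert_of_mem hz)) (hfT z hz hzx hzx')
  obtain ⟨f, hf, hfx, -, hfX⟩ := key X subset_rfl
  exact ⟨f, hf, hfx, hfX⟩

lemma exists_separating (h : TwoSphereDesign X w r₁ r₂)
    (hcard : X.card = 2 * Module.finrank ℝ (polySpaceStar 4 (sphereUnion X))) {x : E n}
    (hx : x ∈ X) :
    ∃ f ∈ evenQuartics n, evalAt f x ≠ 0 ∧ ∀ y ∈ X, y ≠ x → y ≠ -x → evalAt f y = 0 := by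
  rcases h.norm_eq hx with hr | hr
  · exact h.exists_separating₁ hcard hx hr
  · exact h.symm.exists_separating₁ hcard hx hr

lemma ne_neg (h : TwoSphereDesign X w r₁ r₂) {x : E n} (hx : x ∈ X) : x ≠ -x :=
  fun h0 => h.ne_zero hx <| by
    have h1 : (2 : ℝ) • x = 0 := by
      rw [two_smul]
      nth_rewrite 2 [h0]
      exact add_neg_cancel x
    exact (smul_eq_zero.1 h1).resolve_left two_ne_zero

lemma sum_of_support (h : TwoSphereDesign X w r₁ r₂) {x : E n} (hx : x ∈ X) (hnx : -x ∈ X)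
    {F : E n → ℝ} (hF : ∀ y ∈ X, y ≠ x → y ≠ -x → F y = 0) :
    ∑ y ∈ X, F y = F x + F (-x) := by
  rw [← Finset.sum_pair (h.ne_neg hx)]
  symm
  apply Finset.sum_subset
  · intro y hy
    rcases Finset.mem_insert.1 hy with rfl | hy
    · exact hx
    · rw [Finset.mem_singleton.1 hy]; exact hnx
  · intro y hy hy'
    simp only [Finset.mem_insert, Finset.mem_singleton, not_or] at hy'
    exact hF y hy hy'.1 hy'.2

/-- Let f be a separating function for `x`. The sum of w f² ⟨x,·⟩ over `X` is zero by oddness, but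
without `-x` it would reduce to one nonzero term. The same sum with both terms present gives
equality of the weights. -/
lemma neg_mem (h : TwoSphereDesign X w r₁ r₂)
    (hcard : X.card = 2 * Module.finrank ℝ (polySpaceStar 4 (sphereUnion X))) {x : E n}
    (hx : x ∈ X) : -x ∈ X := by
  obtain ⟨f, hf, hfx, hfX⟩ := h.exists_separating hcard hx
  by_contra hnx
  have h0 := h.sum_mul_inner_eq_zero hf hf x
  rw [Finset.sum_eq_single x] at h0
  · rw [real_inner_self_eq_norm_sq] at h0
    have h1 := (h.design.weight_pos x hx).ne'
    simp [h1, hfx, h.ne_zero hx] at h0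
  · intro y hy hyx
    rw [hfX y hy hyx (by rintro rfl; exact hnx hy)]
    ring
  · exact fun h' => absurd hx h'

lemma weight_neg (h : TwoSphereDesign X w r₁ r₂)
    (hcard : X.card = 2 * Module.finrank ℝ (polySpaceStar 4 (sphereUnion X))) {x : E n}
    (hx : x ∈ X) : w (-x) = w x := by
  obtain ⟨f, hf, hfx, hfX⟩ := h.exists_separating hcard hx
  have h0 := h.sum_mul_inner_eq_zero hf hf x
  rw [h.sum_of_support hx (h.neg_mem hcard hx)
    (fun y hy h1 h2 => by rw [hfX y hy h1 h2]; ring), evalAt_neg_of_mem hf, inner_neg_right,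
    real_inner_self_eq_norm_sq] at h0
  have h2 : ‖x‖ ≠ 0 := norm_ne_zero_iff.2 (h.ne_zero hx)
  have h3 : (evalAt f x ^ 2 * ‖x‖ ^ 2) * (w x - w (-x)) = 0 := by linear_combination h0
  have h4 := (mul_eq_zero.1 h3).resolve_left (by positivity)
  linarith

/-! ### Orthogonality relations of the kernel on a tight design -/

lemma reproKernel_neg (x y : E n) :
    reproKernel X w r₁ r₂ x (-y) = reproKernel X w r₁ r₂ x y := by
  simp only [reproKernel, zonalTwo, zonalFour, norm_neg, inner_neg_right]
  have e1 : (-inner ℝ x y) ^ 2 = inner ℝ x y ^ 2 := by ring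
  have e2 : (-inner ℝ x y) ^ 4 = inner ℝ x y ^ 4 := by ring
  rw [e1, e2]

/-- In the reproducing formula at `y`, only the two points `±x` contribute, and they contribute
equally. Taking `y = x`, and then other `y`, gives the diagonal and off-diagonal values of the
kernel. -/
lemma evalAt_eq_reproKernel (h : TwoSphereDesign X w r₁ r₂)
    (hcard : X.card = 2 * Module.finrank ℝ (polySpaceStar 4 (sphereUnion X))) {x y : E n}
    (hx : x ∈ X) (hy : y ∈ X) {f : MvPolynomial (Fin n) ℝ} (hf : f ∈ evenQuartics n)
    (hfX : ∀ y ∈ X, y ≠ x → y ≠ -x → evalAt f y = 0) :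
    2 * w x * reproKernel X w r₁ r₂ y x * evalAt f x = evalAt f y := by
  have h0 := h.sum_reproKernel_mul_evalAt (h.norm_eq hy) hf
  rw [h.sum_of_support hx (h.neg_mem hcard hx) (fun y hy h1 h2 => by rw [hfX y hy h1 h2]; ring),
    evalAt_neg_of_mem hf, h.weight_neg hcard hx, reproKernel_neg] at h0
  linear_combination h0

lemma reproKernel_self (h : TwoSphereDesign X w r₁ r₂)
    (hcard : X.card = 2 * Module.finrank ℝ (polySpaceStar 4 (sphereUnion X))) {x : E n}
    (hx : x ∈ X) : 2 * w x * reproKernel X w r₁ r₂ x x = 1 := by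
  obtain ⟨f, hf, hfx, hfX⟩ := h.exists_separating hcard hx
  have := h.evalAt_eq_reproKernel hcard hx hx hf hfX
  exact mul_right_cancel₀ hfx (by linear_combination this)

lemma reproKernel_eq_zero (h : TwoSphereDesign X w r₁ r₂)
    (hcard : X.card = 2 * Module.finrank ℝ (polySpaceStar 4 (sphereUnion X))) {x y : E n}
    (hx : x ∈ X) (hy : y ∈ X) (hyx : y ≠ x) (hyx' : y ≠ -x) :
    reproKernel X w r₁ r₂ y x = 0 := by
  obtain ⟨f, hf, hfx, hfX⟩ := h.exists_separating hcard hx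
  have h0 := h.evalAt_eq_reproKernel hcard hx hy hf hfX
  rw [hfX y hy hyx hyx'] at h0
  have h1 := (mul_eq_zero.1 h0).resolve_right hfx
  exact (mul_eq_zero.1 h1).resolve_left (by have := h.design.weight_pos x hx; positivity)

/-- Points of different norms are orthogonal with respect to the zonal kernel of degree four. -/
lemma zonalFour_eq_zero (h : TwoSphereDesign X w r₁ r₂)
    (hcard : X.card = 2 * Module.finrank ℝ (polySpaceStar 4 (sphereUnion X))) {x y : E n}
    (hx : x ∈ X) (hy : y ∈ X) (hxy : ‖x‖ ≠ ‖y‖) : zonalFour x y = 0 := by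
  have h0 := h.reproKernel_eq_zero hcard hy hx (by rintro rfl; exact hxy rfl)
    (by rintro rfl; exact hxy (norm_neg _))
  rw [reproKernel, if_neg hxy.symm, zero_add] at h0
  exact (div_eq_zero_iff.1 h0).resolve_right h.momentEight_pos.ne'

end TwoSphereDesign

end EuclideanDesign

end

noncomputable section

open MeasureTheory
open scoped Classical

namespace EuclideanDesign

/-! ### A Diophantine exclusion -/

/-- The quadratic polynomial in `a` whose sign compares `M ^ 2` with `K ^ 2 + c`. -/
def gapPoly (n c a : ℝ) : ℝ :=
  c * 6 * (24 * (n + 1) * a ^ 2 - 8 * (n + 1) * a + n + 2)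
    - (n + 2) * (n + 4) * (8 * (n + 1) * a - (n - 1))

/-! ### Sign certificates for large n -/

section

variable {n K : ℝ}

lemma lower_bound_K (hn : 241 ≤ n) (hK0 : 0 < K) (hK : 6 * K ^ 2 = (n + 1) * (n + 2)) :
    4082 / 10000 * n + 6 / 10 ≤ K := by
  apply le_of_sq_le_sq _ hK0.le
  nlinarith

lemma upper_bound_K (hn : 241 ≤ n) (hK : 6 * K ^ 2 = (n + 1) * (n + 2)) :
    K ≤ 40825 / 100000 * n + 6124 / 10000 := by
  apply le_of_sq_le_sq _ (by positivity)
  nlinarith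

/-- In the certificates that use this, `f` is a sign expression reduced modulo `6 * K ^ 2 = (n + 1)
* (n + 2)` until it is linear in `K`. Measured from `n = 241` and from the near-optimal linear bound
for `K`, it has no negative coefficient, so `positivity` finishes. The lower bound serves when the
coefficient of `K` is positive, the upper bound of `pos_of_upper` when it is negative. -/
lemma pos_of_lower {f : ℝ → ℝ → ℝ} (hn : 241 ≤ n) (hK0 : 0 < K)
    (hK : 6 * K ^ 2 = (n + 1) * (n + 2))
    (h : ∀ t s : ℝ, 0 ≤ t → 0 ≤ s → 0 < f (241 + t) (4082 / 10000 * (241 + t) + 6 / 10 + s)) :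
    0 < f n K := by
  have := h (n - 241) (K - (4082 / 10000 * n + 6 / 10)) (by linarith)
    (by linarith [lower_bound_K hn hK0 hK])
  convert this using 2 <;> ring

lemma pos_of_upper {f : ℝ → ℝ → ℝ} (hn : 241 ≤ n)
    (hK : 6 * K ^ 2 = (n + 1) * (n + 2))
    (h : ∀ t s : ℝ, 0 ≤ t → 0 ≤ s →
      0 < f (241 + t) (40825 / 100000 * (241 + t) + 6124 / 10000 - s)) :
    0 < f n K := by
  have := h (n - 241) (40825 / 100000 * n + 6124 / 10000 - K) (by linarith)
    (by linarith [upper_bound_K hn hK])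
  convert this using 2 <;> ring

lemma gapPoly_mid_neg (hn : 241 ≤ n) (hK : 6 * K ^ 2 = (n + 1) * (n + 2)) :
    gapPoly n (2 * K + 1) ((n + 6) / 24) < 0 := by
  have := pos_of_upper (f := fun n K => (1/3)*n^4 + (-1/2)*n^3*K + (37/12)*n^3 + (-5/2)*n^2*K
    + (149/12)*n^2 + (-8)*n*K + (74/3)*n + (-18)*K + 15) hn hK
    (fun t s ht hs => by ring_nf; positivity)
  unfold gapPoly
  linear_combination this

lemma gapPoly_lower_neg (hn : 241 ≤ n) (hK0 : 0 < K) (hK : 6 * K ^ 2 = (n + 1) * (n + 2)) :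
    gapPoly n (2 * K + 1) (K / 6) < 0 := by
  have := pos_of_lower (f := fun n K => n^3 + 4*n^2*K + 3*n^2 + 8*n*K + 2*n - 8*K) hn hK0 hK
    (fun t s ht hs => by ring_nf; positivity)
  unfold gapPoly
  linear_combination this - ((-4/3)*n*K + 2*n + (-4/3)*K + 2) * hK

lemma gapPoly_upper_pos (hn : 241 ≤ n) (hK : 6 * K ^ 2 = (n + 1) * (n + 2)) :
    0 < gapPoly n (2 * K + 1) (K / 6 + 1 / 2) := by
  have := pos_of_upper (f := fun n K => 3*n^3 - 4*n^2*K + n^2 + 40*n*K - 6*n + 56*K - 4) hn hK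
    (fun t s ht hs => by ring_nf; positivity)
  unfold gapPoly
  linear_combination this - ((4/3)*n*K + 6*n + (4/3)*K + 6) * hK

lemma gapPoly_four_neg_left (hn : 241 ≤ n) (hK : 6 * K ^ 2 = (n + 1) * (n + 2)) :
    gapPoly n (8 * K + 16) ((n + 6) / 12 - K / 6 - 1 / 2) < 0 := by
  have := pos_of_upper (f := fun n K => 6*n^4 + (-44/3)*n^3*K + (-37/3)*n^3 + (172/3)*n^2*K
    + (-19/3)*n^2 + (-376/3)*n*K + (-374/3)*n + (-736/3)*K + (-680/3)) hn hK
    (fun t s ht hs => by ring_nf; positivity)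
  unfold gapPoly
  linear_combination this - ((16/3)*n^2 + (-16/3)*n*K + (-16)*n + (-16/3)*K + (-64/3)) * hK

lemma gapPoly_four_neg_right (hn : 241 ≤ n) (hK : 6 * K ^ 2 = (n + 1) * (n + 2)) :
    gapPoly n (8 * K + 16) ((n + 6) / 12 - K / 6) < 0 := by
  have := pos_of_upper (f := fun n K => 6*n^4 + (-44/3)*n^3*K + (71/3)*n^3 + (-116/3)*n^2*K
    + (-127/3)*n^2 + (200/3)*n*K + (-878/3)*n + (128/3)*K + (-968/3)) hn hK
    (fun t s ht hs => by ring_nf; positivity)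
  unfold gapPoly
  linear_combination this - ((16/3)*n^2 + (-16/3)*n*K + 16*n + (-16/3)*K + (32/3)) * hK

lemma gapPoly_five_pos_left (hn : 241 ≤ n) (hK0 : 0 < K) (hK : 6 * K ^ 2 = (n + 1) * (n + 2)) :
    0 < gapPoly n (10 * K + 25) ((n + 6) / 12 - K / 6 - 1 / 2) := by
  have := pos_of_lower (f := fun n K => (-22/3)*n^4 + 18*n^3*K + (74/3)*n^3 + (-94)*n^2*K
    + (22/3)*n^2 + 172*n*K + (550/3)*n + 344*K + 352) hn hK0 hK
    (fun t s ht hs => by ring_nf; positivity)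
  unfold gapPoly
  linear_combination this - ((-20/3)*n^2 + (20/3)*n*K + (70/3)*n + (20/3)*K + 30) * hK

lemma gapPoly_five_slope_pos (hn : 241 ≤ n) (hK0 : 0 < K) (hK : 6 * K ^ 2 = (n + 1) * (n + 2)) :
    0 < (10 * K + 25) * 6 * (48 * (n + 1) * ((n + 6) / 12 - K / 6 - 1 / 2) - 8 * (n + 1))
      - 8 * (n + 1) * (n + 2) * (n + 4) := by
  have := pos_of_lower (f := fun n K => (-88)*n^3 + 240*n^2*K + 224*n^2 + (-1440)*n*K
    + (-1112)*n + (-1680)*K + (-1424)) hn hK0 hK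
    (fun t s ht hs => by ring_nf; positivity)
  linear_combination this - ((-80)*n + (-80)) * hK

end

/-! ### The squeeze between consecutive squares -/

lemma gapPoly_neg_of_between {n c a b x : ℝ} (hn : 0 < n) (hc : 0 < c) (hax : a ≤ x) (hxb : x ≤ b)
    (ha : gapPoly n c a < 0) (hb : gapPoly n c b < 0) : gapPoly n c x < 0 := by
  rcases eq_or_lt_of_le (hax.trans hxb) with hab | hab
  · have : x = a := le_antisymm (by linarith) hax
    rwa [this]
  -- Interpolation formula for a quadratic with leading coefficient `144 * c * (n + 1)`: by
  -- convexity it lies below its chord.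
  have key : (b - a) * gapPoly n c x =
      (b - x) * gapPoly n c a + (x - a) * gapPoly n c b
        - (b - a) * (x - a) * (b - x) * (144 * c * (n + 1)) := by
    unfold gapPoly; ring
  have h1 : (b - x) * gapPoly n c a + (x - a) * gapPoly n c b < 0 := by
    rcases eq_or_lt_of_le hax with h | h
    · subst h
      nlinarith
    · nlinarith
  have h2 : 0 ≤ (b - a) * (x - a) * (b - x) * (144 * c * (n + 1)) := by
    have := sub_nonneg.2 hax
    have := sub_nonneg.2 hxb
    have := sub_pos.2 hab
    positivity
  nlinarith

/-- The equation satisfied by `M`, in terms of the gap between `M ^ 2` and `K ^ 2`. -/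
lemma gapPoly_eq_zero {n K M a : ℝ} (hK : 6 * K ^ 2 = (n + 1) * (n + 2))
    (hM : M ^ 2 * (24 * (n + 1) * a ^ 2 - 8 * (n + 1) * a + n + 2) =
      (n + 2) * (1 + 2 * (n + 1) * a) ^ 2) : gapPoly n (M ^ 2 - K ^ 2) a = 0 := by
  unfold gapPoly
  linear_combination 6 * hM - (24 * (n + 1) * a ^ 2 - 8 * (n + 1) * a + n + 2) * hK

lemma quad_pos {n a : ℝ} (hn : 0 < n) (ha : 1 / 3 ≤ a) :
    0 < 24 * (n + 1) * a ^ 2 - 8 * (n + 1) * a + n + 2 := by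
  nlinarith [mul_nonneg (by linarith : 0 ≤ a) (by linarith : 0 ≤ 3 * a - 1)]

lemma gapPoly_sub {n c d a : ℝ} : gapPoly n c a - gapPoly n d a =
    (c - d) * 6 * (24 * (n + 1) * a ^ 2 - 8 * (n + 1) * a + n + 2) := by
  unfold gapPoly; ring

/-- For `1 / 3 ≤ a` the polynomial is strictly increasing in its gap argument (`quad_pos`), so its
sign at `c` locates `c` relative to the true gap `d`. -/
lemma lt_of_gapPoly_neg {n c d a : ℝ} (hn : 0 < n) (ha : 1 / 3 ≤ a) (hd : gapPoly n d a = 0)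
    (hc : gapPoly n c a < 0) : c < d := by
  have h1 := gapPoly_sub (n := n) (c := c) (d := d) (a := a)
  have h2 := quad_pos hn ha
  nlinarith

lemma lt_of_gapPoly_pos {n c d a : ℝ} (hn : 0 < n) (ha : 1 / 3 ≤ a) (hd : gapPoly n d a = 0)
    (hc : 0 < gapPoly n c a) : d < c := by
  have h1 := gapPoly_sub (n := n) (c := c) (d := d) (a := a)
  have h2 := quad_pos hn ha
  nlinarith

lemma K_lt_M {n a : ℝ} {K M : ℤ} (hn : 23 ≤ n) (hM0 : 0 < M) (ha : 1 / 3 ≤ a)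
    (hg : gapPoly n ((M : ℝ) ^ 2 - (K : ℝ) ^ 2) a = 0) : K < M := by
  have h1 : (0 : ℝ) < (M : ℝ) ^ 2 - (K : ℝ) ^ 2 := by
    apply lt_of_gapPoly_neg (by linarith) ha hg
    unfold gapPoly
    have : 0 < 8 * (n + 1) * a - (n - 1) := by nlinarith
    have : 0 < (n + 2) * (n + 4) * (8 * (n + 1) * a - (n - 1)) := by positivity
    linarith
  have h2 : K ^ 2 < M ^ 2 := by exact_mod_cast sub_pos.1 h1
  exact lt_of_pow_lt_pow_left₀ 2 hM0.le h2

/-- In all but one case the integers `M₁`, `M₂` are squeezed between consecutive integers. -/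
lemma no_solution_of_large {n a b : ℝ} {K M₁ M₂ : ℤ} (hn : 241 ≤ n) (hK0 : 0 < K)
    (hK : 6 * (K : ℝ) ^ 2 = (n + 1) * (n + 2)) (hM₁ : 0 < M₁) (hM₂ : 0 < M₂)
    (hb : 1 / 3 ≤ b) (hab : b ≤ a) (hsum : a + b = (n + 6) / 12)
    (h₁ : gapPoly n ((M₁ : ℝ) ^ 2 - (K : ℝ) ^ 2) a = 0)
    (h₂ : gapPoly n ((M₂ : ℝ) ^ 2 - (K : ℝ) ^ 2) b = 0) : False := by
  have hn0 : 0 < n := by linarith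
  have hKr : (0 : ℝ) < K := by exact_mod_cast hK0
  have ha : 1 / 3 ≤ a := hb.trans hab
  have hmid : (n + 6) / 24 ≤ a := by linarith
  have hlt := K_lt_M (by linarith) hM₁ ha h₁
  -- The larger parameter is at least half the sum, and there the gap is below 4K + 4 = (K+2)² − K².
  have hM : M₁ = K + 1 := by
    have : M₁ < K + 2 := by
      have h3 : (M₁ : ℝ) ^ 2 - (K : ℝ) ^ 2 < 4 * K + 4 := by
        apply lt_of_gapPoly_pos hn0 ha h₁
        have hlo := lower_bound_K hn hKr hK
        unfold gapPoly
        have e1 : 0 ≤ 3 * a - 1 := by linarith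
        have e2 : (n + 2) * (n + 4) ≤ 3 * (4 * K + 4) * (2 * (3 * a - 1)) := by nlinarith
        have e3 : 0 ≤ 8 * (n + 1) * a := by positivity
        have e4 := mul_le_mul_of_nonneg_right e2 e3
        have e5 : 0 < (n + 2) * (n + 4) * (n - 1) := by
          have : 0 < n - 1 := by linarith
          positivity
        have e6 : 0 < (4 * (K : ℝ) + 4) * 6 * (n + 2) := by positivity
        nlinarith
      have h4 : M₁ ^ 2 < (K + 2) ^ 2 := by
        have : (M₁ : ℝ) ^ 2 < ((K : ℝ) + 2) ^ 2 := by nlinarith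
        exact_mod_cast this
      exact lt_of_pow_lt_pow_left₀ 2 (by omega) h4
    omega
  subst hM
  have hc : ((K + 1 : ℤ) : ℝ) ^ 2 - (K : ℝ) ^ 2 = 2 * K + 1 := by push_cast; ring
  rw [hc] at h₁
  have hcpos : (0 : ℝ) < 2 * K + 1 := by positivity
  -- With the gap fixed at 2K + 1, `a` is a zero of a convex quadratic that is negative at (n+6)/24
  -- and K/6 and positive at K/6 + 1/2. This encloses `a` in an interval of length 1/2.
  have ha1 : K / 6 < a := by
    by_contra! hcon
    have := gapPoly_neg_of_between hn0 hcpos hmid hcon (gapPoly_mid_neg hn hK)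
      (gapPoly_lower_neg hn hKr hK)
    linarith
  have hup := gapPoly_upper_pos hn hK
  have ha2 : a < K / 6 + 1 / 2 := by
    by_contra! hcon
    have hlo := lower_bound_K hn hKr hK
    have key : (a - (n + 6) / 24) * gapPoly n (2 * K + 1) (K / 6 + 1 / 2) =
        (a - (K / 6 + 1 / 2)) * gapPoly n (2 * K + 1) ((n + 6) / 24)
        + ((K / 6 + 1 / 2) - (n + 6) / 24) * gapPoly n (2 * K + 1) a
        - (a - (n + 6) / 24) * ((K / 6 + 1 / 2) - (n + 6) / 24) * (a - (K / 6 + 1 / 2))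
          * (144 * (2 * K + 1) * (n + 1)) := by
      unfold gapPoly; ring
    rw [h₁] at key
    have e1 : 0 < (K : ℝ) / 6 + 1 / 2 - (n + 6) / 24 := by linarith
    have e2 : 0 < a - (n + 6) / 24 := by linarith
    have e3 : 0 ≤ a - (K / 6 + 1 / 2) := by linarith
    have e4 := mul_pos e2 hup
    have e5 := mul_nonneg e3 (neg_nonneg.2 (gapPoly_mid_neg hn hK).le)
    have e6 : 0 ≤ (a - (n + 6) / 24) * ((K / 6 + 1 / 2) - (n + 6) / 24) * (a - (K / 6 + 1 / 2))
          * (144 * (2 * K + 1) * (n + 1)) := by positivity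
    linarith
  have hb1 : (n + 6) / 12 - K / 6 - 1 / 2 ≤ b := by linarith
  have hb2 : b ≤ (n + 6) / 12 - K / 6 := by linarith
  -- The bounds 8K + 16 and 10K + 25 are the gaps of (K+4)² and (K+5)². The first is checked at both
  -- ends of the interval for `b`, the second by value and slope at its left end.
  have h5 : 8 * (K : ℝ) + 16 < (M₂ : ℝ) ^ 2 - (K : ℝ) ^ 2 :=
    lt_of_gapPoly_neg hn0 hb h₂ (gapPoly_neg_of_between hn0 (by positivity) hb1 hb2
      (gapPoly_four_neg_left hn hK) (gapPoly_four_neg_right hn hK))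
  have h6 : (M₂ : ℝ) ^ 2 - (K : ℝ) ^ 2 < 10 * K + 25 := by
    apply lt_of_gapPoly_pos hn0 hb h₂
    have e1 := gapPoly_five_pos_left hn hKr hK
    have e2 := gapPoly_five_slope_pos hn hKr hK
    set b₀ := (n + 6) / 12 - (K : ℝ) / 6 - 1 / 2 with hb₀
    have key : gapPoly n (10 * K + 25) b = gapPoly n (10 * K + 25) b₀ + (b - b₀) *
        ((10 * K + 25) * 6 * (48 * (n + 1) * b₀ - 8 * (n + 1)) - 8 * (n + 1) * (n + 2) * (n + 4))
        + (b - b₀) ^ 2 * (144 * (10 * K + 25) * (n + 1)) := by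
      unfold gapPoly; ring
    rw [key]
    have e3 : 0 ≤ b - b₀ := by linarith
    positivity
  have h7 : (K + 4) ^ 2 < M₂ ^ 2 := by
    have : ((K : ℝ) + 4) ^ 2 < (M₂ : ℝ) ^ 2 := by nlinarith
    exact_mod_cast this
  have h8 : M₂ ^ 2 < (K + 5) ^ 2 := by
    have : (M₂ : ℝ) ^ 2 < ((K : ℝ) + 5) ^ 2 := by nlinarith
    exact_mod_cast this
  have h9 := lt_of_pow_lt_pow_left₀ 2 hM₂.le h7
  have h10 := lt_of_pow_lt_pow_left₀ 2 (by omega) h8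
  omega

lemma no_solution_of_eq {a b : ℝ} {M₁ M₂ : ℤ} (hM₁ : 0 < M₁) (hM₂ : 0 < M₂)
    (hb : 1 / 3 ≤ b) (hab : b ≤ a) (hsum : a + b = (23 + 6) / 12)
    (h₁ : gapPoly 23 ((M₁ : ℝ) ^ 2 - (10 : ℤ) ^ 2) a = 0)
    (h₂ : gapPoly 23 ((M₂ : ℝ) ^ 2 - (10 : ℤ) ^ 2) b = 0) : False := by
  have ha : 1 / 3 ≤ a := hb.trans hab
  have hlt := K_lt_M (K := 10) le_rfl hM₁ ha h₁
  have hM : M₁ = 11 := by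
    have : M₁ < 12 := by
      have h3 : (M₁ : ℝ) ^ 2 - (10 : ℤ) ^ 2 < 44 := by
        apply lt_of_gapPoly_pos (by norm_num) ha h₁
        unfold gapPoly
        nlinarith
      have h4 : M₁ ^ 2 < 12 ^ 2 := by
        have : (M₁ : ℝ) ^ 2 < 12 ^ 2 := by push_cast at h3; linarith
        exact_mod_cast this
      exact lt_of_pow_lt_pow_left₀ 2 (by omega) h4
    omega
  subst hM
  unfold gapPoly at h₁
  push_cast at h₁
  ring_nf at h₁
  -- With M₁ = 11 the parameter `a` is just below 2, so `b` is just above 5/12. The values 125 and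
  -- 156 used next are 15² − 10² and 16² − 10².
  have ha1 : 199 / 100 < a := by nlinarith
  have ha2 : a < 2 := by nlinarith
  have h5 : (125 : ℝ) < (M₂ : ℝ) ^ 2 - (10 : ℤ) ^ 2 := by
    apply lt_of_gapPoly_neg (by norm_num) hb h₂
    unfold gapPoly
    nlinarith
  have h6 : (M₂ : ℝ) ^ 2 - (10 : ℤ) ^ 2 < 156 := by
    apply lt_of_gapPoly_pos (by norm_num) hb h₂
    unfold gapPoly
    nlinarith
  have h7 : 15 ^ 2 < M₂ ^ 2 := by
    have : (15 : ℝ) ^ 2 < (M₂ : ℝ) ^ 2 := by push_cast at h5; linarith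
    exact_mod_cast this
  have h8 : M₂ ^ 2 < 16 ^ 2 := by
    have : (M₂ : ℝ) ^ 2 < 16 ^ 2 := by push_cast at h6; linarith
    exact_mod_cast this
  have h9 := lt_of_pow_lt_pow_left₀ 2 hM₂.le h7
  have h10 := lt_of_pow_lt_pow_left₀ 2 (by omega) h8
  omega

/-- This is a Pell equation whose first solutions with `3 ≤ n` are (23, 10) and (241, 99), so a
finite check below 241 suffices. -/
lemma eq_or_large {n K : ℕ} (hn : 3 ≤ n) (hK : 6 * K ^ 2 = (n + 1) * (n + 2)) :
    (n = 23 ∧ K = 10) ∨ 241 ≤ n := by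
  by_contra! hcon
  have hn' : n < 241 := hcon.2
  have hK' : K < 99 := by
    by_contra! h
    have h1 : (n + 1) * (n + 2) ≤ 241 * 242 := Nat.mul_le_mul (by omega) (by omega)
    have h2 : 99 ^ 2 ≤ K ^ 2 := Nat.pow_le_pow_left h 2
    omega
  have key : ∀ k < 99, ∀ m < 241, 6 * k ^ 2 = (m + 1) * (m + 2) → m < 3 ∨ (m = 23 ∧ k = 10) := by
    decide +kernel
  rcases key K hK' n hn' hK with h | h
  · omega
  · exact hcon.1 h.1 h.2

theorem no_solution {n K : ℕ} {a b : ℝ} {M₁ M₂ : ℤ} (hn : 3 ≤ n)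
    (hK : 6 * K ^ 2 = (n + 1) * (n + 2)) (hM₁ : 0 < M₁) (hM₂ : 0 < M₂)
    (ha : 1 / 3 ≤ a) (hb : 1 / 3 ≤ b) (hsum : a + b = ((n : ℝ) + 6) / 12)
    (h₁ : (M₁ : ℝ) ^ 2 * (24 * ((n : ℝ) + 1) * a ^ 2 - 8 * ((n : ℝ) + 1) * a + n + 2) =
      ((n : ℝ) + 2) * (1 + 2 * ((n : ℝ) + 1) * a) ^ 2)
    (h₂ : (M₂ : ℝ) ^ 2 * (24 * ((n : ℝ) + 1) * b ^ 2 - 8 * ((n : ℝ) + 1) * b + n + 2) =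
      ((n : ℝ) + 2) * (1 + 2 * ((n : ℝ) + 1) * b) ^ 2) : False := by
  wlog hab : b ≤ a generalizing a b M₁ M₂
  · exact this hM₂ hM₁ hb ha (by linarith) h₂ h₁ (le_of_not_ge hab)
  have hKr : 6 * ((K : ℤ) : ℝ) ^ 2 = ((n : ℝ) + 1) * (n + 2) := by exact_mod_cast hK
  have g₁ := gapPoly_eq_zero hKr h₁
  have g₂ := gapPoly_eq_zero hKr h₂
  rcases eq_or_large hn hK with ⟨rfl, rfl⟩ | hlarge
  · exact no_solution_of_eq hM₁ hM₂ hb hab (by exact_mod_cast hsum) (by exact_mod_cast g₁)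
      (by exact_mod_cast g₂)
  · have hK0 : (0 : ℤ) < K := by
      rcases Nat.eq_zero_or_pos K with rfl | h
      · simp at hK
      · exact_mod_cast h
    exact no_solution_of_large (by exact_mod_cast hlarge) hK0 hKr hM₁ hM₂ hb hab hsum g₁ g₂

end EuclideanDesign

end

noncomputable section

open MeasureTheory
open scoped Classical

namespace EuclideanDesign

variable {n : ℕ}

/-! ### The layers of a tight design -/

/-- The squared cosine of the angle between two vectors of norm `r`. -/
def cosSq (r : ℝ) (x y : E n) : ℝ := inner ℝ x y ^ 2 / r ^ 4

/-- The properties of a layer of a tight design; `α` measures the share of the layer in the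
eighth moment. -/
structure TightLayer (L : Finset (E n)) (r α : ℝ) : Prop where
  two_le : 2 ≤ n
  pos : 0 < r
  α_pos : 0 < α
  norm_eq : ∀ x ∈ L, ‖x‖ = r
  neg_mem : ∀ x ∈ L, -x ∈ L
  card_eq : (L.card : ℝ) = n * (n + 1) * (1 + α * (n - 1))
  quad : ∀ x ∈ L, ∀ y ∈ L, y ≠ x → y ≠ -x →
    α * (n + 4) * (n + 2) * cosSq r x y ^ 2 + (n + 2) * (1 - 6 * α) * cosSq r x y
      + (3 * α - 1) = 0
  sum_eq : ∀ g : E n → ℝ, IsPoly 7 g → ∑ y ∈ L, g y = L.card * sphereMean r g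

/-- The parameter of a layer of a design on two spheres. -/
def layerParam (X : Finset (E n)) (w : E n → ℝ) (r₁ r₂ : ℝ) : ℝ :=
  layerWeight X w r₁ * r₁ ^ 8 / momentEight X w r₁ r₂ * (n + 6) / 12

namespace TwoSphereDesign

variable {X : Finset (E n)} {w : E n → ℝ} {r₁ r₂ : ℝ}

lemma layerParam_pos (h : TwoSphereDesign X w r₁ r₂) : 0 < layerParam X w r₁ r₂ := by
  have := h.pos₁
  have := h.weight₁_pos
  have := h.momentEight_pos
  unfold layerParam
  positivity

lemma layerParam_add (h : TwoSphereDesign X w r₁ r₂) :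
    layerParam X w r₁ r₂ + layerParam X w r₂ r₁ = (n + 6) / 12 := by
  have h1 := h.momentEight_pos.ne'
  unfold layerParam
  rw [momentEight_comm X w r₂ r₁]
  have h2 : layerWeight X w r₁ * r₁ ^ 8 / momentEight X w r₁ r₂ +
      layerWeight X w r₂ * r₂ ^ 8 / momentEight X w r₁ r₂ = 1 := by
    rw [← add_div, div_eq_one_iff_eq h1, momentEight]
  linear_combination ((n : ℝ) + 6) / 12 * h2

/-- In 2 w(x) K(x,x) = 1 the kernel value depends only on the norm of `x`, so the weight is constant
on the layer. The normalization of `layerParam` absorbs the dimension of the harmonics of degree 4.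
-/
lemma layerWeight_eq (h : TwoSphereDesign X w r₁ r₂)
    (hcard : X.card = 2 * Module.finrank ℝ (polySpaceStar 4 (sphereUnion X))) {x : E n}
    (hx : x ∈ layer X r₁) :
    layerWeight X w r₁ = w x * (n * (n + 1) * (1 + layerParam X w r₁ r₂ * (n - 1))) := by
  obtain ⟨hxX, hxr⟩ := Finset.mem_filter.1 hx
  have h1 := h.reproKernel_self hcard hxX
  rw [reproKernel, if_pos rfl, zonalTwo, zonalFour, hxr, real_inner_self_eq_norm_sq, hxr] at h1
  have hr := h.pos₁
  have hW := h.weight₁_pos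
  have hM := h.momentEight_pos
  unfold layerParam
  field_simp at h1 ⊢
  linear_combination -h1 / 2

lemma tightLayer (h : TwoSphereDesign X w r₁ r₂)
    (hcard : X.card = 2 * Module.finrank ℝ (polySpaceStar 4 (sphereUnion X))) :
    TightLayer (layer X r₁) r₁ (layerParam X w r₁ r₂) := by
  have hn : (2 : ℝ) ≤ n := by exact_mod_cast h.two_le
  have hα := h.layerParam_pos
  have hr := h.pos₁
  have hW := h.weight₁_pos
  have hM := h.momentEight_pos
  have hc : (0 : ℝ) < n * (n + 1) * (1 + layerParam X w r₁ r₂ * (n - 1)) := by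
    have : (0 : ℝ) < n - 1 := by linarith
    positivity
  have hw : ∀ x ∈ layer X r₁, w x =
      layerWeight X w r₁ / (n * (n + 1) * (1 + layerParam X w r₁ r₂ * (n - 1))) := fun x hx => by
    rw [eq_div_iff hc.ne', ← h.layerWeight_eq hcard hx]
  have hcard' : ((layer X r₁).card : ℝ) = n * (n + 1) * (1 + layerParam X w r₁ r₂ * (n - 1)) := by
    have h1 : layerWeight X w r₁ = ∑ x ∈ layer X r₁, w x := rfl
    rw [Finset.sum_congr rfl hw, Finset.sum_const, nsmul_eq_mul] at h1
    rw [← mul_div_assoc, eq_div_iff hc.ne'] at h1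
    exact mul_left_cancel₀ hW.ne' (by linear_combination -h1)
  refine ⟨h.two_le, hr, hα, fun x hx => (Finset.mem_filter.1 hx).2, fun x hx => ?_, hcard', ?_, ?_⟩
  · obtain ⟨hxX, hxr⟩ := Finset.mem_filter.1 hx
    exact Finset.mem_filter.2 ⟨h.neg_mem hcard hxX, by rw [norm_neg, hxr]⟩
  · intro x hx y hy hyx hyx'
    obtain ⟨hxX, hxr⟩ := Finset.mem_filter.1 hx
    obtain ⟨hyX, hyr⟩ := Finset.mem_filter.1 hy
    have h1 := h.reproKernel_eq_zero hcard hxX hyX hyx hyx'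
    rw [reproKernel, if_pos (by rw [hxr, hyr]), zonalTwo, zonalFour, hxr, hyr,
      real_inner_comm] at h1
    have h2 : inner ℝ x y ^ 2 = cosSq r₁ x y * r₁ ^ 4 := by
      unfold cosSq; field_simp
    have h3 : inner ℝ x y ^ 4 = cosSq r₁ x y ^ 2 * r₁ ^ 8 := by
      rw [show (4 : ℕ) = 2 * 2 from rfl, pow_mul, h2]; ring
    rw [h2, h3] at h1
    unfold layerParam
    have hn0 : (n : ℝ) ≠ 0 := by linarith
    field_simp at h1 ⊢
    apply mul_left_cancel₀ hn0
    linear_combination h1 / 2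
  · intro g hg
    have h1 := h.layer_sum_eq hg
    rw [Finset.sum_congr rfl (fun x hx => by rw [hw x hx]), ← Finset.mul_sum, ← hcard'] at h1
    have hL : ((layer X r₁).card : ℝ) ≠ 0 := by rw [hcard']; exact hc.ne'
    field_simp at h1
    linear_combination h1

end TwoSphereDesign

/-! ### Eigenvalues of integer matrices -/

lemma isIntegral_of_eigenvector {ι : Type*} [Fintype ι] (A : Matrix ι ι ℤ) {h : ι → ℝ} {c : ℝ}
    (h0 : h ≠ 0) (hA : ∀ i, ∑ j, (A i j : ℝ) * h j = c * h i) : IsIntegral ℤ c := by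
  refine ⟨A.charpoly, A.charpoly_monic, ?_⟩
  have h1 : Polynomial.eval c (A.map (Int.castRingHom ℝ)).charpoly = 0 := by
    rw [Matrix.eval_charpoly]
    apply Matrix.exists_mulVec_eq_zero_iff.1
    refine ⟨h, h0, ?_⟩
    ext i
    have := hA i
    rw [Matrix.sub_mulVec, Pi.sub_apply]
    simp only [Matrix.mulVec, dotProduct, Matrix.scalar_apply, Matrix.map_apply, eq_intCast, this]
    simp [Matrix.diagonal_apply]
  rw [Matrix.charpoly_map, Polynomial.eval_map] at h1
  exact h1

lemma exists_int_of_isIntegral {c : ℝ} (hc : IsIntegral ℤ c) {q : ℚ} (hq : c = q) :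
    ∃ m : ℤ, c = m := by
  have h1 : IsIntegral ℤ q := by
    rw [hq] at hc
    exact (isIntegral_algebraMap_iff (algebraMap ℚ ℝ).injective).1 hc
  obtain ⟨m, hm⟩ := IsIntegrallyClosed.isIntegral_iff.1 h1
  refine ⟨m, ?_⟩
  rw [hq, ← hm]
  simp

/-! ### Moments of a layer and its integrality conditions -/

namespace TightLayer

variable {L : Finset (E n)} {r α : ℝ}

lemma two_le_cast (h : TightLayer L r α) : (2 : ℝ) ≤ n := by exact_mod_cast h.two_le

lemma lt_card (h : TightLayer L r α) : (n : ℝ) * (n + 1) < L.card := by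
  have h1 := h.two_le_cast
  have h2 : 0 < α * (n - 1) := mul_pos h.α_pos (by linarith)
  rw [h.card_eq]
  have : (0 : ℝ) < n * (n + 1) := by positivity
  nlinarith

lemma card_pos (h : TightLayer L r α) : (0 : ℝ) < L.card := by
  have := h.lt_card
  have : (0 : ℝ) ≤ n * (n + 1) := by positivity
  linarith

lemma nonempty (h : TightLayer L r α) : L.Nonempty := by
  rw [← Finset.card_pos]
  exact_mod_cast h.card_pos

lemma ne_neg (h : TightLayer L r α) {x : E n} (hx : x ∈ L) : x ≠ -x := fun h0 => by
  have h1 : (2 : ℝ) • x = 0 := by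
    rw [two_smul]
    nth_rewrite 2 [h0]
    exact add_neg_cancel x
  have h2 := h.norm_eq x hx
  rw [(smul_eq_zero.1 h1).resolve_left two_ne_zero, norm_zero] at h2
  exact h.pos.ne h2

lemma cosSq_self (h : TightLayer L r α) {x : E n} (hx : x ∈ L) : cosSq r x x = 1 := by
  have := h.pos
  rw [cosSq, real_inner_self_eq_norm_sq, h.norm_eq x hx]
  field_simp

lemma cosSq_neg (r : ℝ) (x y : E n) : cosSq r x (-y) = cosSq r x y := by
  rw [cosSq, cosSq, inner_neg_right, neg_sq]

lemma cosSq_nonneg (r : ℝ) (x y : E n) : 0 ≤ cosSq r x y := by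
  unfold cosSq; positivity

/-- A sum over the layer splits into the contributions of `x`, `-x` and the rest. -/
lemma sum_split (h : TightLayer L r α) {x : E n} (hx : x ∈ L) (F : E n → ℝ) :
    ∑ y ∈ L, F y = F x + F (-x) + ∑ y ∈ L.filter (fun y => y ≠ x ∧ y ≠ -x), F y := by
  rw [← Finset.sum_filter_add_sum_filter_not L (fun y => y ≠ x ∧ y ≠ -x), add_comm]
  congr 1
  rw [← Finset.sum_pair (h.ne_neg hx)]
  refine Finset.sum_congr ?_ fun _ _ => rfl
  ext y
  simp only [Finset.mem_filter, Finset.mem_insert, Finset.mem_singleton]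
  constructor
  · rintro ⟨-, hy⟩
    tauto
  · rintro (rfl | rfl)
    · exact ⟨hx, by simp⟩
    · exact ⟨h.neg_mem x hx, by simp⟩

lemma sum_inner_sq (h : TightLayer L r α) (v : E n) :
    ∑ y ∈ L, inner ℝ v y ^ 2 = L.card * (r ^ 2 * ‖v‖ ^ 2 / n) := by
  rw [h.sum_eq _ ((IsPoly.inner_pow v 2).mono (by norm_num)), sphereMean_scale]
  simp_rw [real_inner_smul_right, mul_pow]
  rw [sphereMean_const_mul, sphereMean_inner_pow_eq h.two_le, coordMoment_two]
  ring

lemma sum_inner_pow_four (h : TightLayer L r α) (v : E n) :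
    ∑ y ∈ L, inner ℝ v y ^ 4 = L.card * (r ^ 4 * ‖v‖ ^ 4 * (3 / (n * (n + 2)))) := by
  rw [h.sum_eq _ ((IsPoly.inner_pow v 4).mono (by norm_num)), sphereMean_scale]
  simp_rw [real_inner_smul_right, mul_pow]
  rw [sphereMean_const_mul, sphereMean_inner_pow_eq h.two_le, coordMoment_four]
  ring

lemma sum_cosSq (h : TightLayer L r α) {x : E n} (hx : x ∈ L) :
    ∑ y ∈ L, cosSq r x y = L.card / n := by
  have hr := h.pos
  simp only [cosSq]
  rw [← Finset.sum_div, h.sum_inner_sq, h.norm_eq x hx]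
  field_simp

lemma sum_cosSq_sq (h : TightLayer L r α) {x : E n} (hx : x ∈ L) :
    ∑ y ∈ L, cosSq r x y ^ 2 = L.card * 3 / (n * (n + 2)) := by
  have hr := h.pos
  have : ∀ y, cosSq r x y ^ 2 = inner ℝ x y ^ 4 / r ^ 8 := fun y => by rw [cosSq]; ring
  simp only [this]
  rw [← Finset.sum_div, h.sum_inner_pow_four, h.norm_eq x hx]
  field_simp

/-- The rest of a layer, without `x` and `-x`. -/
lemma card_rest (h : TightLayer L r α) {x : E n} (hx : x ∈ L) :
    ((L.filter (fun y => y ≠ x ∧ y ≠ -x)).card : ℝ) = L.card - 2 := by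
  have := h.sum_split hx (fun _ => 1)
  simp only [Finset.sum_const, nsmul_eq_mul, mul_one] at this
  linarith

lemma sum_cosSq_rest (h : TightLayer L r α) {x : E n} (hx : x ∈ L) :
    ∑ y ∈ L.filter (fun y => y ≠ x ∧ y ≠ -x), cosSq r x y = L.card / n - 2 := by
  have := h.sum_split hx (fun y => cosSq r x y)
  rw [cosSq_neg, h.cosSq_self hx, h.sum_cosSq hx] at this
  linarith

lemma sum_cosSq_sq_rest (h : TightLayer L r α) {x : E n} (hx : x ∈ L) :
    ∑ y ∈ L.filter (fun y => y ≠ x ∧ y ≠ -x), cosSq r x y ^ 2 =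
      L.card * 3 / (n * (n + 2)) - 2 := by
  have := h.sum_split hx (fun y => cosSq r x y ^ 2)
  rw [cosSq_neg, h.cosSq_self hx, h.sum_cosSq_sq hx] at this
  linarith

/-- The layer is too large to be equiangular. -/
lemma third_le (h : TightLayer L r α) : 1 / 3 ≤ α := by
  by_contra! hα
  obtain ⟨x, hx⟩ := h.nonempty
  have hn := h.two_le_cast
  have hα0 := h.α_pos
  set R := L.filter (fun y => y ≠ x ∧ y ≠ -x) with hR
  have hquad : ∀ y ∈ R, α * (n + 4) * (n + 2) * cosSq r x y ^ 2
      + (n + 2) * (1 - 6 * α) * cosSq r x y + (3 * α - 1) = 0 := fun y hy => by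
    obtain ⟨hyL, hyx, hyx'⟩ := Finset.mem_filter.1 hy
    exact h.quad x hx y hyL hyx hyx'
  have heq : ∀ y ∈ R, ∀ y' ∈ R, cosSq r x y = cosSq r x y' := by
    intro y hy y' hy'
    by_contra hne
    have h1 := hquad y hy
    have h2 := hquad y' hy'
    -- Two distinct roots have product (3α − 1)/(α(n+4)(n+2)), negative when α < 1/3, yet squared
    -- cosines are nonnegative. So only one value occurs.
    have h3 : (cosSq r x y - cosSq r x y') * (α * (n + 4) * (n + 2) * cosSq r x y * cosSq r x y'
        + (1 - 3 * α)) = 0 := by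
      linear_combination -cosSq r x y * h2 + cosSq r x y' * h1
    have h4 := (mul_eq_zero.1 h3).resolve_left (sub_ne_zero.2 hne)
    have h5 := cosSq_nonneg r x y
    have h6 := cosSq_nonneg r x y'
    have h7 : 0 ≤ α * (n + 4) * (n + 2) * cosSq r x y * cosSq r x y' := by positivity
    linarith
  have hcr := h.card_rest hx
  have hlt := h.lt_card
  have hRne : R.Nonempty := by
    rw [← Finset.card_pos]
    have : (0 : ℝ) < R.card := by rw [hcr]; nlinarith
    exact_mod_cast this
  obtain ⟨y₀, hy₀⟩ := hRne
  have s1 := h.sum_cosSq_rest hx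
  have s2 := h.sum_cosSq_sq_rest hx
  rw [← hR, Finset.sum_congr rfl (fun y hy => heq y hy y₀ hy₀), Finset.sum_const, nsmul_eq_mul,
    hcr] at s1
  rw [← hR, Finset.sum_congr rfl (fun y hy => by rw [heq y hy y₀ hy₀]), Finset.sum_const,
    nsmul_eq_mul, hcr] at s2
  -- For a single value c the sums of c and c² satisfy Cauchy–Schwarz with equality. This forces the
  -- cardinality n(n+1), contradicting `lt_card`.
  have h8 : ((L.card : ℝ) / n - 2) ^ 2 = (L.card - 2) * (L.card * 3 / (n * (n + 2)) - 2) := by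
    rw [← s1, ← s2]; ring
  have hn0 : (n : ℝ) ≠ 0 := by linarith
  field_simp at h8
  have h9 : (L.card : ℝ) * ((n - 1) * 2) * (L.card - n * (n + 1)) = 0 := by
    linear_combination -h8
  have h10 := h.card_pos
  have h11 : (0 : ℝ) < (L.card : ℝ) * ((n - 1) * 2) * (L.card - n * (n + 1)) := by
    have : (0 : ℝ) < n - 1 := by linarith
    have : (0 : ℝ) < L.card - n * (n + 1) := by linarith
    positivity
  linarith

lemma param_rational (h : TightLayer L r α) : ∃ q : ℚ, α = q := by
  refine ⟨((L.card : ℚ) / (n * (n + 1)) - 1) / (n - 1), ?_⟩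
  have hn := h.two_le_cast
  have : (n : ℝ) - 1 ≠ 0 := by linarith
  push_cast
  rw [h.card_eq]
  field_simp
  ring

/-- An eigenvector of the distance matrices of the layer. -/
def layerVector (L : Finset (E n)) (r : ℝ) (x y : E n) : ℝ :=
  (if y = x ∨ y = -x then 1 else 0) - 2 / L.card * (1 + zonalTwo x y / r ^ 4)

lemma layerVector_neg (L : Finset (E n)) (r : ℝ) (x y : E n) :
    layerVector L r x (-y) = layerVector L r x y := by
  unfold layerVector
  have h1 : (-y = x ∨ -y = -x) ↔ (y = x ∨ y = -x) := by
    rw [neg_inj, neg_eq_iff_eq_neg, or_comm]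
  simp only [h1, zonalTwo, inner_neg_right, neg_sq, norm_neg]

lemma layerVector_self (h : TightLayer L r α) {x : E n} (hx : x ∈ L) :
    layerVector L r x x ≠ 0 := by
  have h1 := h.lt_card
  have h2 := h.card_pos
  have h3 := h.pos
  have h4 : layerVector L r x x = (L.card - n * (n + 1)) / L.card := by
    rw [layerVector, if_pos (Or.inl rfl), zonalTwo, real_inner_self_eq_norm_sq, h.norm_eq x hx]
    field_simp
    ring
  rw [h4]
  have : (0 : ℝ) < L.card - n * (n + 1) := by linarith
  positivity

/-- The vector is the indicator of {x, -x} minus its projection to the even functions of degree at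
most 2. For `m = 0` and `m = 2` the right side vanishes, which is the orthogonality needed for the
eigenvector equation. -/
lemma sum_layerVector_mul (h : TightLayer L r α) {x : E n} (hx : x ∈ L) (v : E n) (m : ℕ)
    (hm : m ≤ 5) :
    ∑ y ∈ L, layerVector L r x y * inner ℝ v y ^ m =
      inner ℝ v x ^ m + inner ℝ v (-x) ^ m -
        2 * sphereMean r (fun y => (1 + zonalTwo x y / r ^ 4) * inner ℝ v y ^ m) := by
  have h1 := h.sum_eq _ (((isPoly_zonalTwo x (r ^ 4)).mul (IsPoly.inner_pow v m)).mono
    (show 2 + m ≤ 7 by omega))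
  have h2 := h.card_pos
  have h3 := h.sum_split hx (fun y => (if y = x ∨ y = -x then 1 else 0) * inner ℝ v y ^ m)
  rw [Finset.sum_eq_zero (s := L.filter _) (fun y hy => by
    have := (Finset.mem_filter.1 hy).2
    rw [if_neg (by tauto), zero_mul])] at h3
  simp only [true_or, or_true, if_true, one_mul, add_zero] at h3
  simp only [layerVector, sub_mul, Finset.sum_sub_distrib, mul_assoc]
  rw [h3, ← Finset.mul_sum, h1]
  field_simp

lemma sum_layerVector (h : TightLayer L r α) {x : E n} (hx : x ∈ L) :
    ∑ y ∈ L, layerVector L r x y = 0 := by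
  have := h.sum_layerVector_mul hx x 0 (by norm_num)
  rw [sphereMean_zonalTwo_zero h.two_le _ _ h.pos (h.norm_eq x hx)] at this
  simp only [pow_zero, mul_one] at this
  linarith

lemma sum_layerVector_cosSq (h : TightLayer L r α) {x : E n} (hx : x ∈ L) (v : E n) :
    ∑ y ∈ L, cosSq r v y * layerVector L r x y = 0 := by
  have := h.sum_layerVector_mul hx v 2 (by norm_num)
  rw [sphereMean_zonalTwo_two h.two_le _ _ h.pos (h.norm_eq x hx), inner_neg_right,
    real_inner_comm v x] at this
  have h1 : ∑ y ∈ L, cosSq r v y * layerVector L r x y =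
      (∑ y ∈ L, layerVector L r x y * inner ℝ v y ^ 2) / r ^ 4 := by
    rw [Finset.sum_div]
    exact Finset.sum_congr rfl fun y _ => by rw [cosSq]; ring
  rw [h1, this]
  ring

/-- The normalized difference of the two roots is an integer fraction. -/
theorem exists_int (h : TightLayer L r α) (hn7 : 7 ≤ n) :
    ∃ M : ℤ, 0 < M ∧ (M : ℝ) ^ 2 * (24 * ((n : ℝ) + 1) * α ^ 2 - 8 * ((n : ℝ) + 1) * α + n + 2) =
      ((n : ℝ) + 2) * (1 + 2 * ((n : ℝ) + 1) * α) ^ 2 := by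
  have hn : (7 : ℝ) ≤ n := by exact_mod_cast hn7
  have hα := h.third_le
  have hα0 := h.α_pos
  have hD := quad_pos (by linarith : (0 : ℝ) < n) hα
  set D := 24 * ((n : ℝ) + 1) * α ^ 2 - 8 * ((n : ℝ) + 1) * α + n + 2 with hDdef
  set d := Real.sqrt ((n + 2) * D) with hd
  have hd2 : d ^ 2 = (n + 2) * D := Real.sq_sqrt (by positivity)
  have hd0 : 0 < d := Real.sqrt_pos.2 (by positivity)
  set p := α * (n + 4) * (n + 2) with hp
  have hp0 : 0 < p := by positivity
  -- This is the derivative of the quadratic at the squared cosine, so its square at a root is the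
  -- discriminant `d ^ 2`.
  let t : E n → E n → ℝ := fun x y => 2 * p * cosSq r x y + (n + 2) * (1 - 6 * α)
  have ht : ∀ x ∈ L, ∀ y ∈ L, y ≠ x → y ≠ -x → t x y = d ∨ t x y = -d := by
    intro x hx y hy hyx hyx'
    have h1 := h.quad x hx y hy hyx hyx'
    rw [← sq_eq_sq_iff_eq_or_eq_neg, hd2, hDdef]
    simp only [t]
    rw [← hp] at h1
    linear_combination 4 * p * h1 + 4 * (3 * α - 1) * hp
  obtain ⟨q, hq⟩ := h.param_rational
  -- the root of the discriminant is rational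
  obtain ⟨x, hx⟩ := h.nonempty
  obtain ⟨qd, hqd⟩ : ∃ qd : ℚ, d = qd := by
    set R := L.filter (fun y => y ≠ x ∧ y ≠ -x) with hR
    have hsum : ∑ y ∈ R, t x y = 2 * p * (L.card / n - 2)
        + (n + 2) * (1 - 6 * α) * (L.card - 2) := by
      simp only [t]
      rw [Finset.sum_add_distrib, ← Finset.mul_sum, h.sum_cosSq_rest hx, Finset.sum_const,
        nsmul_eq_mul, h.card_rest hx]
      ring
    -- The sum is rational by the moment identities and an integer multiple of `d` by its signs, so
    -- `d` is rational once the sum is nonzero.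
    have hsum' : ∑ y ∈ R, t x y = d * ((∑ y ∈ R, (if t x y = d then 1 else -1 : ℤ) : ℤ) : ℝ) := by
      push_cast
      rw [Finset.mul_sum]
      refine Finset.sum_congr rfl fun y hy => ?_
      obtain ⟨hyL, hyx, hyx'⟩ := Finset.mem_filter.1 hy
      rcases ht x hx y hyL hyx hyx' with h1 | h1
      · simp [h1]
      · rw [if_neg (by rw [h1]; linarith), h1]
        ring
    have hne : ∑ y ∈ R, t x y ≠ 0 := by
      rw [hsum, h.card_eq, hp]
      have e1 : 2 * (α * (n + 4) * (n + 2)) * ((n : ℝ) * (n + 1) * (1 + α * (n - 1)) / n - 2)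
          + (n + 2) * (1 - 6 * α) * ((n : ℝ) * (n + 1) * (1 + α * (n - 1)) - 2) =
          -((n + 2) * (n - 1) * (4 * (n + 1) * (n - 2) * α ^ 2 - (n - 4) * (n + 1) * α
            - (n + 2))) := by
        field_simp
        ring
      rw [e1]
      have e2 : 0 < 4 * ((n : ℝ) + 1) * (n - 2) * α ^ 2 - (n - 4) * (n + 1) * α - (n + 2) := by
        have f1 : 0 ≤ α - 1 / 3 := by linarith
        have f2 : 0 ≤ ((n : ℝ) - 7) := by linarith
        -- Expansion around α = 1/3. The constant term (n² − 4n − 14)/9 is positive from n = 7 on.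
        have f3 : 4 * ((n : ℝ) + 1) * (n - 2) * α ^ 2 - (n - 4) * (n + 1) * α - (n + 2)
            = ((n : ℝ) - 7) * ((n : ℝ) + 3) / 9 + 7 / 9 + (α - 1 / 3) * (n + 1) *
              (8 / 3 * (n - 2) - (n - 4)) + 4 * (n + 1) * (n - 2) * (α - 1 / 3) ^ 2 := by ring
        rw [f3]
        have f4 : (0 : ℝ) ≤ n - 2 := by linarith
        have f5 : (0 : ℝ) ≤ 8 / 3 * ((n : ℝ) - 2) - (n - 4) := by linarith
        positivity
      have e3 : (0 : ℝ) < n - 1 := by linarith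
      have e4 : 0 < ((n : ℝ) + 2) * (n - 1) * (4 * (n + 1) * (n - 2) * α ^ 2
        - (n - 4) * (n + 1) * α - (n + 2)) := by positivity
      linarith
    set m : ℤ := ∑ y ∈ R, (if t x y = d then 1 else -1 : ℤ) with hm
    have hm0 : (m : ℝ) ≠ 0 := by
      intro h0
      rw [hsum', h0, mul_zero] at hne
      exact hne rfl
    refine ⟨(2 * (q * (n + 4) * (n + 2)) * (L.card / n - 2)
        + (n + 2) * (1 - 6 * q) * (L.card - 2)) / m, ?_⟩
    push_cast
    rw [← hq, eq_div_iff hm0, ← hsum', hsum, hp]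
  -- the integer matrix of one of the two relations
  let A : Matrix L L ℤ := fun a b =>
    if (b : E n) ≠ a ∧ (b : E n) ≠ -a ∧ t a b = d then 1 else 0
  -- Away from `±a` the function `t a` equals d(2A − 1). Since the vector is orthogonal to constants
  -- and to `t a`, only the values at `±a` remain, and the even vector is an eigenvector of `A`.
  have hvec : ∀ a : L, ∑ b : L, (A a b : ℝ) * layerVector L r x b =
      -((n + 2) * (1 + 2 * (n + 1) * α) / d + 1) * layerVector L r x a := by
    intro a
    have ha := a.2
    have e1 := h.sum_layerVector hx
    have e2 := h.sum_layerVector_cosSq hx (a : E n)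
    let B : E n → ℝ := fun b => if b ≠ a ∧ b ≠ -a ∧ t a b = d then 1 else 0
    have e3 : ∑ b : L, (A a b : ℝ) * layerVector L r x b = ∑ b ∈ L, B b * layerVector L r x b := by
      rw [← Finset.sum_coe_sort L]
      refine Finset.sum_congr rfl fun b _ => ?_
      simp only [A, B]
      push_cast
      rfl
    have e4 := h.sum_split ha (fun y => t a y * layerVector L r x y)
    have e5 := h.sum_split ha (fun y => B y * layerVector L r x y)
    have e6 := h.sum_split ha (fun y => layerVector L r x y)
    have e7 : ∑ y ∈ L, t a y * layerVector L r x y = 0 := by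
      have : ∀ y, t a y * layerVector L r x y = 2 * p * (cosSq r a y * layerVector L r x y)
          + (n + 2) * (1 - 6 * α) * layerVector L r x y := fun y => by simp only [t]; ring
      simp_rw [this]
      rw [Finset.sum_add_distrib, ← Finset.mul_sum, ← Finset.mul_sum, e2, e1]
      ring
    have e8 : ∀ y ∈ L.filter (fun y => y ≠ (a : E n) ∧ y ≠ -(a : E n)),
        t a y * layerVector L r x y = 2 * d * (B y * layerVector L r x y)
          - d * layerVector L r x y := by
      intro y hy
      obtain ⟨hyL, hyx, hyx'⟩ := Finset.mem_filter.1 hy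
      simp only [B]
      rcases ht a ha y hyL hyx hyx' with h1 | h1
      · rw [if_pos ⟨hyx, hyx', h1⟩, h1]; ring
      · rw [if_neg (fun hh => by rw [h1] at hh; linarith [hh.2.2]), h1]; ring
    rw [Finset.sum_congr rfl e8, Finset.sum_sub_distrib, ← Finset.mul_sum, ← Finset.mul_sum, e7] at e4
    have b1 : B a = 0 := by simp [B]
    have b2 : B (-a) = 0 := by simp [B]
    have t1 : t a (a : E n) = (n + 2) * (1 + 2 * (n + 1) * α) := by
      simp only [t]
      rw [h.cosSq_self ha, hp]; ring
    have t2 : t a (-(a : E n)) = (n + 2) * (1 + 2 * (n + 1) * α) := by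
      rw [← t1]; simp only [t, cosSq_neg]
    simp only [b1, b2, zero_mul, zero_add, layerVector_neg, t1, t2] at e4 e5 e6
    rw [e1] at e6
    rw [e3, e5]
    rw [← mul_right_inj' hd0.ne']
    have e9 : d * (-((n + 2) * (1 + 2 * (n + 1) * α) / d + 1) * layerVector L r x a) =
        -((n + 2) * (1 + 2 * (n + 1) * α) + d) * layerVector L r x a := by
      field_simp
    rw [e9]
    linear_combination -e4 / 2 - d / 2 * e6
  have hAint := isIntegral_of_eigenvector A (h := fun b : L => layerVector L r x b)
    (fun h0 => h.layerVector_self hx (congrFun h0 ⟨x, hx⟩)) hvec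
  obtain ⟨m, hm⟩ := exists_int_of_isIntegral hAint
    (q := -(((n : ℚ) + 2) * (1 + 2 * (n + 1) * q) / qd + 1)) (by push_cast; rw [← hq, ← hqd])
  have hM : (((-m - 1 : ℤ) : ℝ)) = (n + 2) * (1 + 2 * (n + 1) * α) / d := by
    push_cast
    linarith
  refine ⟨-m - 1, ?_, ?_⟩
  · have : (0 : ℝ) < ((-m - 1 : ℤ) : ℝ) := by rw [hM]; positivity
    exact_mod_cast this
  · rw [hM, div_pow, hd2]
    field_simp

/-- The inner products between two layers force a quadratic Diophantine condition. -/
lemma exists_six_mul_sq (h : TightLayer L r α) (hn3 : 3 ≤ n) {x : E n} (hx : x ≠ 0)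
    (hz : ∀ y ∈ L, zonalFour x y = 0) : ∃ K : ℕ, 6 * K ^ 2 = (n + 1) * (n + 2) := by
  have hn : (3 : ℝ) ≤ n := by exact_mod_cast hn3
  have hr := h.pos
  have hxn : 0 < ‖x‖ := norm_pos_iff.2 hx
  -- Half the derivative of the quadratic for the squared cosine. Its values are ±d, and the second
  -- moment gives a rational sum, nonzero exactly because n ≠ 2.
  let t : E n → ℝ := fun y =>
    (n + 4) * (n + 2) * (inner ℝ x y ^ 2 / (‖x‖ ^ 2 * r ^ 2)) - 3 * (n + 2)
  set s : ℝ := 6 * (n + 1) * (n + 2) with hs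
  have hs0 : 0 < s := by positivity
  set d := Real.sqrt s with hd
  have hd2 : d ^ 2 = s := Real.sq_sqrt hs0.le
  have hd0 : 0 < d := Real.sqrt_pos.2 hs0
  have ht : ∀ y ∈ L, t y = d ∨ t y = -d := by
    intro y hy
    rw [← sq_eq_sq_iff_eq_or_eq_neg, hd2, hs]
    have h1 := hz y hy
    rw [zonalFour, h.norm_eq y hy] at h1
    have h2 := (mul_eq_zero.1 h1).resolve_left (by positivity)
    simp only [t]
    have h3 : ((n : ℝ) + 4) * (n + 2) * (inner ℝ x y ^ 2 / (‖x‖ ^ 2 * r ^ 2)) ^ 2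
        - 6 * (n + 2) * (inner ℝ x y ^ 2 / (‖x‖ ^ 2 * r ^ 2)) + 3 = 0 := by
      field_simp
      linear_combination h2
    linear_combination ((n : ℝ) + 4) * (n + 2) * h3
  have hsum : ∑ y ∈ L, t y = L.card * ((n + 2) * (4 - 2 * n) / n) := by
    simp only [t]
    rw [Finset.sum_sub_distrib, ← Finset.mul_sum, ← Finset.sum_div, h.sum_inner_sq,
      Finset.sum_const, nsmul_eq_mul]
    field_simp
    ring
  have hsum' : ∑ y ∈ L, t y = d * ((∑ y ∈ L, (if t y = d then 1 else -1 : ℤ) : ℤ) : ℝ) := by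
    push_cast
    rw [Finset.mul_sum]
    refine Finset.sum_congr rfl fun y hy => ?_
    rcases ht y hy with h1 | h1
    · simp [h1]
    · rw [if_neg (by rw [h1]; linarith), h1]
      ring
  set m : ℤ := ∑ y ∈ L, (if t y = d then 1 else -1 : ℤ)
  have hm : (m : ℝ) ≠ 0 := by
    intro h0
    rw [hsum', h0, mul_zero] at hsum
    have h1 : (L.card : ℝ) * ((n + 2) * (2 * n - 4) / n) > 0 := by
      have := h.card_pos
      have : (0 : ℝ) < 2 * n - 4 := by linarith
      positivity
    have h2 : (L.card : ℝ) * ((n + 2) * (4 - 2 * n) / n) =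
      -((L.card : ℝ) * ((n + 2) * (2 * n - 4) / n)) := by ring
    linarith
  have hsq : IsSquare (((6 * (n + 1) * (n + 2) : ℕ) : ℚ)) := by
    refine ⟨(L.card : ℚ) * ((n + 2) * (4 - 2 * n) / n) / m, ?_⟩
    have : d = (L.card : ℝ) * ((n + 2) * (4 - 2 * n) / n) / m := by
      rw [eq_div_iff hm, ← hsum', hsum]
    have h2 : s = (L.card : ℝ) * ((n + 2) * (4 - 2 * n) / n) / m *
        ((L.card : ℝ) * ((n + 2) * (4 - 2 * n) / n) / m) := by
      rw [← this, ← hd2]; ring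
    rw [hs] at h2
    exact_mod_cast h2
  rw [Rat.isSquare_natCast_iff] at hsq
  obtain ⟨k, hk⟩ := hsq
  have h6 : 6 ∣ k := by
    have h2 : 2 ∣ k := Nat.prime_two.dvd_of_dvd_pow (n := 2) ⟨3 * (n + 1) * (n + 2), by
      rw [sq, ← hk]; ring⟩
    have h3 : 3 ∣ k := Nat.prime_three.dvd_of_dvd_pow (n := 2) ⟨2 * (n + 1) * (n + 2), by
      rw [sq, ← hk]; ring⟩
    omega
  obtain ⟨K, rfl⟩ := h6
  exact ⟨K, by nlinarith⟩

end TightLayer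

/-! ### Exclusion of dimensions above two -/

namespace TwoSphereDesign

variable {X : Finset (E n)} {w : E n → ℝ} {r₁ r₂ : ℝ}

/-- Tight designs on two spheres exist only in the plane. -/
theorem eq_two (h : TwoSphereDesign X w r₁ r₂)
    (hcard : X.card = 2 * Module.finrank ℝ (polySpaceStar 4 (sphereUnion X))) : n = 2 := by
  by_contra hne
  have hn3 : 3 ≤ n := by have := h.two_le; omega
  have T₁ := h.tightLayer hcard
  have T₂ := h.symm.tightLayer hcard
  obtain ⟨x, hx⟩ := T₁.nonempty
  obtain ⟨hxX, hxr⟩ := Finset.mem_filter.1 hx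
  obtain ⟨K, hK⟩ := T₂.exists_six_mul_sq hn3 (h.ne_zero hxX) (fun y hy => by
    obtain ⟨hyX, hyr⟩ := Finset.mem_filter.1 hy
    exact h.zonalFour_eq_zero hcard hxX hyX (by rw [hxr, hyr]; exact h.ne))
  have hn7 : 7 ≤ n := by
    rcases eq_or_large hn3 hK with h' | h' <;> omega
  obtain ⟨M₁, hM₁, e₁⟩ := T₁.exists_int hn7
  obtain ⟨M₂, hM₂, e₂⟩ := T₂.exists_int hn7
  exact no_solution hn3 hK hM₁ hM₂ T₁.third_le T₂.third_le h.layerParam_add e₁ e₂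

end TwoSphereDesign

end EuclideanDesign

end

noncomputable section

open MeasureTheory
open scoped Classical

namespace EuclideanDesign

/-! ### Octagons -/

/-- The point of the plane with polar coordinates `(r, θ)`. -/
def polar (r θ : ℝ) : E 2 := !₂[r * Real.cos θ, r * Real.sin θ]

lemma inner_polar (r s θ η : ℝ) :
    inner ℝ (polar r θ) (polar s η) = r * s * Real.cos (θ - η) := by
  simp only [polar, PiLp.inner_apply, Fin.sum_univ_two, Real.cos_sub]
  simp
  ring

lemma norm_polar {r : ℝ} (hr : 0 ≤ r) (θ : ℝ) : ‖polar r θ‖ = r := by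
  have h := real_inner_self_eq_norm_sq (polar r θ)
  rw [inner_polar, sub_self, Real.cos_zero, mul_one, ← sq] at h
  exact ((pow_left_inj₀ hr (norm_nonneg _) two_ne_zero).1 h).symm

lemma exists_polar (x : E 2) : ∃ θ, x = polar ‖x‖ θ := by
  let z : ℂ := ⟨x 0, x 1⟩
  have hz : ‖z‖ = ‖x‖ := by
    rw [Complex.norm_eq_sqrt_sq_add_sq, EuclideanSpace.norm_eq, Fin.sum_univ_two]
    simp [z]
  refine ⟨z.arg, ?_⟩
  ext i
  fin_cases i
  · simp [polar, ← hz, Complex.norm_mul_cos_arg, z]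
  · simp [polar, ← hz, Complex.norm_mul_sin_arg, z]

lemma polar_add_int_mul_two_pi (r θ : ℝ) (k : ℤ) :
    polar r (θ + k * (2 * Real.pi)) = polar r θ := by
  rw [polar, polar, Real.cos_add_int_mul_two_pi, Real.sin_add_int_mul_two_pi]

/-- One trigonometric equation replaces the list of vertices; `cos_eight_mul` turns it into a
polynomial condition on a squared cosine. -/
lemma mem_octagon_iff {r φ : ℝ} {x : E 2} :
    x ∈ octagon r φ ↔ ∃ θ, Real.cos (8 * (θ - φ)) = 1 ∧ x = polar r θ := by
  constructor
  · intro hx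
    obtain ⟨k, -, rfl⟩ := Finset.mem_image.1 hx
    refine ⟨φ + 2 * k * Real.pi / 8, ?_, rfl⟩
    rw [show 8 * (φ + 2 * k * Real.pi / 8 - φ) = k * (2 * Real.pi) by ring]
    exact Real.cos_nat_mul_two_pi k
  · rintro ⟨θ, hθ, rfl⟩
    obtain ⟨k, hk⟩ := (Real.cos_eq_one_iff _).1 hθ
    obtain ⟨j, hj⟩ : ∃ j : ℕ, (j : ℤ) = k % 8 := ⟨(k % 8).toNat, by omega⟩
    refine Finset.mem_image.2 ⟨j, Finset.mem_range.2 (by omega), ?_⟩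
    have h1 : (k : ℝ) = 8 * ((k / 8 : ℤ) : ℝ) + j := by
      have : k = 8 * (k / 8) + j := by omega
      exact_mod_cast this
    have h2 : θ = φ + 2 * j * Real.pi / 8 + ((k / 8 : ℤ) : ℝ) * (2 * Real.pi) := by
      rw [h1] at hk
      linarith
    rw [h2, polar_add_int_mul_two_pi]
    rfl

lemma norm_of_mem_octagon {r φ : ℝ} (hr : 0 ≤ r) {x : E 2} (hx : x ∈ octagon r φ) : ‖x‖ = r := by
  obtain ⟨θ, -, rfl⟩ := mem_octagon_iff.1 hx
  exact norm_polar hr θ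

lemma octagon_injOn {r : ℝ} (hr : 0 < r) (φ : ℝ) :
    Set.InjOn (fun k : ℕ => polar r (φ + 2 * k * Real.pi / 8)) (Finset.range 8) := by
  intro j hj k hk hjk
  have h1 : inner ℝ (polar r (φ + 2 * j * Real.pi / 8)) (polar r (φ + 2 * k * Real.pi / 8)) =
      r ^ 2 := by
    simp only at hjk
    rw [hjk, real_inner_self_eq_norm_sq, norm_polar hr.le]
  rw [inner_polar] at h1
  have h2 : Real.cos (φ + 2 * j * Real.pi / 8 - (φ + 2 * k * Real.pi / 8)) = 1 := by
    have : r ^ 2 ≠ 0 := by positivity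
    apply mul_left_cancel₀ this
    linear_combination h1
  obtain ⟨m, hm⟩ := (Real.cos_eq_one_iff _).1 h2
  have h3 : ((8 * m : ℤ) : ℝ) = ((j - k : ℤ) : ℝ) := by
    push_cast
    have := Real.pi_pos
    apply mul_left_cancel₀ this.ne'
    linear_combination 4 * hm
  have h4 : 8 * m = (j : ℤ) - k := by exact_mod_cast h3
  simp only [Finset.coe_range, Set.mem_Iio] at hj hk
  omega

lemma octagon_eq_image (r φ : ℝ) :
    octagon r φ = (Finset.range 8).image fun k : ℕ => polar r (φ + 2 * k * Real.pi / 8) := rfl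

lemma card_octagon {r : ℝ} (hr : 0 < r) (φ : ℝ) : (octagon r φ).card = 8 := by
  rw [octagon_eq_image, Finset.card_image_of_injOn (octagon_injOn hr φ), Finset.card_range]

lemma sum_octagon {r : ℝ} (hr : 0 < r) (φ : ℝ) (F : E 2 → ℝ) :
    ∑ x ∈ octagon r φ, F x = ∑ k ∈ Finset.range 8, F (polar r (φ + 2 * k * Real.pi / 8)) := by
  rw [octagon_eq_image, Finset.sum_image (octagon_injOn hr φ)]

lemma cos_eight_mul (θ : ℝ) :
    Real.cos (8 * θ) = 2 * (2 * (2 * Real.cos θ ^ 2 - 1) ^ 2 - 1) ^ 2 - 1 := by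
  rw [show 8 * θ = 2 * (2 * (2 * θ)) by ring, Real.cos_two_mul, Real.cos_two_mul, Real.cos_two_mul]

lemma cos_eight_sub_pi (θ : ℝ) : Real.cos (8 * (θ - Real.pi / 8)) = -Real.cos (8 * θ) := by
  rw [show 8 * (θ - Real.pi / 8) = 8 * θ - Real.pi by ring, Real.cos_sub_pi]

/-! ### Uniqueness in the plane -/

namespace TwoSphereDesign

variable {X : Finset (E 2)} {w : E 2 → ℝ} {r₁ r₂ : ℝ}

/-- In the plane the two parameters sum to 2/3 and each is at least 1/3, so both bounds are
attained. -/
lemma layerParam_eq_third (h : TwoSphereDesign X w r₁ r₂)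
    (hcard : X.card = 2 * Module.finrank ℝ (polySpaceStar 4 (sphereUnion X))) :
    layerParam X w r₁ r₂ = 1 / 3 := by
  have h1 := (h.tightLayer hcard).third_le
  have h2 := (h.symm.tightLayer hcard).third_le
  have h3 := h.layerParam_add
  norm_num at h3
  linarith

lemma card_layer (h : TwoSphereDesign X w r₁ r₂)
    (hcard : X.card = 2 * Module.finrank ℝ (polySpaceStar 4 (sphereUnion X))) :
    (layer X r₁).card = 8 := by
  have h1 := (h.tightLayer hcard).card_eq
  rw [h.layerParam_eq_third hcard] at h1
  norm_num at h1
  exact_mod_cast h1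

/-- Equal parameters mean that both layers have the same share of the eighth moment, and both have
the same cardinality. -/
lemma weight_ratio (h : TwoSphereDesign X w r₁ r₂)
    (hcard : X.card = 2 * Module.finrank ℝ (polySpaceStar 4 (sphereUnion X))) {x y : E 2}
    (hx : x ∈ layer X r₁) (hy : y ∈ layer X r₂) : w y = r₁ ^ 8 / r₂ ^ 8 * w x := by
  have h1 := h.layerWeight_eq hcard hx
  have h2 := h.symm.layerWeight_eq hcard hy
  have h3 := h.layerParam_eq_third hcard
  have h4 := h.symm.layerParam_eq_third hcard
  rw [h3] at h1
  rw [h4] at h2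
  have hM := h.momentEight_pos
  have hr := h.pos₂
  have h5 : layerWeight X w r₁ * r₁ ^ 8 = layerWeight X w r₂ * r₂ ^ 8 := by
    rw [← h4, layerParam, layerParam, momentEight_comm X w r₂ r₁] at h3
    field_simp at h3
    linarith
  rw [h1, h2] at h5
  field_simp
  norm_num at h5
  linarith

lemma weight_eq (h : TwoSphereDesign X w r₁ r₂)
    (hcard : X.card = 2 * Module.finrank ℝ (polySpaceStar 4 (sphereUnion X))) {x y : E 2}
    (hx : x ∈ layer X r₁) (hy : y ∈ layer X r₁) : w y = w x := by
  have h1 := h.layerWeight_eq hcard hx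
  rw [h.layerWeight_eq hcard hy, h.layerParam_eq_third hcard] at h1
  norm_num at h1
  linarith

/-- After a rotation, the first layer is the standard octagon. -/
lemma image_mem_octagon (h : TwoSphereDesign X w r₁ r₂)
    (hcard : X.card = 2 * Module.finrank ℝ (polySpaceStar 4 (sphereUnion X)))
    {g : E 2 ≃ₗᵢ[ℝ] E 2} {x₀ x : E 2} (hx₀ : x₀ ∈ layer X r₁) (hg : g x₀ = polar r₁ 0)
    (hx : x ∈ layer X r₁) : g x ∈ octagon r₁ 0 := by
  have T := h.tightLayer hcard
  have hr := h.pos₁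
  obtain ⟨θ, hθ⟩ := exists_polar (g x)
  rw [LinearIsometryEquiv.norm_map, T.norm_eq x hx] at hθ
  have hc : cosSq r₁ x₀ x = Real.cos θ ^ 2 := by
    rw [cosSq, ← g.inner_map_map, hg, hθ, inner_polar, zero_sub, Real.cos_neg]
    field_simp
  have hz : Real.cos θ ^ 2 = 1 ∨ Real.cos θ ^ 2 = 0 ∨ Real.cos θ ^ 2 = 1 / 2 := by
    by_cases h1 : x = x₀ ∨ x = -x₀
    · left
      rw [← hc]
      rcases h1 with rfl | rfl
      · exact T.cosSq_self hx
      · rw [TightLayer.cosSq_neg, T.cosSq_self hx₀]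
    · right
      push Not at h1
      have h2 := T.quad x₀ hx₀ x hx h1.1 h1.2
      rw [h.layerParam_eq_third hcard, hc] at h2
      norm_num at h2
      -- At α = 1/3 the constant term of the quadratic vanishes, leaving the roots 0 and 1/2.
      have h3 : Real.cos θ ^ 2 * (Real.cos θ ^ 2 - 1 / 2) = 0 := by linear_combination h2 / 8
      rcases mul_eq_zero.1 h3 with h4 | h4
      · exact Or.inl h4
      · right; linarith
  refine mem_octagon_iff.2 ⟨θ, ?_, hθ⟩
  rw [sub_zero, cos_eight_mul]
  rcases hz with h1 | h1 | h1 <;> rw [h1] <;> norm_num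

/-- In the plane the zonal condition is 8cos⁴θ − 8cos²θ + 1 = cos 4θ = 0, that is, cos 8θ = −1. -/
lemma image_mem_octagon' (h : TwoSphereDesign X w r₁ r₂)
    (hcard : X.card = 2 * Module.finrank ℝ (polySpaceStar 4 (sphereUnion X)))
    {g : E 2 ≃ₗᵢ[ℝ] E 2} {x₀ x : E 2} (hx₀ : x₀ ∈ layer X r₁) (hg : g x₀ = polar r₁ 0)
    (hx : x ∈ layer X r₂) : g x ∈ octagon r₂ (Real.pi / 8) := by
  have hr₁ := h.pos₁
  have hr₂ := h.pos₂
  obtain ⟨hxX, hxr⟩ := Finset.mem_filter.1 hx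
  obtain ⟨hx₀X, hx₀r⟩ := Finset.mem_filter.1 hx₀
  obtain ⟨θ, hθ⟩ := exists_polar (g x)
  rw [LinearIsometryEquiv.norm_map, hxr] at hθ
  have hz := h.zonalFour_eq_zero hcard hx₀X hxX (by rw [hxr, hx₀r]; exact h.ne)
  rw [zonalFour, ← g.inner_map_map, hg, hθ, inner_polar, zero_sub, Real.cos_neg, hxr, hx₀r] at hz
  norm_num at hz
  have h1 : (r₁ * r₂) ^ 4 * (8 * Real.cos θ ^ 4 - 8 * Real.cos θ ^ 2 + 1) = 0 := by
    linear_combination hz / 3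
  have h2 := (mul_eq_zero.1 h1).resolve_left (by positivity)
  refine mem_octagon_iff.2 ⟨θ, ?_, hθ⟩
  rw [cos_eight_sub_pi, cos_eight_mul]
  linear_combination -2 * (8 * Real.cos θ ^ 4 - 8 * Real.cos θ ^ 2 + 1) * h2

lemma eq_union (h : TwoSphereDesign X w r₁ r₂) : X = layer X r₁ ∪ layer X r₂ := by
  ext x
  simp only [layer, Finset.mem_union, Finset.mem_filter]
  constructor
  · intro hx
    rcases h.norm_eq hx with h' | h'
    · exact Or.inl ⟨hx, h'⟩
    · exact Or.inr ⟨hx, h'⟩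
  · tauto

theorem weightedSimilar (h : TwoSphereDesign X w r₁ r₂)
    (hcard : X.card = 2 * Module.finrank ℝ (polySpaceStar 4 (sphereUnion X))) :
    ∃ w₁ : ℝ, 0 < w₁ ∧ WeightedSimilar X w (octagonPair r₁ r₂) (octagonWeight r₁ r₂ w₁) := by
  obtain ⟨x₀, hx₀⟩ := (h.tightLayer hcard).nonempty
  obtain ⟨hx₀X, hx₀r⟩ := Finset.mem_filter.1 hx₀
  obtain ⟨g, hg⟩ := exists_isometry_map (x := x₀) (y := polar r₁ 0)
    (by rw [norm_polar h.pos₁.le, hx₀r])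
  -- Both sides have eight points, so inclusion is equality.
  have i₁ : (layer X r₁).image g = octagon r₁ 0 := by
    apply Finset.eq_of_subset_of_card_le
    · intro y hy
      obtain ⟨x, hx, rfl⟩ := Finset.mem_image.1 hy
      exact h.image_mem_octagon hcard hx₀ hg hx
    · rw [card_octagon h.pos₁, Finset.card_image_of_injective _ g.injective, h.card_layer hcard]
  have i₂ : (layer X r₂).image g = octagon r₂ (Real.pi / 8) := by
    apply Finset.eq_of_subset_of_card_le
    · intro y hy
      obtain ⟨x, hx, rfl⟩ := Finset.mem_image.1 hy
      exact h.image_mem_octagon' hcard hx₀ hg hx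
    · rw [card_octagon h.pos₂, Finset.card_image_of_injective _ g.injective,
        h.symm.card_layer hcard]
  refine ⟨w x₀, h.design.weight_pos x₀ hx₀X, g, 1, 1, one_pos, one_pos, ?_, fun x hx => ?_⟩
  · simp only [one_smul]
    conv_lhs => rw [h.eq_union]
    rw [Finset.image_union, octagonPair, ← i₁, ← i₂]
  · rw [one_smul, one_mul, octagonWeight]
    split_ifs with hmem
    · have hxr := norm_of_mem_octagon h.pos₁.le hmem
      rw [LinearIsometryEquiv.norm_map] at hxr
      exact (h.weight_eq hcard hx₀ (Finset.mem_filter.2 ⟨hx, hxr⟩)).symm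
    · rcases h.norm_eq hx with hxr | hxr
      · exact absurd (h.image_mem_octagon hcard hx₀ hg (Finset.mem_filter.2 ⟨hx, hxr⟩)) hmem
      · exact (h.weight_ratio hcard hx₀ (Finset.mem_filter.2 ⟨hx, hxr⟩)).symm

end TwoSphereDesign

end EuclideanDesign

end

noncomputable section

open MeasureTheory
open scoped Classical

namespace EuclideanDesign

/-! ### The octagon pair is a tight design -/

/-! ### Power sums over an octagon -/

section PowerSums

lemma sum_cos_pow (x : ℝ) (m : ℕ) :
    ∑ k ∈ Finset.range 8, Real.cos (x + 2 * k * Real.pi / 8) ^ m =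
      (1 + (-1) ^ m) * (Real.cos x ^ m + (√2 / 2) ^ m * (Real.cos x - Real.sin x) ^ m
        + (-Real.sin x) ^ m + (-(√2 / 2)) ^ m * (Real.cos x + Real.sin x) ^ m) := by
  have e1 : Real.cos (x + Real.pi / 4) = √2 / 2 * (Real.cos x - Real.sin x) := by
    rw [Real.cos_add, Real.cos_pi_div_four, Real.sin_pi_div_four]; ring
  have e2 : Real.cos (x + Real.pi / 4 + Real.pi / 2) = -(√2 / 2) * (Real.cos x + Real.sin x) := by
    rw [Real.cos_add_pi_div_two, Real.sin_add, Real.cos_pi_div_four, Real.sin_pi_div_four]; ring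
  have hpi : ∀ y, Real.cos (y + Real.pi) ^ m = (-1) ^ m * Real.cos y ^ m := fun y => by
    rw [Real.cos_add_pi, neg_pow]
  simp only [Finset.sum_range_succ, Finset.sum_range_zero, zero_add]
  push_cast
  rw [show x + 2 * 0 * Real.pi / 8 = x by ring,
    show x + 2 * 1 * Real.pi / 8 = x + Real.pi / 4 by ring,
    show x + 2 * 2 * Real.pi / 8 = x + Real.pi / 2 by ring,
    show x + 2 * 3 * Real.pi / 8 = x + Real.pi / 4 + Real.pi / 2 by ring,
    show x + 2 * 4 * Real.pi / 8 = x + Real.pi by ring,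
    show x + 2 * 5 * Real.pi / 8 = x + Real.pi / 4 + Real.pi by ring,
    show x + 2 * 6 * Real.pi / 8 = x + Real.pi / 2 + Real.pi by ring,
    show x + 2 * 7 * Real.pi / 8 = x + Real.pi / 4 + Real.pi / 2 + Real.pi by ring,
    hpi, hpi, hpi, hpi, e1, e2, Real.cos_add_pi_div_two, mul_pow, mul_pow]
  ring

lemma sum_cos_pow_odd (x : ℝ) {m : ℕ} (hm : Odd m) :
    ∑ k ∈ Finset.range 8, Real.cos (x + 2 * k * Real.pi / 8) ^ m = 0 := by
  rw [sum_cos_pow, hm.neg_one_pow]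
  ring

lemma sum_cos_pow_even (x : ℝ) (m : ℕ) :
    ∑ k ∈ Finset.range 8, Real.cos (x + 2 * k * Real.pi / 8) ^ (2 * m) =
      2 * ((Real.cos x ^ 2) ^ m + (Real.sin x ^ 2) ^ m
        + (1 / 2) ^ m * ((Real.cos x - Real.sin x) ^ (2 * m)
          + (Real.cos x + Real.sin x) ^ (2 * m))) := by
  have h2 : (√2 / 2) ^ 2 = 1 / 2 := by
    rw [div_pow, Real.sq_sqrt (by norm_num)]; norm_num
  rw [sum_cos_pow, pow_mul (-1 : ℝ), neg_one_sq, one_pow, pow_mul (√2 / 2), pow_mul (-(√2 / 2)),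
    neg_sq, h2, pow_mul (-Real.sin x), neg_sq, pow_mul (Real.cos x)]
  ring

lemma coordMoment_plane (m : ℕ) (hm : m ≤ 9) (h8 : m ≠ 8) (x : ℝ) :
    ∑ k ∈ Finset.range 8, Real.cos (x + 2 * k * Real.pi / 8) ^ m = 8 * coordMoment le_rfl m := by
  have hs := Real.sin_sq x
  rcases Nat.even_or_odd' m with ⟨j, rfl | rfl⟩
  · have hj : j < 4 := by omega
    rw [sum_cos_pow_even]
    interval_cases j
    · norm_num [coordMoment_zero]
    · have e : (Real.cos x - Real.sin x) ^ (2 * 1) + (Real.cos x + Real.sin x) ^ (2 * 1) =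
        2 * Real.cos x ^ 2 + 2 * Real.sin x ^ 2 := by ring
      rw [e, hs, coordMoment_two]
      norm_num
      ring
    · have e : (Real.cos x - Real.sin x) ^ (2 * 2) + (Real.cos x + Real.sin x) ^ (2 * 2) =
        2 * Real.cos x ^ 4 + 12 * Real.cos x ^ 2 * Real.sin x ^ 2
          + 2 * (Real.sin x ^ 2) ^ 2 := by ring
      rw [e, hs, coordMoment_four]
      norm_num
      ring
    · have e : (Real.cos x - Real.sin x) ^ (2 * 3) + (Real.cos x + Real.sin x) ^ (2 * 3) =
        2 * Real.cos x ^ 6 + 30 * Real.cos x ^ 4 * Real.sin x ^ 2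
          + 30 * Real.cos x ^ 2 * (Real.sin x ^ 2) ^ 2 + 2 * (Real.sin x ^ 2) ^ 3 := by ring
      rw [e, hs, coordMoment_six]
      norm_num
      ring
  · rw [sum_cos_pow_odd x ⟨j, rfl⟩, coordMoment_odd _ ⟨j, rfl⟩, mul_zero]

/-- Degree 8 is the only degree up to 9 in which an octagon fails. The error is a multiple of cos
8x, so it changes sign under rotation by π/8. -/
lemma sum_cos_pow_eight (x : ℝ) :
    ∑ k ∈ Finset.range 8, Real.cos (x + 2 * k * Real.pi / 8) ^ 8 =
      8 * coordMoment le_rfl 8 + Real.cos (8 * x) / 16 := by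
  have hs := Real.sin_sq x
  have e : (Real.cos x - Real.sin x) ^ (2 * 4) + (Real.cos x + Real.sin x) ^ (2 * 4) =
    2 * Real.cos x ^ 8 + 56 * Real.cos x ^ 6 * Real.sin x ^ 2
      + 140 * Real.cos x ^ 4 * (Real.sin x ^ 2) ^ 2 + 56 * Real.cos x ^ 2 * (Real.sin x ^ 2) ^ 3
      + 2 * (Real.sin x ^ 2) ^ 4 := by ring
  rw [show (8 : ℕ) = 2 * 4 from rfl, sum_cos_pow_even, e, hs, cos_eight_mul,
    show 2 * 4 = 8 from rfl, coordMoment_eight]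
  norm_num
  ring

end PowerSums

lemma sum_octagon_inner_pow {r : ℝ} (hr : 0 < r) (φ s ψ : ℝ) (m : ℕ) :
    ∑ x ∈ octagon r φ, inner ℝ (polar s ψ) x ^ m =
      s ^ m * r ^ m * ∑ k ∈ Finset.range 8, Real.cos (φ - ψ + 2 * k * Real.pi / 8) ^ m := by
  rw [sum_octagon hr, Finset.mul_sum]
  refine Finset.sum_congr rfl fun k _ => ?_
  rw [real_inner_comm, inner_polar, mul_pow, mul_pow, mul_comm (r ^ m)]
  congr 3
  ring

/-- The mean over a sphere, as a linear functional on polynomials. -/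
def sphereMeanLin {n : ℕ} (r : ℝ) : MvPolynomial (Fin n) ℝ →ₗ[ℝ] ℝ where
  toFun f := sphereMean r (evalAt f)
  map_add' f g := by
    rw [← sphereMean_add (continuous_evalAt f) (continuous_evalAt g)]
    congr 1
    ext x
    exact evalAt_add f g x
  map_smul' c f := by
    rw [RingHom.id_apply, smul_eq_mul, ← sphereMean_const_mul]
    congr 1
    ext x
    exact evalAt_smul c f x

/-- A linear functional on polynomials that vanishes on the powers of linear forms up to degree
`d` vanishes on the polynomials of degree at most `d`. -/
lemma eq_zero_of_linPoly_pow {n d : ℕ} (T : MvPolynomial (Fin n) ℝ →ₗ[ℝ] ℝ)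
    (hT : ∀ m ≤ d, ∀ v : E n, T (linPoly v ^ m) = 0) {f : MvPolynomial (Fin n) ℝ}
    (hf : f.totalDegree ≤ d) : T f = 0 := by
  rw [← MvPolynomial.sum_homogeneousComponent f, map_sum]
  refine Finset.sum_eq_zero fun m hm => ?_
  have hm' : m ≤ d := by have := Finset.mem_range.1 hm; omega
  have h1 : Submodule.span ℝ (Set.range fun v : E n => linPoly v ^ m) ≤ LinearMap.ker T := by
    rw [Submodule.span_le]
    rintro _ ⟨v, rfl⟩
    exact hT m hm' v
  exact h1 (homogeneousSubmodule_le_span_linPoly_pow m (MvPolynomial.homogeneousComponent_mem m f))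

/-! ### Two octagons with balanced eighth moments -/

section OctagonPair

variable {r₁ r₂ w₁ : ℝ}

lemma octagon_disjoint (h₁ : 0 < r₁) (h₂ : 0 < r₂) (hne : r₁ ≠ r₂) (φ ψ : ℝ) :
    Disjoint (octagon r₁ φ) (octagon r₂ ψ) := by
  rw [Finset.disjoint_left]
  intro x hx hx'
  exact hne ((norm_of_mem_octagon h₁.le hx).symm.trans (norm_of_mem_octagon h₂.le hx'))

lemma octagon_nonempty (r φ : ℝ) : (octagon r φ).Nonempty :=
  ⟨_, Finset.mem_image_of_mem _ (Finset.mem_range.2 (by norm_num : 0 < 8))⟩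

lemma radii_octagonPair (h₁ : 0 < r₁) (h₂ : 0 < r₂) : radii (octagonPair r₁ r₂) = {r₁, r₂} := by
  have h : ∀ r φ, 0 < r → (octagon r φ).image (fun x => ‖x‖) = {r} := by
    intro r φ hr
    obtain ⟨x, hx⟩ := octagon_nonempty r φ
    ext s
    simp only [Finset.mem_image, Finset.mem_singleton]
    constructor
    · rintro ⟨y, hy, rfl⟩
      exact norm_of_mem_octagon hr.le hy
    · rintro rfl
      exact ⟨x, hx, norm_of_mem_octagon hr.le hx⟩
  rw [radii, octagonPair, Finset.image_union, h r₁ 0 h₁, h r₂ _ h₂]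
  rfl

lemma layer_octagonPair_left (h₁ : 0 < r₁) (h₂ : 0 < r₂) (hne : r₁ ≠ r₂) :
    layer (octagonPair r₁ r₂) r₁ = octagon r₁ 0 := by
  ext x
  simp only [layer, octagonPair, Finset.mem_filter, Finset.mem_union]
  constructor
  · rintro ⟨hx | hx, hr⟩
    · exact hx
    · exact absurd (hr.symm.trans (norm_of_mem_octagon h₂.le hx)) hne
  · exact fun hx => ⟨Or.inl hx, norm_of_mem_octagon h₁.le hx⟩

lemma layer_octagonPair_right (h₁ : 0 < r₁) (h₂ : 0 < r₂) (hne : r₁ ≠ r₂) :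
    layer (octagonPair r₁ r₂) r₂ = octagon r₂ (Real.pi / 8) := by
  ext x
  simp only [layer, octagonPair, Finset.mem_filter, Finset.mem_union]
  constructor
  · rintro ⟨hx | hx, hr⟩
    · exact absurd ((norm_of_mem_octagon h₁.le hx).symm.trans hr) hne
    · exact hx
  · exact fun hx => ⟨Or.inr hx, norm_of_mem_octagon h₂.le hx⟩

lemma octagonWeight_left {x : E 2} (hx : x ∈ octagon r₁ 0) : octagonWeight r₁ r₂ w₁ x = w₁ :=
  if_pos hx

lemma octagonWeight_right (h₁ : 0 < r₁) (h₂ : 0 < r₂) (hne : r₁ ≠ r₂) {x : E 2}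
    (hx : x ∈ octagon r₂ (Real.pi / 8)) : octagonWeight r₁ r₂ w₁ x = r₁ ^ 8 / r₂ ^ 8 * w₁ :=
  if_neg fun hx' => Finset.disjoint_left.1 (octagon_disjoint h₁ h₂ hne _ _) hx' hx

lemma octagonPair_isDesign (h₁ : 0 < r₁) (h₂ : 0 < r₂) (hne : r₁ ≠ r₂) (hw : 0 < w₁) :
    IsDesign 9 (octagonPair r₁ r₂) (octagonWeight r₁ r₂ w₁) := by
  have hw₂ : 0 < r₁ ^ 8 / r₂ ^ 8 * w₁ := by positivity
  refine ⟨fun x _ => ?_, fun f hf => ?_⟩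
  · unfold octagonWeight
    split_ifs <;> assumption
  · have W₁ : ∑ x ∈ octagon r₁ 0, octagonWeight r₁ r₂ w₁ x = 8 * w₁ := by
      rw [Finset.sum_congr rfl fun x hx => octagonWeight_left hx, Finset.sum_const,
        card_octagon h₁, nsmul_eq_mul]
      norm_num
    have W₂ : ∑ x ∈ octagon r₂ (Real.pi / 8), octagonWeight r₁ r₂ w₁ x =
        8 * (r₁ ^ 8 / r₂ ^ 8 * w₁) := by
      rw [Finset.sum_congr rfl fun x hx => octagonWeight_right h₁ h₂ hne hx, Finset.sum_const,
        card_octagon h₂, nsmul_eq_mul]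
      norm_num
    let T : MvPolynomial (Fin 2) ℝ →ₗ[ℝ] ℝ :=
      (8 * w₁) • sphereMeanLin r₁ + (8 * (r₁ ^ 8 / r₂ ^ 8 * w₁)) • sphereMeanLin r₂
        - (w₁ • ∑ x ∈ octagon r₁ 0, evalLin x
          + (r₁ ^ 8 / r₂ ^ 8 * w₁) • ∑ x ∈ octagon r₂ (Real.pi / 8), evalLin x)
    have hT : T f = 0 := by
      refine eq_zero_of_linPoly_pow T (fun m hm v => ?_) hf
      obtain ⟨ψ, hψ⟩ := exists_polar v
      have hmean : ∀ r, sphereMean r (evalAt (linPoly v ^ m)) =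
          r ^ m * (‖v‖ ^ m * coordMoment le_rfl m) := fun r => by
        rw [← sphereMean_inner_pow_eq, sphereMean_scale, ← sphereMean_const_mul]
        congr 1
        ext u
        rw [evalAt_pow, evalAt_linPoly, real_inner_smul_right, mul_pow]
      have hsum : ∀ r φ, 0 < r → ∑ x ∈ octagon r φ, evalAt (linPoly v ^ m) x =
          ‖v‖ ^ m * r ^ m * ∑ k ∈ Finset.range 8, Real.cos (φ - ψ + 2 * k * Real.pi / 8) ^ m :=
        fun r φ hr => by
          rw [← sum_octagon_inner_pow hr, ← hψ]
          simp only [evalAt_pow, evalAt_linPoly]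
      simp only [T, LinearMap.sub_apply, LinearMap.add_apply, LinearMap.smul_apply, smul_eq_mul,
        LinearMap.coe_sum, Finset.sum_apply, evalLin_apply]
      change 8 * w₁ * sphereMean r₁ _ + 8 * (r₁ ^ 8 / r₂ ^ 8 * w₁) * sphereMean r₂ _ - _ = 0
      rw [hmean, hmean, hsum r₁ 0 h₁, hsum r₂ _ h₂]
      by_cases h8 : m = 8
      · subst h8
        rw [sum_cos_pow_eight, sum_cos_pow_eight]
        -- The errors of degree 8 have opposite signs, and the weights are chosen so that weight
        -- times eighth power of the radius agrees.
        have hc : Real.cos (8 * (Real.pi / 8 - ψ)) = -Real.cos (8 * (0 - ψ)) := by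
          rw [show 8 * (Real.pi / 8 - ψ) = Real.pi - 8 * ψ by ring, Real.cos_pi_sub,
            show 8 * (0 - ψ) = -(8 * ψ) by ring, Real.cos_neg]
        rw [hc]
        field_simp
        ring
      · rw [coordMoment_plane m hm h8, coordMoment_plane m hm h8]
        ring
    rw [radii_octagonPair h₁ h₂, Finset.sum_pair hne, layer_octagonPair_left h₁ h₂ hne,
      layer_octagonPair_right h₁ h₂ hne, W₁, W₂, octagonPair,
      Finset.sum_union (octagon_disjoint h₁ h₂ hne _ _),
      Finset.sum_congr rfl (g := fun x => w₁ * evalAt f x)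
        (fun x hx => by rw [octagonWeight_left hx]),
      Finset.sum_congr (s₁ := octagon r₂ (Real.pi / 8)) rfl
        (g := fun x => r₁ ^ 8 / r₂ ^ 8 * w₁ * evalAt f x)
        (fun x hx => by rw [octagonWeight_right h₁ h₂ hne hx]),
      ← Finset.mul_sum, ← Finset.mul_sum]
    simp only [T, LinearMap.sub_apply, LinearMap.add_apply, LinearMap.smul_apply, smul_eq_mul,
      LinearMap.coe_sum, Finset.sum_apply, evalLin_apply] at hT
    exact sub_eq_zero.1 hT

lemma octagonPair_twoSphereDesign (h₁ : 0 < r₁) (h₂ : 0 < r₂) (hne : r₁ ≠ r₂) (hw : 0 < w₁) :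
    TwoSphereDesign (octagonPair r₁ r₂) (octagonWeight r₁ r₂ w₁) r₁ r₂ :=
  ⟨le_rfl, h₁, h₂, hne, radii_octagonPair h₁ h₂, octagonPair_isDesign h₁ h₂ hne hw⟩

/-- An even quartic that separates the points of two octagons from a vertex of the first. -/
lemma octagon_separating {r s φ ψ : ℝ} (hr : 0 < r) (hs : 0 < s) (hne : r ≠ s)
    (hφψ : Real.cos (8 * (φ - ψ)) = -1) {x : E 2} (hx : x ∈ octagon r φ) :
    ∃ f ∈ evenQuartics 2, evalAt f x ≠ 0 ∧
      (∀ y ∈ octagon r φ, y ≠ x → y ≠ -x → evalAt f y = 0) ∧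
      ∀ y ∈ octagon s ψ, evalAt f y = 0 := by
  have hrs : r ^ 2 - s ^ 2 ≠ 0 := by
    rw [sub_ne_zero]
    exact fun h => hne ((sq_eq_sq₀ hr.le hs.le).1 h)
  let L := linPoly x
  let N := normPoly 2
  -- The terms come from two pieces, visible in `hval`: one with the factor t² − s², vanishing on
  -- the second circle, and the fourth harmonic, vanishing on the second octagon. On the first
  -- circle they add up to 4cos²(2cos² − 1), zero at the vertices other than ±x.
  let f : MvPolynomial (Fin 2) ℝ :=
    (4 / r ^ 4 / (r ^ 2 - s ^ 2)) • (N * L ^ 2) + (-1 / (r ^ 2 - s ^ 2)) • N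
      + (-4 * s ^ 2 / r ^ 4 / (r ^ 2 - s ^ 2)) • L ^ 2 + MvPolynomial.C (s ^ 2 / (r ^ 2 - s ^ 2))
      + (8 / r ^ 8) • L ^ 4 + (-8 / r ^ 6) • (N * L ^ 2) + (1 / r ^ 4) • N ^ 2
  have hL := linPoly_isHomogeneous x
  have hN := normPoly_isHomogeneous 2
  have h4 : MvPolynomial.homogeneousSubmodule (Fin 2) ℝ 4 ≤ evenQuartics 2 :=
    homogeneous_le_evenQuartics (by simp)
  have h2 : MvPolynomial.homogeneousSubmodule (Fin 2) ℝ 2 ≤ evenQuartics 2 :=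
    homogeneous_le_evenQuartics (by simp)
  have h0 : MvPolynomial.homogeneousSubmodule (Fin 2) ℝ 0 ≤ evenQuartics 2 :=
    homogeneous_le_evenQuartics (by simp)
  have hf : f ∈ evenQuartics 2 := by
    have m1 : N * L ^ 2 ∈ evenQuartics 2 := h4 (hN.mul (hL.pow 2))
    have m2 : L ^ 2 ∈ evenQuartics 2 := h2 (hL.pow 2)
    have m3 : L ^ 4 ∈ evenQuartics 2 := h4 (hL.pow 4)
    have m4 : N ^ 2 ∈ evenQuartics 2 := h4 (hN.pow 2)
    have m5 : N ∈ evenQuartics 2 := h2 hN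
    have m6 : MvPolynomial.C (s ^ 2 / (r ^ 2 - s ^ 2)) ∈ evenQuartics 2 :=
      h0 (MvPolynomial.isHomogeneous_C _ _)
    exact add_mem (add_mem (add_mem (add_mem (add_mem (add_mem (Submodule.smul_mem _ _ m1)
      (Submodule.smul_mem _ _ m5)) (Submodule.smul_mem _ _ m2)) m6) (Submodule.smul_mem _ _ m3))
      (Submodule.smul_mem _ _ m1)) (Submodule.smul_mem _ _ m4)
  obtain ⟨a, ha, hxa⟩ := mem_octagon_iff.1 hx
  have hval : ∀ t b, 0 ≤ t → evalAt f (polar t b) =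
      (t ^ 2 - s ^ 2) / (r ^ 2 - s ^ 2) * (4 * t ^ 2 / r ^ 2 * Real.cos (a - b) ^ 2 - 1)
        + t ^ 4 / r ^ 4 * (8 * Real.cos (a - b) ^ 4 - 8 * Real.cos (a - b) ^ 2 + 1) := by
    intro t b ht
    simp only [f, L, N, evalAt_add, evalAt_smul, evalAt_mul, evalAt_pow, evalAt_linPoly,
      evalAt_normPoly, evalAt_C, norm_polar ht]
    rw [hxa, inner_polar]
    field_simp
    ring
  have hvalr : ∀ b, evalAt f (polar r b) =
      4 * Real.cos (a - b) ^ 2 * (2 * Real.cos (a - b) ^ 2 - 1) := by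
    intro b
    rw [hval r b hr.le, div_self hrs]
    field_simp
    ring
  refine ⟨f, hf, ?_, fun y hy hyx hyx' => ?_, fun y hy => ?_⟩
  · rw [hxa, hvalr, sub_self, Real.cos_zero]
    norm_num
  · obtain ⟨b, hb, hyb⟩ := mem_octagon_iff.1 hy
    have hcos : Real.cos (8 * (a - b)) = 1 := by
      obtain ⟨j, hj⟩ := (Real.cos_eq_one_iff _).1 ha
      obtain ⟨k, hk⟩ := (Real.cos_eq_one_iff _).1 hb
      refine (Real.cos_eq_one_iff _).2 ⟨j - k, ?_⟩
      push_cast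
      linarith
    have hc1 : Real.cos (a - b) ^ 2 ≠ 1 := by
      intro h
      have hin : inner ℝ x y = r ^ 2 * Real.cos (a - b) := by
        rw [hxa, hyb, inner_polar]; ring
      have hnx := norm_of_mem_octagon hr.le hx
      have hny := norm_of_mem_octagon hr.le hy
      rcases sq_eq_sq_iff_eq_or_eq_neg.1 (h.trans (one_pow 2).symm) with h' | h'
      · apply hyx
        rw [← sub_eq_zero, ← norm_eq_zero, ← sq_eq_zero_iff, norm_sub_sq_real, real_inner_comm,
          hin, hnx, hny, h']
        ring
      · apply hyx'
        rw [← sub_eq_zero, sub_neg_eq_add, ← norm_eq_zero, ← sq_eq_zero_iff, norm_add_sq_real,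
          real_inner_comm, hin, hnx, hny, h']
        ring
    rw [cos_eight_mul] at hcos
    rw [hyb, hvalr]
    -- With c = cos², one has cos 8θ − 1 = 32c(c − 1)(2c − 1)²; the extra factor c completes a
    -- square.
    have hfac : (Real.cos (a - b) ^ 2 * (2 * Real.cos (a - b) ^ 2 - 1)) ^ 2
        * (Real.cos (a - b) ^ 2 - 1) = 0 := by
      linear_combination (Real.cos (a - b) ^ 2) * hcos / 32
    have := (mul_eq_zero.1 hfac).resolve_right (sub_ne_zero.2 hc1)
    have := pow_eq_zero_iff (two_ne_zero) |>.1 this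
    linear_combination 4 * this
  · obtain ⟨b, hb, hyb⟩ := mem_octagon_iff.1 hy
    have hcos : Real.cos (8 * (a - b)) = -1 := by
      obtain ⟨j, hj⟩ := (Real.cos_eq_one_iff _).1 ha
      obtain ⟨k, hk⟩ := (Real.cos_eq_one_iff _).1 hb
      rw [← hφψ, ← Real.cos_add_int_mul_two_pi (8 * (φ - ψ)) (j - k)]
      congr 1
      push_cast
      linarith
    rw [cos_eight_mul] at hcos
    have h1 : (8 * Real.cos (a - b) ^ 4 - 8 * Real.cos (a - b) ^ 2 + 1) ^ 2 = 0 := by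
      linear_combination hcos / 2
    have h2 := pow_eq_zero_iff (two_ne_zero) |>.1 h1
    rw [hyb, hval s b hs.le, h2]
    ring

theorem octagonPair_isTightDesign (h₁ : 0 < r₁) (h₂ : 0 < r₂) (hne : r₁ ≠ r₂) (hw : 0 < w₁) :
    IsTightDesign 9 2 (octagonPair r₁ r₂) (octagonWeight r₁ r₂ w₁) := by
  have hD := octagonPair_twoSphereDesign h₁ h₂ hne hw
  refine ⟨hD.design, ?_, ?_⟩
  · rw [hD.radii_eq, Finset.card_pair hne]
  · rw [moellerBound, if_neg (by decide), if_neg (fun h => hD.ne_zero h.2 rfl)]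
    apply hD.card_eq_of_separating
    intro x hx
    rcases Finset.mem_union.1 hx with hx | hx
    · obtain ⟨f, hf, hfx, hf1, hf2⟩ := octagon_separating h₁ h₂ hne (φ := 0) (ψ := Real.pi / 8)
        (by rw [cos_eight_sub_pi]; simp) hx
      refine ⟨f, hf, hfx, fun y hy hyx hyx' => ?_⟩
      rcases Finset.mem_union.1 hy with hy | hy
      · exact hf1 y hy hyx hyx'
      · exact hf2 y hy
    · obtain ⟨f, hf, hfx, hf1, hf2⟩ := octagon_separating h₂ h₁ hne.symm (φ := Real.pi / 8)
        (ψ := 0) (by rw [show 8 * (Real.pi / 8 - 0) = Real.pi by ring, Real.cos_pi]) hx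
      refine ⟨f, hf, hfx, fun y hy hyx hyx' => ?_⟩
      rcases Finset.mem_union.1 hy with hy | hy
      · exact hf2 y hy
      · exact hf1 y hy hyx hyx'

end OctagonPair

end EuclideanDesign

end

noncomputable section

open MeasureTheory
open scoped Classical

namespace EuclideanDesign

variable {n : ℕ}

/-! ### Harmonic polynomials of degree four -/

lemma finrank_homogeneousSubmodule (n m : ℕ) :
    Module.finrank ℝ (MvPolynomial.homogeneousSubmodule (Fin n) ℝ m) = (n + m - 1).choose m := by
  let S := Finset.finsuppAntidiag (Finset.univ : Finset (Fin n)) m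
  have hS : ∀ d : Fin n →₀ ℕ, d ∈ S ↔ d.degree = m := by
    intro d
    rw [Finset.mem_finsuppAntidiag, Finsupp.degree_eq_sum]
    simp
  let c : MvPolynomial.homogeneousSubmodule (Fin n) ℝ m →ₗ[ℝ] (S → ℝ) :=
    LinearMap.pi fun d => (MvPolynomial.lcoeff ℝ (d : Fin n →₀ ℕ)) ∘ₗ Submodule.subtype _
  have hc : ∀ p d, c p d = MvPolynomial.coeff (d : Fin n →₀ ℕ) (p : MvPolynomial (Fin n) ℝ) :=
    fun _ _ => rfl
  have hinj : Function.Injective c := by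
    rw [← LinearMap.ker_eq_bot, LinearMap.ker_eq_bot']
    intro p hp
    ext d
    by_cases hd : d ∈ S
    · have := congrFun hp ⟨d, hd⟩
      rw [hc] at this
      simpa using this
    · rw [MvPolynomial.IsHomogeneous.coeff_eq_zero ((MvPolynomial.mem_homogeneousSubmodule _ _).1 p.2)
        (fun h => hd ((hS d).2 h))]
      simp
  have hsurj : Function.Surjective c := by
    intro u
    refine ⟨⟨∑ d : S, MvPolynomial.monomial (d : Fin n →₀ ℕ) (u d), ?_⟩, ?_⟩
    · exact Submodule.sum_mem _ fun d _ =>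
        MvPolynomial.isHomogeneous_monomial _ ((hS d).1 d.2)
    · ext d
      rw [hc, MvPolynomial.coeff_sum]
      simp only [MvPolynomial.coeff_monomial]
      rw [Finset.sum_eq_single d]
      · simp
      · intro b _ hb
        rw [if_neg (fun h => hb (Subtype.ext h))]
      · simp
  rw [(LinearEquiv.ofBijective c ⟨hinj, hsurj⟩).finrank_eq, Module.finrank_fintype_fun_eq_card,
    Fintype.card_coe, Finset.card_finsuppAntidiag_nat_eq_choose, Finset.card_univ, Fintype.card_fin]

lemma pderiv_linPoly (i : Fin n) (v : E n) :
    MvPolynomial.pderiv i (linPoly v) = MvPolynomial.C (v i) := by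
  rw [linPoly, map_sum]
  rw [Finset.sum_eq_single i]
  · simp [MvPolynomial.smul_eq_C_mul]
  · intro j _ hj
    simp [Pi.single_eq_of_ne hj]
  · simp

lemma laplacian_linPoly_pow_four (v : E n) :
    laplacian n (linPoly v ^ 4) = (12 * ‖v‖ ^ 2) • linPoly v ^ 2 := by
  have h1 : ∀ i, MvPolynomial.pderiv i (MvPolynomial.pderiv i (linPoly v ^ 4)) =
      MvPolynomial.C (12 * v i ^ 2) * linPoly v ^ 2 := by
    intro i
    have h4 : MvPolynomial.pderiv i (linPoly v ^ 4) =
        MvPolynomial.C (4 * v i) * linPoly v ^ 3 := by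
      rw [Derivation.leibniz_pow, pderiv_linPoly]
      simp only [smul_eq_mul, nsmul_eq_mul, map_mul, map_ofNat, Nat.cast_ofNat]
      norm_num
      ring
    rw [h4, MvPolynomial.pderiv_C_mul, Derivation.leibniz_pow, pderiv_linPoly]
    simp only [smul_eq_mul, nsmul_eq_mul, map_mul, map_pow, map_ofNat, Nat.cast_ofNat]
    norm_num
    ring
  simp only [laplacian, LinearMap.coe_sum, Finset.sum_apply, LinearMap.comp_apply]
  rw [EuclideanSpace.real_norm_sq_eq, Finset.mul_sum, MvPolynomial.smul_eq_C_mul, map_sum,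
    Finset.sum_mul]
  exact Finset.sum_congr rfl fun i _ => h1 i

/-- The Laplacian sends the fourth power of a nonzero linear form to a nonzero multiple of its
square, and powers of linear forms span in both degrees. Rank–nullity then gives the dimension of
the harmonic quartics. -/
lemma map_laplacian (n : ℕ) :
    (MvPolynomial.homogeneousSubmodule (Fin n) ℝ 4).map (laplacian n) =
      MvPolynomial.homogeneousSubmodule (Fin n) ℝ 2 := by
  apply le_antisymm
  · rw [Submodule.map_le_iff_le_comap]
    refine (homogeneousSubmodule_le_span_linPoly_pow 4).trans ?_
    rw [Submodule.span_le]
    rintro _ ⟨v, rfl⟩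
    change laplacian n (linPoly v ^ 4) ∈ MvPolynomial.homogeneousSubmodule (Fin n) ℝ 2
    rw [laplacian_linPoly_pow_four]
    exact Submodule.smul_mem _ _ ((linPoly_isHomogeneous v).pow 2)
  · refine (homogeneousSubmodule_le_span_linPoly_pow 2).trans ?_
    rw [Submodule.span_le]
    rintro _ ⟨v, rfl⟩
    by_cases hv : v = 0
    · have : linPoly v = 0 := by simp [hv, linPoly]
      change linPoly v ^ 2 ∈ Submodule.map _ _
      rw [this, zero_pow two_ne_zero]
      exact Submodule.zero_mem _
    · refine ⟨(12 * ‖v‖ ^ 2)⁻¹ • linPoly v ^ 4,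
        Submodule.smul_mem _ _ ((linPoly_isHomogeneous v).pow 4), ?_⟩
      rw [map_smul, laplacian_linPoly_pow_four, smul_smul, inv_mul_cancel₀, one_smul]
      have := norm_ne_zero_iff.2 hv
      positivity

lemma finrank_harmonicSpace_add (n : ℕ) :
    Module.finrank ℝ (harmonicSpace n 4) + (n + 1).choose 2 = (n + 3).choose 4 := by
  have : FiniteDimensional ℝ (MvPolynomial.homogeneousSubmodule (Fin n) ℝ 4) :=
    Module.Finite.iff_fg.2 (MvPolynomial.homogeneousSubmodule_fg _ _ _)
  have h1 := LinearMap.finrank_range_add_finrank_ker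
    ((laplacian n).domRestrict (MvPolynomial.homogeneousSubmodule (Fin n) ℝ 4))
  rw [LinearMap.range_domRestrict, map_laplacian, finrank_homogeneousSubmodule,
    finrank_homogeneousSubmodule] at h1
  have h2 : Module.finrank ℝ (LinearMap.ker ((laplacian n).domRestrict
      (MvPolynomial.homogeneousSubmodule (Fin n) ℝ 4))) = Module.finrank ℝ (harmonicSpace n 4) := by
    rw [LinearMap.ker_domRestrict, ← Submodule.finrank_map_subtype_eq, Submodule.map_comap_subtype]
    rfl
  rw [h2] at h1
  rw [show n + 2 - 1 = n + 1 from rfl, show n + 4 - 1 = n + 3 from rfl] at h1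
  omega

lemma finrank_harmonicSpace (n : ℕ) :
    (Module.finrank ℝ (harmonicSpace n 4) : ℝ) = n * (n + 6) * (n ^ 2 - 1) / 24 := by
  have h := finrank_harmonicSpace_add n
  have h' : (Module.finrank ℝ (harmonicSpace n 4) : ℝ) + ((n + 1).choose 2 : ℝ) =
      ((n + 3).choose 4 : ℝ) := by exact_mod_cast h
  have e2 : ((n + 1).choose 2 : ℝ) = n * (n + 1) / 2 := by
    rw [Nat.cast_choose_two]; push_cast; ring
  have e4 : ((n + 3).choose 4 : ℝ) = n * (n + 1) * (n + 2) * (n + 3) / 24 := by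
    have h3 := Nat.descFactorial_eq_factorial_mul_choose (n + 3) 4
    have h5 : (n + 3).descFactorial 4 = n * (n + 1) * (n + 2) * (n + 3) := by
      simp only [Nat.descFactorial]
      rw [show n + 3 - 3 = n from rfl, show n + 3 - 2 = n + 1 from rfl,
        show n + 3 - 1 = n + 2 from rfl, Nat.sub_zero]
      ring
    rw [h5] at h3
    have h6 : ((n * (n + 1) * (n + 2) * (n + 3) : ℕ) : ℝ) = ((4).factorial * (n + 3).choose 4 : ℕ) := by
      exact_mod_cast h3
    push_cast [Nat.factorial] at h6
    rw [h6]
    norm_num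
  rw [e2, e4] at h'
  linear_combination h'

theorem gegenbauerQ_four (hn : 2 ≤ n) :
    gegenbauerQ n 4 = Polynomial.C ((n : ℝ) * (n + 6) / 24) *
      (Polynomial.C (((n : ℝ) + 4) * (n + 2)) * Polynomial.X ^ 4
        - Polynomial.C (6 * ((n : ℝ) + 2)) * Polynomial.X ^ 2 + Polynomial.C 3) := by
  have hn' : (2 : ℝ) ≤ n := by exact_mod_cast hn
  have h1 : (n : ℝ) - 1 ≠ 0 := by linarith
  have h2 : (n : ℝ) ≠ 0 := by linarith
  have h3 : (n : ℝ) + 1 ≠ 0 := by linarith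
  apply Polynomial.funext
  intro x
  have p2 : (gegenbauerUnit n 2).eval x = (n * x ^ 2 - 1) / (n - 1) := by
    simp [gegenbauerUnit]
    field_simp
  have p3 : (gegenbauerUnit n 3).eval x = ((n + 2) * x ^ 3 - 3 * x) / (n - 1) := by
    rw [gegenbauerUnit]
    simp only [Polynomial.eval_mul, Polynomial.eval_sub, Polynomial.eval_C, Polynomial.eval_X]
    rw [p2, gegenbauerUnit]
    simp
    field_simp
    ring
  -- The denominator n² − 1 cancels against the dimension of the harmonic quartics.
  have p4 : (gegenbauerUnit n 4).eval x =
      ((n + 4) * (n + 2) * x ^ 4 - 6 * (n + 2) * x ^ 2 + 3) / ((n - 1) * (n + 1)) := by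
    rw [gegenbauerUnit]
    simp only [Polynomial.eval_mul, Polynomial.eval_sub, Polynomial.eval_C, Polynomial.eval_X]
    rw [p2, p3]
    have h4 : (2 : ℝ) + n - 1 = n + 1 := by ring
    push_cast
    rw [h4]
    field_simp
    ring
  rw [gegenbauerQ, Polynomial.eval_mul, Polynomial.eval_C, p4, finrank_harmonicSpace]
  simp
  field_simp
  ring

/-- The zeros of the Gegenbauer polynomial of degree four in terms of the zonal kernel. -/
lemma isRoot_gegenbauerQ_four (hn : 2 ≤ n) {x y : E n} {r s : ℝ} (hr : 0 < r) (hs : 0 < s)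
    (hx : ‖x‖ = r) (hy : ‖y‖ = s) (h : zonalFour x y = 0) :
    (gegenbauerQ n 4).IsRoot (inner ℝ x y / (r * s)) := by
  rw [Polynomial.IsRoot.def, gegenbauerQ_four hn]
  rw [zonalFour, hx, hy] at h
  simp only [Polynomial.eval_mul, Polynomial.eval_add, Polynomial.eval_sub, Polynomial.eval_C,
    Polynomial.eval_pow, Polynomial.eval_X]
  have hr4 := hr.ne'
  have hs4 := hs.ne'
  rw [← zero_div ((r * s) ^ 4), ← h]
  field_simp

end EuclideanDesign

end

open EuclideanDesign

/-! ### The classification theorem -/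

theorem theorem1p1 (n : ℕ) (hn : 2 ≤ n) :
    (gegenbauerQ n 4 = Polynomial.C ((n : ℝ) * (n + 6) / 24) *
      (Polynomial.C (((n : ℝ) + 4) * (n + 2)) * Polynomial.X ^ 4
        - Polynomial.C (6 * ((n : ℝ) + 2)) * Polynomial.X ^ 2 + Polynomial.C 3)) ∧
    (∀ (X : Finset (E n)) (w : E n → ℝ) (r₁ r₂ : ℝ), 0 < r₁ → 0 < r₂ → radii X = {r₁, r₂} →
      IsTightDesign 9 2 X w →
        (∀ x ∈ X, -x ∈ X) ∧
        (∀ x ∈ layer X r₁, ∀ y ∈ layer X r₂,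
          (gegenbauerQ n 4).IsRoot (inner ℝ x y / (r₁ * r₂))) ∧
        n = 2 ∧
        ∃ w₁ : ℝ, 0 < w₁ ∧
          WeightedSimilar X w (octagonPair r₁ r₂) (octagonWeight r₁ r₂ w₁)) ∧
    (∀ r₁ r₂ w₁ : ℝ, 0 < r₁ → 0 < r₂ → r₁ ≠ r₂ → 0 < w₁ →
      IsTightDesign 9 2 (octagonPair r₁ r₂) (octagonWeight r₁ r₂ w₁)) := by
  refine ⟨gegenbauerQ_four hn, fun X w r₁ r₂ h₁ h₂ hX hT => ?_,
    fun r₁ r₂ w₁ h₁ h₂ hne hw => octagonPair_isTightDesign h₁ h₂ hne hw⟩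
  have hne : r₁ ≠ r₂ := by
    rintro rfl
    have := hT.card_radii
    simp [hX] at this
  have hD : TwoSphereDesign X w r₁ r₂ := ⟨hn, h₁, h₂, hne, hX, hT.design⟩
  have hcard : X.card = 2 * Module.finrank ℝ (polySpaceStar 4 (sphereUnion X)) := by
    have := hT.card_eq
    -- Since 9 is odd and positive radii exclude the origin, the applicable bound is the one without
    -- the correction by one.
    rwa [moellerBound, if_neg (by decide), if_neg (fun h => hD.ne_zero h.2 rfl)] at this
  refine ⟨fun x hx => hD.neg_mem hcard hx, fun x hx y hy => ?_, ?_⟩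
  · obtain ⟨hxX, hxr⟩ := Finset.mem_filter.1 hx
    obtain ⟨hyX, hyr⟩ := Finset.mem_filter.1 hy
    exact isRoot_gegenbauerQ_four hn h₁ h₂ hxr hyr
      (hD.zonalFour_eq_zero hcard hxX hyX (by rw [hxr, hyr]; exact hne))
  · obtain rfl := hD.eq_two hcard
    exact ⟨rfl, hD.weightedSimilar hcard⟩
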